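/- Let $k$ be a field and $\otimes=\otimes_k$. A dual quasi-Hopf algebra is a coassociative counital coalgebra $(H,\Delta,\varepsilon)$ with a bilinear multiplication and a unit $1$ ($1a=a=a1$) that are coalgebra morphisms, a convolution-invertible $\sigma\in(H\otimes H\otimes H)^*$, a coalgebra anti-morphism $s:H\to H$ and $\alpha,\beta\in H^*$ such that, in Sweedler notation, $$a_1(b_1c_1)\,\sigma(a_2,b_2,c_2)=\sigma(a_1,b_1,c_1)\,(a_2b_2)c_2,\qquad \sigma(a,1,b)=\varepsilon(a)\varepsilon(b),$$ $$\sigma(a_1,b_1,c_1d_1)\sigma(a_2b_2,c_2,d_2)=\sigma(b_1,c_1,d_1)\sigma(a_1,b_2c_2,d_2)\sigma(a_2,b_3,c_3),$$ $$s(h_1)\alpha(h_2)h_3=\alpha(h)1,\qquad h_1\beta(h_2)s(h_3)=\beta(h)1,$$ $$\sigma(h_1,s(h_3),h_5)\beta(h_2)\alpha(h_4)=\varepsilon(h)=\sigma^{-1}(s(h_1),h_3,s(h_5))\alpha(h_2)\beta(h_4).$$ Put $$\lambda(a,b)=\nu(s(b_1),s(a_1),a_3,b_3)\alpha(a_2)\alpha(b_2),\quad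 \nu(a,b,c,d)=\sigma(a_1,b_1,c_1)\sigma^{-1}(a_2b_2,c_2,d),$$ $$\chi(a,b)=\mu(a_1,b_1,s(b_3),s(a_3))\beta(a_2)\beta(b_2),\quad \mu(a,b,c,d)=\sigma(a_1b_1,c_1,d)\sigma^{-1}(a_2,b_2,c_2),$$ $$f(a,b)=\sigma^{-1}(s(b_1)s(a_1),a_3b_3,s(a_5b_5))\,\lambda(a_2,b_2)\,\beta(a_4b_4),$$ $$g(a,b)=\sigma^{-1}(s(a_1b_1),a_3b_3,s(b_5)s(a_5))\,\chi(a_4,b_4)\,\alpha(a_2b_2).$$ A left-left Yetter-Drinfeld module over $H$ is a left $H$-comodule $M$, $m\mapsto m_{(-1)}\otimes m_{(0)}$, with a bilinear map $H\times M\to M$, $(h,m)\mapsto h\cdot m$, such that for all $h,g\in H$ and $m\in M$ $$\sigma(h_1,g_1,m_{(-1)})\,\sigma((h_2g_2\cdot m_{(0)})_{(-1)},h_3,g_3)\,(h_2g_2\cdot m_{(0)})_{(0)}=\sigma(h_1,(g_1\cdot m)_{(-1)},g_2)\,h_2\cdot(g_1\cdot m)_{(0)},$$ $$1\cdot m=m,\qquad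 h_1m_{(-1)}\otimes h_2\cdot m_{(0)}=(h_1\cdot m)_{(-1)}h_2\otimes(h_1\cdot m)_{(0)}.$$ Morphisms are the $H$-linear, $H$-colinear maps; ${}^H_H\mathcal{YD}^{fd}$ is the category of the finite-dimensional ones. **Theorem.** Let $H$ be a dual quasi-Hopf algebra whose antipode $s$ is bijective. Then ${}^H_H\mathcal{YD}^{fd}$ is a rigid braided monoidal category. Its tensor product is $M\otimes N$, with $k$-linear tensor product of morphisms, coaction $m\otimes n\mapsto m_{(-1)}n_{(-1)}\otimes(m_{(0)}\otimes n_{(0)})$ and action $$\begin{aligned}h\cdot(m\otimes n)={}&\sigma(h_1,m_{(-1)},n_{(-1)1})\,\sigma^{-1}((h_2\cdot m_{(0)})_{(-1)1},h_3,n_{(-1)2})\\&\sigma((h_2\cdot m_{(0)})_{(-1)2},(h_4\cdot n_{(0)})_{(-1)},h_5)\,(h_2\cdot m_{(0)})_{(0)}\otimes(h_4\cdot n_{(0)})_{(0)};\end{aligned}$$ its unit object is $k$ with coaction $c\mapsto 1\otimes c$ and action $h\cdot c=\varepsilon(h)c$, with the usual unit constraints; its associativity constraint is $(m\otimes n)\otimes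 p\mapsto\sigma^{-1}(m_{(-1)},n_{(-1)},p_{(-1)})\,m_{(0)}\otimes(n_{(0)}\otimes p_{(0)})$; and its braiding $N\otimes M\to M\otimes N$ is $n\otimes m\mapsto n_{(-1)}\cdot m\otimes n_{(0)}$. Let moreover $M$ be an object with basis $\{m_i\}$ and dual basis $\{m^i\}$. Then the following structures make $\mathrm{Hom}(M,k)$ a Yetter-Drinfeld module (sums over $i$ understood): 1. for ${}^*M$: the coaction is $\varphi\mapsto\varphi(m_{i(0)})\,s(m_{i(-1)})\otimes m^i$ and $$h\cdot\varphi=f(s^{-1}(h_3),m_{i(-1)})\;g\big((s^{-1}(h_2)\cdot m_{i(0)})_{(-1)},s^{-1}(h_1)\big)\;\varphi\big((s^{-1}(h_2)\cdot m_{i(0)})_{(0)}\big)\,m^i;$$ 2. for $M^*$: the coaction is $\varphi\mapsto\varphi(m_{i(0)})\,s^{-1}(m_{i(-1)})\otimes m^i$ and $$h\cdot\varphi=f(s^{-1}(m_{i(-1)}),h_3)\;g\big(h_1,s^{-1}((s(h_2)\cdot m_{i(0)})_{(-1)})\big)\;\varphi\big((s(h_2)\cdot m_{i(0)})_{(0)}\big)\,m^i.$$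 In this monoidal category, ${}^*M$ is a right dual of $M$ (there are morphisms $M\otimes{}^*M\to k$ and $k\to{}^*M\otimes M$ satisfying the triangle identities) and $M^*$ is a left dual of $M$ (there are morphisms $M^*\otimes M\to k$ and $k\to M\otimes M^*$ satisfying the triangle identities). -/

import Mathlib

open scoped TensorProduct
open CategoryTheory MonoidalCategory Coalgebra

universe u v

/-! ### Sweedler sums -/

/-- Sweedler sum `∑ F a b` over a chosen finite decomposition `t = ∑ a ⊗ b`. It is used below only
for `F` bilinear, where it does not depend on the decomposition (see `sweedler_eq_lift`). -/
noncomputable def sweedler {k A B V : Type*} [CommSemiring k] [AddCommMonoid A] [Module k A]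
    [AddCommMonoid B] [Module k B] [AddCommMonoid V] (t : A ⊗[k] B) (F : A → B → V) : V :=
  ∑ p ∈ (TensorProduct.exists_finset t).choose, F p.1 p.2

theorem sweedler_eq_lift {k A B V : Type*} [CommSemiring k] [AddCommMonoid A] [Module k A]
    [AddCommMonoid B] [Module k B] [AddCommMonoid V] [Module k V] (t : A ⊗[k] B)
    (F : A →ₗ[k] B →ₗ[k] V) :
    sweedler t (fun a b => F a b) = TensorProduct.lift F t := by
  conv_rhs => rw [(TensorProduct.exists_finset t).choose_spec]
  simp [sweedler, map_sum]

section Coproducts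

variable (k : Type*) {H V : Type*} [CommSemiring k] [AddCommMonoid H] [Module k H]
  [Coalgebra k H] [AddCommMonoid V]

/-- `∑ F h₁ h₂` for `Δ(h) = ∑ h₁ ⊗ h₂`. -/
noncomputable def cop2 (h : H) (F : H → H → V) : V :=
  sweedler (comul (R := k) h) F

/-- `∑ F h₁ h₂ h₃` over the twofold iterated comultiplication of `h`. -/
noncomputable def cop3 (h : H) (F : H → H → H → V) : V :=
  cop2 k h fun h₁ h' => cop2 k h' fun h₂ h₃ => F h₁ h₂ h₃

/-- `∑ F h₁ h₂ h₃ h₄ h₅` over the fourfold iterated comultiplication of `h`. -/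
noncomputable def cop5 (h : H) (F : H → H → H → H → H → V) : V :=
  cop3 k h fun h₁ h₂ h' => cop3 k h' fun h₃ h₄ h₅ => F h₁ h₂ h₃ h₄ h₅

end Coproducts

/-! ### Dual quasi-Hopf algebras -/

/-- A dual quasi-Hopf algebra over the field `k`: a coalgebra `H` with a unital, not necessarily
associative, bilinear multiplication, such that multiplication and unit are coalgebra morphisms,
together with a convolution invertible reassociator `σ` and an antipode `(s, α, β)`. -/
class DualQuasiHopfAlgebra (k : Type*) (H : Type*) [Field k] [NonAssocRing H] [Module k H]
    [IsScalarTower k H H] [SMulCommClass k H H] [Coalgebra k H] where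
  counit_mul : ∀ a b : H, counit (R := k) (a * b) = counit (R := k) a * counit (R := k) b
  comul_mul : ∀ a b : H, comul (R := k) (a * b) =
    cop2 k a fun a₁ a₂ => cop2 k b fun b₁ b₂ => (a₁ * b₁) ⊗ₜ[k] (a₂ * b₂)
  counit_one : counit (R := k) (1 : H) = 1
  comul_one : comul (R := k) (1 : H) = 1 ⊗ₜ[k] 1
  /-- the reassociator, an element of `(H ⊗ H ⊗ H)*` -/
  σ : H →ₗ[k] H →ₗ[k] H →ₗ[k] k
  /-- the convolution inverse of the reassociator -/
  σinv : H →ₗ[k] H →ₗ[k] H →ₗ[k] k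
  σ_mul_σinv : ∀ a b c : H,
    (cop2 k a fun a₁ a₂ => cop2 k b fun b₁ b₂ => cop2 k c fun c₁ c₂ =>
      σ a₁ b₁ c₁ * σinv a₂ b₂ c₂) =
    counit (R := k) a * counit (R := k) b * counit (R := k) c
  σinv_mul_σ : ∀ a b c : H,
    (cop2 k a fun a₁ a₂ => cop2 k b fun b₁ b₂ => cop2 k c fun c₁ c₂ =>
      σinv a₁ b₁ c₁ * σ a₂ b₂ c₂) =
    counit (R := k) a * counit (R := k) b * counit (R := k) c
  quasi_assoc : ∀ a b c : H,
    (cop2 k a fun a₁ a₂ => cop2 k b fun b₁ b₂ => cop2 k c fun c₁ c₂ =>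
      σ a₂ b₂ c₂ • (a₁ * (b₁ * c₁))) =
    cop2 k a fun a₁ a₂ => cop2 k b fun b₁ b₂ => cop2 k c fun c₁ c₂ =>
      σ a₁ b₁ c₁ • ((a₂ * b₂) * c₂)
  cocycle : ∀ a b c d : H,
    (cop2 k a fun a₁ a₂ => cop2 k b fun b₁ b₂ => cop2 k c fun c₁ c₂ => cop2 k d fun d₁ d₂ =>
      σ a₁ b₁ (c₁ * d₁) * σ (a₂ * b₂) c₂ d₂) =
    cop2 k a fun a₁ a₂ => cop3 k b fun b₁ b₂ b₃ => cop3 k c fun c₁ c₂ c₃ =>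
      cop2 k d fun d₁ d₂ => σ b₁ c₁ d₁ * σ a₁ (b₂ * c₂) d₂ * σ a₂ b₃ c₃
  σ_one : ∀ a b : H, σ a 1 b = counit (R := k) a * counit (R := k) b
  /-- the antipode -/
  antipode : H →ₗ[k] H
  α : H →ₗ[k] k
  β : H →ₗ[k] k
  counit_s : ∀ h : H, counit (R := k) (antipode h) = counit (R := k) h
  comul_s : ∀ h : H, comul (R := k) (antipode h) = cop2 k h fun h₁ h₂ => antipode h₂ ⊗ₜ[k] antipode h₁
  s_α : ∀ h : H, (cop3 k h fun h₁ h₂ h₃ => α h₂ • (antipode h₁ * h₃)) = α h • (1 : H)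
  β_s : ∀ h : H, (cop3 k h fun h₁ h₂ h₃ => β h₂ • (h₁ * antipode h₃)) = β h • (1 : H)
  σ_antipode : ∀ h : H,
    (cop5 k h fun h₁ h₂ h₃ h₄ h₅ => β h₂ * α h₄ * σ h₁ (antipode h₃) h₅) = counit (R := k) h
  σinv_antipode : ∀ h : H,
    (cop5 k h fun h₁ h₂ h₃ h₄ h₅ => α h₂ * β h₄ * σinv (antipode h₁) h₃ (antipode h₅)) = counit (R := k) h

namespace DualQuasiHopfAlgebra

variable (k : Type u) {H : Type v} [Field k] [NonAssocRing H] [Module k H]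
  [IsScalarTower k H H] [SMulCommClass k H H] [Coalgebra k H] [DualQuasiHopfAlgebra k H]

/-- The antipode `s`, with the base field explicit. -/
abbrev s : H →ₗ[k] H := antipode

/-- The inverse of a bijective antipode. -/
noncomputable def sInv (hs : Function.Bijective (s k : H →ₗ[k] H)) : H →ₗ[k] H :=
  (LinearEquiv.ofBijective (s k : H →ₗ[k] H) hs).symm

/-- `ν(a,b,c,d) = σ(a₁,b₁,c₁) σ⁻¹(a₂b₂,c₂,d)`. -/
noncomputable def nu (a b c d : H) : k :=
  cop2 k a fun a₁ a₂ => cop2 k b fun b₁ b₂ => cop2 k c fun c₁ c₂ =>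
    σ a₁ b₁ c₁ * σinv (a₂ * b₂) c₂ d

/-- `μ(a,b,c,d) = σ(a₁b₁,c₁,d) σ⁻¹(a₂,b₂,c₂)`. -/
noncomputable def mu (a b c d : H) : k :=
  cop2 k a fun a₁ a₂ => cop2 k b fun b₁ b₂ => cop2 k c fun c₁ c₂ =>
    σ (a₁ * b₁) c₁ d * σinv a₂ b₂ c₂

/-- `λ(a,b) = ν(s(b₁),s(a₁),a₃,b₃) α(a₂) α(b₂)`. -/
noncomputable def lam (a b : H) : k :=
  cop3 k a fun a₁ a₂ a₃ => cop3 k b fun b₁ b₂ b₃ =>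
    nu k (s k b₁) (s k a₁) a₃ b₃ * α a₂ * α b₂

/-- `χ(a,b) = μ(a₁,b₁,s(b₃),s(a₃)) β(a₂) β(b₂)`. -/
noncomputable def chi (a b : H) : k :=
  cop3 k a fun a₁ a₂ a₃ => cop3 k b fun b₁ b₂ b₃ =>
    mu k a₁ b₁ (s k b₃) (s k a₃) * β a₂ * β b₂

/-- The twist `f(a,b) = σ⁻¹(s(b₁)s(a₁), a₃b₃, s(a₅b₅)) λ(a₂,b₂) β(a₄b₄)`. -/
noncomputable def twistF (a b : H) : k :=
  cop5 k a fun a₁ a₂ a₃ a₄ a₅ => cop5 k b fun b₁ b₂ b₃ b₄ b₅ =>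
    σinv (s k b₁ * s k a₁) (a₃ * b₃) (s k (a₅ * b₅)) * lam k a₂ b₂ * β (a₄ * b₄)

/-- The twist `g(a,b) = σ⁻¹(s(a₁b₁), a₃b₃, s(b₅)s(a₅)) χ(a₄,b₄) α(a₂b₂)`. -/
noncomputable def twistG (a b : H) : k :=
  cop5 k a fun a₁ a₂ a₃ a₄ a₅ => cop5 k b fun b₁ b₂ b₃ b₄ b₅ =>
    σinv (s k (a₁ * b₁)) (a₃ * b₃) (s k b₅ * s k a₅) * chi k a₄ b₄ * α (a₂ * b₂)

end DualQuasiHopfAlgebra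

open DualQuasiHopfAlgebra

/-! ### Left-left Yetter-Drinfeld modules -/

/-- The structure of a left-left Yetter-Drinfeld module over `H` on the vector space `M`: a left
`H`-comodule structure `coact` and a bilinear (not associative) action `act`. In Sweedler sums over
`coact m` we write `m₁` for `m₍₋₁₎` and `m₀` for `m₍₀₎`. -/
structure YetterDrinfeld (k : Type u) (H : Type v) [Field k] [NonAssocRing H] [Module k H]
    [IsScalarTower k H H] [SMulCommClass k H H] [Coalgebra k H] [DualQuasiHopfAlgebra k H]
    (M : Type*) [AddCommGroup M] [Module k M] where
  coact : M →ₗ[k] H ⊗[k] M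
  act : H →ₗ[k] M →ₗ[k] M
  counit_coact : ∀ m, (counit (R := k) (A := H)).rTensor M (coact m) = 1 ⊗ₜ[k] m
  coassoc_coact : ∀ m, TensorProduct.assoc k H H M ((comul (R := k)).rTensor M (coact m)) =
    coact.lTensor H (coact m)
  act_act : ∀ (h g : H) (m : M),
    (cop3 k h fun h₁ h₂ h₃ => cop3 k g fun g₁ g₂ g₃ => sweedler (coact m) fun m₁ m₀ =>
      sweedler (coact (act (h₂ * g₂) m₀)) fun p₁ p₀ =>
        (σ h₁ g₁ m₁ * σ p₁ h₃ g₃ : k) • p₀) =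
    cop2 k h fun h₁ h₂ => cop2 k g fun g₁ g₂ => sweedler (coact (act g₁ m)) fun p₁ p₀ =>
      (σ h₁ p₁ g₂ : k) • act h₂ p₀
  one_act : ∀ m, act 1 m = m
  compat : ∀ (h : H) (m : M),
    (cop2 k h fun h₁ h₂ => sweedler (coact m) fun m₁ m₀ => (h₁ * m₁) ⊗ₜ[k] act h₂ m₀) =
    cop2 k h fun h₁ h₂ => sweedler (coact (act h₁ m)) fun p₁ p₀ => (p₁ * h₂) ⊗ₜ[k] p₀

/-- A finite-dimensional left-left Yetter-Drinfeld module over `H`. -/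
structure FdYD (k : Type u) (H : Type v) [Field k] [NonAssocRing H] [Module k H]
    [IsScalarTower k H H] [SMulCommClass k H H] [Coalgebra k H] [DualQuasiHopfAlgebra k H] where
  carrier : Type u
  [addCommGroup : AddCommGroup carrier]
  [module : Module k carrier]
  [finite : FiniteDimensional k carrier]
  yd : YetterDrinfeld k H carrier

namespace FdYD

variable {k : Type u} {H : Type v} [Field k] [NonAssocRing H] [Module k H]
  [IsScalarTower k H H] [SMulCommClass k H H] [Coalgebra k H] [DualQuasiHopfAlgebra k H]

attribute [instance] addCommGroup module finite

instance : CoeSort (FdYD k H) (Type u) := ⟨carrier⟩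

/-- The left coaction `m ↦ m₍₋₁₎ ⊗ m₍₀₎`. -/
abbrev coact (M : FdYD k H) : M →ₗ[k] H ⊗[k] M := M.yd.coact

/-- The left action `h · m`. -/
abbrev act (M : FdYD k H) : H →ₗ[k] M →ₗ[k] M := M.yd.act

/-- Morphisms are the linear maps that are both `H`-colinear and `H`-linear. -/
@[ext]
structure Hom (M N : FdYD k H) where
  lin : M →ₗ[k] N
  map_coact : ∀ m, N.coact (lin m) = lin.lTensor H (M.coact m)
  map_act : ∀ h m, lin (M.act h m) = N.act h (lin m)

instance : Category (FdYD k H) where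
  Hom := Hom
  id M := ⟨LinearMap.id, fun m => by simp, fun _ _ => rfl⟩
  comp f g := ⟨g.lin ∘ₗ f.lin,
    fun m => by simp [g.map_coact, f.map_coact, LinearMap.lTensor_comp_apply],
    fun h m => by simp [f.map_act, g.map_act]⟩

/-- `StandardTensor` says that a monoidal structure on the category of finite-dimensional
Yetter-Drinfeld modules is the standard one: through the linear isomorphisms `μ` and `η` the
underlying space of `M ⊗ N` is the tensor product over `k` with the diagonal coaction and the action
below, the unit object is `k` with the trivial structures, tensor products of morphisms and unit
constraints are those of vector spaces, and the associativity constraint is given by `σ⁻¹`. -/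
structure StandardTensor [MonoidalCategory (FdYD k H)] where
  μ : ∀ M N : FdYD k H, (M ⊗[k] N) ≃ₗ[k] (M ⊗ N : FdYD k H)
  η : k ≃ₗ[k] (𝟙_ (FdYD k H) : FdYD k H)
  coact_tensor : ∀ (M N : FdYD k H) (m : M) (n : N),
    (M ⊗ N : FdYD k H).coact (μ M N (m ⊗ₜ[k] n)) =
      sweedler (M.coact m) fun m₁ m₀ => sweedler (N.coact n) fun n₁ n₀ =>
        (m₁ * n₁) ⊗ₜ[k] μ M N (m₀ ⊗ₜ[k] n₀)
  act_tensor : ∀ (M N : FdYD k H) (h : H) (m : M) (n : N),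
    (M ⊗ N : FdYD k H).act h (μ M N (m ⊗ₜ[k] n)) =
      cop5 k h fun h₁ h₂ h₃ h₄ h₅ =>
      sweedler (M.coact m) fun m₁ m₀ =>
      sweedler (N.coact n) fun n' n₀ => cop2 k n' fun n₁ n₂ =>
      sweedler (M.coact (M.act h₂ m₀)) fun p' p₀ => cop2 k p' fun p₁ p₂ =>
      sweedler (N.coact (N.act h₄ n₀)) fun q₁ q₀ =>
        (σ h₁ m₁ n₁ * σinv p₁ h₃ n₂ * σ p₂ q₁ h₅ : k) • μ M N (p₀ ⊗ₜ[k] q₀)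
  coact_unit : ∀ c : k, (𝟙_ (FdYD k H)).coact (η c) = (1 : H) ⊗ₜ[k] η c
  act_unit : ∀ (h : H) (c : k), (𝟙_ (FdYD k H)).act h (η c) = η (counit (R := k) h * c)
  tensorHom_lin : ∀ {M M' N N' : FdYD k H} (f : M ⟶ M') (g : N ⟶ N') (m : M) (n : N),
    Hom.lin (f ⊗ₘ g) (μ M N (m ⊗ₜ[k] n)) = μ M' N' (Hom.lin f m ⊗ₜ[k] Hom.lin g n)
  associator_lin : ∀ (M N P : FdYD k H) (m : M) (n : N) (p : P),
    Hom.lin (α_ M N P).hom (μ (M ⊗ N) P (μ M N (m ⊗ₜ[k] n) ⊗ₜ[k] p)) =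
      sweedler (M.coact m) fun m₁ m₀ => sweedler (N.coact n) fun n₁ n₀ =>
      sweedler (P.coact p) fun p₁ p₀ =>
        (σinv m₁ n₁ p₁ : k) • μ M (N ⊗ P) (m₀ ⊗ₜ[k] μ N P (n₀ ⊗ₜ[k] p₀))
  leftUnitor_lin : ∀ (M : FdYD k H) (c : k) (m : M),
    Hom.lin (λ_ M).hom (μ (𝟙_ (FdYD k H)) M (η c ⊗ₜ[k] m)) = c • m
  rightUnitor_lin : ∀ (M : FdYD k H) (m : M) (c : k),
    Hom.lin (ρ_ M).hom (μ M (𝟙_ (FdYD k H)) (m ⊗ₜ[k] η c)) = c • m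

/-- `L` is a left dual of `V`: there are `ev : L ⊗ V ⟶ I` and `coev : I ⟶ V ⊗ L` satisfying the
triangle identities. (Mathlib calls this a right dual.) -/
def IsLeftDual {C : Type*} [Category C] [MonoidalCategory C] (L V : C) : Prop :=
  Nonempty (ExactPairing V L)

/-- `R` is a right dual of `V`: there are `ev' : V ⊗ R ⟶ I` and `coev' : I ⟶ R ⊗ V` satisfying the
triangle identities. (Mathlib calls this a left dual.) -/
def IsRightDual {C : Type*} [Category C] [MonoidalCategory C] (R V : C) : Prop :=
  Nonempty (ExactPairing R V)

end FdYD

/-!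
The category `FdComod k H` of finite-dimensional left `H`-comodules is monoidal: the tensor product
carries the diagonal coaction and the associativity constraint is given by `σ⁻¹`.
Quasi-associativity of the multiplication says that the constraint is colinear, the cocycle
condition on `σ` is the pentagon (`pentagon_lin_inv`), and the antipode axioms say that every
comodule has a dual (`dualPairing`). As the antipode is bijective, every comodule is also isomorphic
to a dual, so there are duals on both sides (`codualPairing`).

An action of `H` on a comodule `M` gives maps `u ⊗ m ↦ u₍₋₁₎ · m ⊗ u₍₀₎` from `U ⊗ M` to `M ⊗ U` for
all comodules `U`, natural in `U`. The axioms of a Yetter-Drinfeld module say exactly that these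
maps are colinear (`compat_iff`, `braid_colinear_iff`) and compatible with tensor products
(`act_act_iff`, `hexagon_iff`). The converse direction uses that every element of `H` is a matrix
coefficient of a finite-dimensional comodule (`exists_coefficient`). Since `U` has a dual, the maps
are invertible (`LaxHalfBraiding.halfBraiding`). So Yetter-Drinfeld modules form a full subcategory
of the Drinfeld centre of `FdComod k H` (`toCenter`). It is closed under tensor products
(`braid_tensorAct`), and its monoidal structure and braiding are induced from the centre. The
half-braiding of the centre is the inverse of the map above, so the braiding is the reverse of that
of the centre.

A dual of the underlying comodule of an object of the centre carries a half-braiding that makes it a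
dual in the centre, namely the mate of the given one (`Center.leftDualPairing`). The braiding of the
centre then provides the dual on the other side (`Center.exists_rightDual`). It remains to see that
these half-braidings come from the stated actions. By `halfBraiding_dual_formula` the half-braiding
of the dual is the transpose of that of `M`, up to the comparison maps between the dual of `X ⊗ Y`
and the tensor product of the duals of `Y` and `X`. In the formula for the comparison maps a
coevaluation and an evaluation are composed through `σ⁻¹`; writing this out gives the transposes of
the operators attached to `f` and `g` (`dualTwistF_lin`, `dualTwistG_lin`). Here `λ` and `χ` come
from the coevaluation and the evaluation of a tensor product.

Sweedler sums are avoided in most of the proof. A coaction `δ` on `U` is encoded by the operators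
`op δ φ : u ↦ φ(u₍₋₁₎) u₍₀₎`, which form a representation of the convolution algebra of functionals,
and identities in `H` become identities between functionals.
-/

open ExactPairing

/-! ### Half-braidings and duals -/

namespace CategoryTheory

universe v₁ u₁
variable {C : Type u₁} [Category.{v₁} C] [MonoidalCategory C]

/-- A half-braiding on `M` whose components `U ⊗ M ⟶ M ⊗ U` are not assumed invertible: a natural
family compatible with the unit object and with tensor products. -/
structure LaxHalfBraiding (M : C) where
  t : ∀ U : C, U ⊗ M ⟶ M ⊗ U
  naturality : ∀ {U V : C} (f : U ⟶ V), f ▷ M ≫ t V = t U ≫ M ◁ f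
  unit : t (𝟙_ C) = (λ_ M).hom ≫ (ρ_ M).inv
  tensor : ∀ U V : C, t (U ⊗ V) =
    (α_ U V M).hom ≫ U ◁ t V ≫ (α_ U M V).inv ≫ t U ▷ V ≫ (α_ M U V).hom

namespace LaxHalfBraiding

variable {M : C} (T : LaxHalfBraiding M)

/-- The candidate inverse of `T.t U`: the mate of `T.t V` under a duality between `U` and `V`. -/
def inv (U V : C) [ExactPairing U V] : M ⊗ U ⟶ U ⊗ M :=
  𝟙 _ ⊗≫ η_ U V ▷ (M ⊗ U) ⊗≫ U ◁ T.t V ▷ U ⊗≫ (U ⊗ M) ◁ ε_ U V ⊗≫ 𝟙 _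

theorem inv_comp (U V : C) [ExactPairing U V] : T.inv U V ≫ T.t U = 𝟙 _ := by
  calc
    _ = 𝟙 _ ⊗≫ η_ U V ▷ (M ⊗ U) ⊗≫ U ◁ T.t V ▷ U ⊗≫
          ((U ⊗ M) ◁ ε_ U V ≫ T.t U ▷ 𝟙_ C) ⊗≫ 𝟙 _ := by
      rw [inv]; monoidal
    _ = 𝟙 _ ⊗≫ η_ U V ▷ (M ⊗ U) ⊗≫ ((α_ U V M).hom ≫ U ◁ T.t V ≫ (α_ U M V).inv ≫
          T.t U ▷ V ≫ (α_ M U V).hom) ▷ U ⊗≫ (M ⊗ U) ◁ ε_ U V ⊗≫ 𝟙 _ := by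
      rw [whisker_exchange]; monoidal
    _ = 𝟙 _ ⊗≫ (η_ U V ▷ M ≫ T.t (U ⊗ V)) ▷ U ⊗≫ (M ⊗ U) ◁ ε_ U V ⊗≫ 𝟙 _ := by
      rw [T.tensor]; monoidal
    _ = 𝟙 _ ⊗≫ M ◁ (η_ U V ▷ U ⊗≫ U ◁ ε_ U V) ⊗≫ 𝟙 _ := by
      rw [T.naturality, T.unit]; monoidal
    _ = _ := by rw [evaluation_coevaluation'']; monoidal

theorem comp_inv (U V : C) [ExactPairing U V] : T.t U ≫ T.inv U V = 𝟙 _ := by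
  calc
    _ = 𝟙 _ ⊗≫ (𝟙_ C ◁ T.t U ≫ η_ U V ▷ (M ⊗ U)) ⊗≫ U ◁ T.t V ▷ U ⊗≫
          (U ⊗ M) ◁ ε_ U V ⊗≫ 𝟙 _ := by
      rw [inv]; monoidal
    _ = 𝟙 _ ⊗≫ η_ U V ▷ (U ⊗ M) ⊗≫ U ◁ ((α_ V U M).hom ≫ V ◁ T.t U ≫ (α_ V M U).inv ≫
          T.t V ▷ U ≫ (α_ M V U).hom) ⊗≫ (U ⊗ M) ◁ ε_ U V ⊗≫ 𝟙 _ := by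
      rw [whisker_exchange]; monoidal
    _ = 𝟙 _ ⊗≫ η_ U V ▷ (U ⊗ M) ⊗≫ U ◁ (T.t (V ⊗ U) ≫ M ◁ ε_ U V) ⊗≫ 𝟙 _ := by
      rw [T.tensor]; monoidal
    _ = 𝟙 _ ⊗≫ (η_ U V ▷ U ⊗≫ U ◁ ε_ U V) ▷ M ⊗≫ 𝟙 _ := by
      rw [← T.naturality, T.unit]; monoidal
    _ = _ := by rw [evaluation_coevaluation'']; monoidal

/-- If all objects have right duals, the components of a lax half-braiding are invertible. -/
def iso [∀ U : C, HasRightDual U] (U : C) : M ⊗ U ≅ U ⊗ M where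
  hom := T.inv U Uᘁ
  inv := T.t U
  hom_inv_id := T.inv_comp U Uᘁ
  inv_hom_id := T.comp_inv U Uᘁ

/-- The half-braiding `M ⊗ U ≅ U ⊗ M` whose inverse components are those of `T`. -/
def halfBraiding [∀ U : C, HasRightDual U] : HalfBraiding M where
  β U := T.iso U
  monoidal U V := by
    rw [← cancel_epi (T.iso (U ⊗ V)).inv, Iso.inv_hom_id]
    change _ = T.t (U ⊗ V) ≫ _
    rw [T.tensor]
    have h1 : ∀ U, T.t U ≫ (T.iso U).hom = 𝟙 _ := fun U => (T.iso U).inv_hom_id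
    simp only [Category.assoc, Iso.hom_inv_id_assoc]
    rw [← comp_whiskerRight_assoc, h1]
    simp only [id_whiskerRight, Category.id_comp, Iso.inv_hom_id_assoc]
    rw [← whiskerLeft_comp_assoc, h1]
    simp
  naturality {U V} f := by
    rw [← cancel_epi (T.iso U).inv, Iso.inv_hom_id_assoc, ← cancel_mono (T.iso V).inv]
    simp only [Category.assoc, Iso.hom_inv_id, Category.comp_id]
    exact (T.naturality f).symm

end LaxHalfBraiding

theorem HalfBraiding.unit_hom {M : C} (b : HalfBraiding M) :
    (b.β (𝟙_ C)).hom = (ρ_ M).hom ≫ (λ_ M).inv := by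
  have h := congrArg Center.Hom.f (braiding_tensorUnit_right (C := Center C) ⟨M, b⟩)
  exact h.trans (congrArg ((ρ_ M).hom ≫ ·) (Center.leftUnitor_inv_f (C := C) ⟨M, b⟩))

/-- The inverse components of a half-braiding form a lax half-braiding. -/
def HalfBraiding.toLax {M : C} (b : HalfBraiding M) : LaxHalfBraiding M where
  t U := (b.β U).inv
  naturality {U V} f := by
    rw [Iso.comp_inv_eq, Category.assoc, b.naturality, Iso.inv_hom_id_assoc]
  unit := by
    rw [← cancel_epi (b.β (𝟙_ C)).hom, Iso.hom_inv_id, b.unit_hom]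
    simp
  tensor U V := by
    rw [← cancel_epi (b.β (U ⊗ V)).hom, Iso.hom_inv_id, b.monoidal]
    simp

section Dual

variable (R : C) {M : C} [ExactPairing R M] (b : HalfBraiding M)

/-- The mate of the half-braiding of `M` under the duality between `R` and `M`. -/
def HalfBraiding.leftDualT (U : C) : U ⊗ R ⟶ R ⊗ U :=
  𝟙 _ ⊗≫ η_ R M ▷ (U ⊗ R) ⊗≫ R ◁ (b.β U).hom ▷ R ⊗≫ (R ⊗ U) ◁ ε_ R M ⊗≫ 𝟙 _

/-- The lax half-braiding on a left dual `R` of `M` induced by a half-braiding on `M`. -/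
def HalfBraiding.leftDual : LaxHalfBraiding R where
  t := b.leftDualT R
  naturality {U V} f := by
    calc
      _ = 𝟙 _ ⊗≫ (𝟙_ C ◁ (f ▷ R) ≫ η_ R M ▷ (V ⊗ R)) ⊗≫ R ◁ (b.β V).hom ▷ R ⊗≫
          (R ⊗ V) ◁ ε_ R M ⊗≫ 𝟙 _ := by rw [leftDualT]; monoidal
      _ = 𝟙 _ ⊗≫ η_ R M ▷ (U ⊗ R) ⊗≫ R ◁ (M ◁ f ≫ (b.β V).hom) ▷ R ⊗≫
          (R ⊗ V) ◁ ε_ R M ⊗≫ 𝟙 _ := by rw [whisker_exchange]; monoidal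
      _ = 𝟙 _ ⊗≫ η_ R M ▷ (U ⊗ R) ⊗≫ R ◁ (b.β U).hom ▷ R ⊗≫
          (R ◁ f ▷ (M ⊗ R) ≫ R ◁ V ◁ ε_ R M) ⊗≫ 𝟙 _ := by
        rw [b.naturality]; monoidal
      _ = _ := by rw [← MonoidalCategory.whiskerLeft_comp, ← whisker_exchange, leftDualT]; monoidal
  unit := by
    rw [leftDualT, b.unit_hom]
    calc
      _ = 𝟙 _ ⊗≫ (η_ R M ▷ R ⊗≫ R ◁ ε_ R M) ⊗≫ 𝟙 _ := by monoidal
      _ = _ := by rw [evaluation_coevaluation'']; monoidal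
  tensor U V := by
    symm
    calc
      _ = 𝟙 _ ⊗≫ U ◁ η_ R M ▷ (V ⊗ R) ⊗≫ U ◁ R ◁ (b.β V).hom ▷ R ⊗≫ U ◁ (R ⊗ V) ◁ ε_ R M ⊗≫
          η_ R M ▷ (U ⊗ R ⊗ V) ⊗≫ R ◁ (b.β U).hom ▷ (R ⊗ V) ⊗≫ R ◁ U ◁ ε_ R M ▷ V ⊗≫ 𝟙 _ := by
        simp only [leftDualT]; monoidal
      _ = 𝟙 _ ⊗≫ U ◁ η_ R M ▷ (V ⊗ R) ⊗≫ U ◁ R ◁ (b.β V).hom ▷ R ⊗≫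
          (𝟙_ C ◁ ((U ⊗ R ⊗ V) ◁ ε_ R M) ≫
          η_ R M ▷ ((U ⊗ R ⊗ V) ⊗ 𝟙_ C)) ⊗≫
          R ◁ (b.β U).hom ▷ (R ⊗ V) ⊗≫ R ◁ U ◁ ε_ R M ▷ V ⊗≫ 𝟙 _ := by
        monoidal
      _ = 𝟙 _ ⊗≫ U ◁ η_ R M ▷ (V ⊗ R) ⊗≫
          (𝟙_ C ◁ (U ◁ R ◁ (b.β V).hom ▷ R) ≫ η_ R M ▷ (U ⊗ (R ⊗ ((V ⊗ M) ⊗ R)))) ⊗≫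
          R ◁ ((M ⊗ U) ◁ (R ⊗ V) ◁ ε_ R M ≫ (b.β U).hom ▷ ((R ⊗ V) ⊗ 𝟙_ C)) ⊗≫
          R ◁ U ◁ ε_ R M ▷ V ⊗≫ 𝟙 _ := by
        rw [whisker_exchange]; monoidal
      _ = 𝟙 _ ⊗≫ (𝟙_ C ◁ (U ◁ η_ R M ▷ (V ⊗ R)) ≫
          η_ R M ▷ (U ⊗ ((R ⊗ M) ⊗ (V ⊗ R)))) ⊗≫
          R ◁ ((M ⊗ U) ◁ (R ◁ (b.β V).hom ▷ R) ≫ (b.β U).hom ▷ (R ⊗ ((V ⊗ M) ⊗ R))) ⊗≫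
          R ◁ U ◁ ((M ⊗ R) ◁ (V ◁ ε_ R M) ≫ ε_ R M ▷ (V ⊗ 𝟙_ C)) ⊗≫ 𝟙 _ := by
        rw [whisker_exchange, whisker_exchange]; monoidal
      _ = 𝟙 _ ⊗≫ η_ R M ▷ (U ⊗ (V ⊗ R)) ⊗≫
          R ◁ ((M ⊗ U) ◁ (η_ R M ▷ (V ⊗ R)) ≫ (b.β U).hom ▷ ((R ⊗ M) ⊗ (V ⊗ R))) ⊗≫
          R ◁ U ◁ ((M ⊗ R) ◁ ((b.β V).hom ▷ R) ≫ ε_ R M ▷ ((V ⊗ M) ⊗ R)) ⊗≫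
          R ◁ U ◁ V ◁ ε_ R M ⊗≫ 𝟙 _ := by
        rw [whisker_exchange, whisker_exchange, whisker_exchange]; monoidal
      _ = 𝟙 _ ⊗≫ η_ R M ▷ (U ⊗ (V ⊗ R)) ⊗≫
          R ◁ (b.β U).hom ▷ (V ⊗ R) ⊗≫
          R ◁ U ◁ (M ◁ η_ R M ⊗≫ ε_ R M ▷ M) ▷ (V ⊗ R) ⊗≫
          R ◁ U ◁ ((b.β V).hom ▷ R) ⊗≫
          R ◁ U ◁ V ◁ ε_ R M ⊗≫ 𝟙 _ := by
        rw [whisker_exchange, whisker_exchange]; monoidal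
      _ = _ := by
        rw [coevaluation_evaluation'', leftDualT, b.monoidal]; monoidal

variable [∀ U : C, HasRightDual U]

/-- The left dual of `(M, b)` in the centre. Right duals of all objects of `C` are needed to invert
the half-braiding. -/
def Center.leftDual : Center C := ⟨R, (b.leftDual R).halfBraiding⟩

/-- The duality between `R` and `M` lifts to the centre. -/
@[reducible]
def Center.leftDualPairing : ExactPairing (Center.leftDual R b) (⟨M, b⟩ : Center C) where
  coevaluation' := ⟨η_ R M, fun U => by
    have key : U ◁ η_ R M ≫ (α_ U R M).inv ≫ b.leftDualT R U ▷ M =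
        (ρ_ U).hom ≫ (λ_ U).inv ≫ η_ R M ▷ U ≫ (α_ R M U).hom ≫ R ◁ (b.β U).hom ≫
          (α_ R U M).inv := by
      calc
        _ = 𝟙 _ ⊗≫ (𝟙_ C ◁ (U ◁ η_ R M) ≫ η_ R M ▷ (U ⊗ (R ⊗ M))) ⊗≫
            R ◁ (b.β U).hom ▷ (R ⊗ M) ⊗≫ R ◁ U ◁ ε_ R M ▷ M ⊗≫ 𝟙 _ := by
          rw [HalfBraiding.leftDualT]; monoidal
        _ = 𝟙 _ ⊗≫ η_ R M ▷ U ⊗≫ R ◁ ((M ⊗ U) ◁ η_ R M ≫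
            (b.β U).hom ▷ (R ⊗ M)) ⊗≫ R ◁ U ◁ ε_ R M ▷ M ⊗≫ 𝟙 _ := by
          rw [whisker_exchange]; monoidal
        _ = 𝟙 _ ⊗≫ η_ R M ▷ U ⊗≫ R ◁ (b.β U).hom ⊗≫
            R ◁ U ◁ (M ◁ η_ R M ⊗≫ ε_ R M ▷ M) ⊗≫ 𝟙 _ := by
          rw [whisker_exchange]; monoidal
        _ = _ := by rw [coevaluation_evaluation'']; monoidal
    have h2 := ((b.leftDual R).iso U).inv_hom_id
    change η_ R M ▷ U ≫ (α_ R M U).hom ≫ R ◁ (b.β U).hom ≫ (α_ R U M).inv ≫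
      ((b.leftDual R).iso U).hom ▷ M ≫ (α_ U R M).hom =
        ((λ_ U).hom ≫ (ρ_ U).inv) ≫ U ◁ η_ R M
    simp only [Category.assoc]
    rw [← cancel_epi ((λ_ U).inv), ← cancel_epi (ρ_ U).hom]
    simp only [Iso.inv_hom_id_assoc, Iso.hom_inv_id_assoc]
    have key2 := key =≫ (((b.leftDual R).iso U).hom ▷ M ≫ (α_ U R M).hom)
    simp only [Category.assoc] at key2
    refine key2.symm.trans ?_
    rw [← comp_whiskerRight_assoc]
    erw [h2]
    simp⟩
  evaluation' := ⟨ε_ R M, fun U => by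
    have key : M ◁ b.leftDualT R U ≫ (α_ M R U).inv ≫ ε_ R M ▷ U =
        (α_ M U R).inv ≫ (b.β U).hom ▷ R ≫ (α_ U M R).hom ≫ U ◁ ε_ R M ≫
          (ρ_ U).hom ≫ (λ_ U).inv := by
      calc
        _ = 𝟙 _ ⊗≫ M ◁ η_ R M ▷ (U ⊗ R) ⊗≫ M ◁ R ◁ (b.β U).hom ▷ R ⊗≫
            ((M ⊗ R) ◁ (U ◁ ε_ R M) ≫ ε_ R M ▷ (U ⊗ 𝟙_ C)) ⊗≫ 𝟙 _ := by
          rw [HalfBraiding.leftDualT]; monoidal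
        _ = 𝟙 _ ⊗≫ M ◁ η_ R M ▷ (U ⊗ R) ⊗≫ ((M ⊗ R) ◁ ((b.β U).hom ▷ R) ≫
            ε_ R M ▷ ((U ⊗ M) ⊗ R)) ⊗≫ U ◁ ε_ R M ⊗≫ 𝟙 _ := by
          rw [whisker_exchange]; monoidal
        _ = 𝟙 _ ⊗≫ (M ◁ η_ R M ⊗≫ ε_ R M ▷ M) ▷ (U ⊗ R) ⊗≫ (b.β U).hom ▷ R ⊗≫
            U ◁ ε_ R M ⊗≫ 𝟙 _ := by
          rw [whisker_exchange]; monoidal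
        _ = _ := by rw [coevaluation_evaluation'']; monoidal
    have h2 := ((b.leftDual R).iso U).hom_inv_id
    change ε_ R M ▷ U ≫ (λ_ U).hom ≫ (ρ_ U).inv =
      ((α_ M R U).hom ≫ M ◁ ((b.leftDual R).iso U).hom ≫ (α_ M U R).inv ≫
        (b.β U).hom ▷ R ≫ (α_ U M R).hom) ≫ U ◁ ε_ R M
    simp only [Category.assoc]
    have key2 := ((α_ M R U).hom ≫ M ◁ ((b.leftDual R).iso U).hom) ≫= key
    simp only [Category.assoc] at key2
    rw [← whiskerLeft_comp_assoc] at key2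
    erw [h2] at key2
    rw [← cancel_mono ((ρ_ U).hom ≫ (λ_ U).inv)]
    simp only [MonoidalCategory.whiskerLeft_id, Category.id_comp, Iso.hom_inv_id_assoc,
      Category.assoc, Iso.inv_hom_id_assoc, Iso.hom_inv_id, Category.comp_id] at key2 ⊢
    exact key2⟩
  coevaluation_evaluation' := Center.ext _ _ <| by
    refine Eq.trans ?_ ((coevaluation_evaluation R M).trans
      (congrArg ((ρ_ M).hom ≫ ·) (Center.leftUnitor_inv_f (C := C) ⟨M, b⟩).symm))
    exact congrArg (M ◁ η_ R M ≫ · ≫ ε_ R M ▷ M)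
      (Center.associator_inv_f (C := C) ⟨M, b⟩ (Center.leftDual R b) ⟨M, b⟩)
  evaluation_coevaluation' := Center.ext _ _ <|
    (evaluation_coevaluation R M).trans
      (congrArg ((λ_ R).hom ≫ ·) (Center.rightUnitor_inv_f (Center.leftDual R b)).symm)

end Dual

/-- If an evaluation `X ⊗ Y ⟶ 𝟙_ C` intertwines half-braidings on `X` and `Y`, then the inverse
half-braidings of `X` with `U` and of `Y` with a dual `V` of `U` are transposes of each other. -/
theorem halfBraiding_dual_transpose {X Y : C} [ExactPairing Y X] (bX : HalfBraiding X)
    (bY : HalfBraiding Y)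
    (h : ∀ U, ε_ Y X ▷ U ≫ (λ_ U).hom ≫ (ρ_ U).inv = (α_ X Y U).hom ≫ X ◁ (bY.β U).hom ≫
      (α_ X U Y).inv ≫ (bX.β U).hom ▷ Y ≫ (α_ U X Y).hom ≫ U ◁ ε_ Y X)
    (V U : C) [ExactPairing V U] :
    (bX.β U).inv ▷ (V ⊗ Y) ≫ ε_ (V ⊗ Y) (X ⊗ U) =
      (U ⊗ X) ◁ (bY.β V).inv ≫ ε_ (Y ⊗ V) (U ⊗ X) := by
  have h' : U ◁ ε_ Y X = (α_ U X Y).inv ≫ (bX.β U).inv ▷ Y ≫ (α_ X U Y).hom ≫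
      X ◁ (bY.β U).inv ≫ (α_ X Y U).inv ≫ ε_ Y X ▷ U ≫ (λ_ U).hom ≫ (ρ_ U).inv := by
    rw [h U]
    simp
  rw [← cancel_epi ((U ⊗ X) ◁ (bY.β V).hom)]
  rw [← whiskerLeft_comp_assoc, Iso.hom_inv_id, MonoidalCategory.whiskerLeft_id, Category.id_comp]
  symm
  have hnat := bY.toLax.naturality (ε_ V U)
  rw [bY.toLax.unit, bY.toLax.tensor] at hnat
  have hnat' : ε_ V U ▷ Y = (α_ U V Y).hom ≫ U ◁ (bY.β V).inv ≫ (α_ U Y V).inv ≫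
      (bY.β U).inv ▷ V ≫ (α_ Y U V).hom ≫ Y ◁ ε_ V U ≫ (ρ_ Y).hom ≫ (λ_ Y).inv := by
    rw [← cancel_mono ((λ_ Y).hom ≫ (ρ_ Y).inv), hnat]
    simp [HalfBraiding.toLax]
  calc
    _ = 𝟙 _ ⊗≫ (U ◁ ε_ Y X) ▷ V ⊗≫ ε_ V U := by
      rw [ExactPairing.tensor_evaluation]; monoidal
    _ = 𝟙 _ ⊗≫ (bX.β U).inv ▷ (Y ⊗ V) ⊗≫ X ◁ (bY.β U).inv ▷ V ⊗≫
        (ε_ Y X ▷ (U ⊗ V) ≫ 𝟙_ C ◁ ε_ V U) ⊗≫ 𝟙 _ := by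
      rw [h']; monoidal
    _ = 𝟙 _ ⊗≫ (bX.β U).inv ▷ (Y ⊗ V) ⊗≫ X ◁ (bY.β U).inv ▷ V ⊗≫
        ((X ⊗ Y) ◁ ε_ V U ≫ ε_ Y X ▷ (𝟙_ C)) ⊗≫ 𝟙 _ := by
      rw [← whisker_exchange]
    _ = 𝟙 _ ⊗≫ (bX.β U).inv ▷ (Y ⊗ V) ⊗≫ (X ⊗ U) ◁ ((bY.β V).hom ≫ (bY.β V).inv) ⊗≫
         X ◁ (bY.β U).inv ▷ V ⊗≫
        (X ⊗ Y) ◁ ε_ V U ⊗≫ ε_ Y X ⊗≫ 𝟙 _ := by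
      rw [Iso.hom_inv_id]; monoidal
    _ = 𝟙 _ ⊗≫ ((bX.β U).inv ▷ (Y ⊗ V) ≫ (X ⊗ U) ◁ (bY.β V).hom) ⊗≫
        X ◁ ((α_ U V Y).hom ≫ U ◁ (bY.β V).inv ≫ (α_ U Y V).inv ≫
      (bY.β U).inv ▷ V ≫ (α_ Y U V).hom ≫ Y ◁ ε_ V U ≫ (ρ_ Y).hom ≫ (λ_ Y).inv) ⊗≫
        ε_ Y X ⊗≫ 𝟙 _ := by
      monoidal
    _ = _ := by
      rw [← hnat', ← whisker_exchange, ExactPairing.tensor_evaluation]; monoidal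

end CategoryTheory

/-! ### Operators attached to a coaction -/

namespace Coaction
variable {k : Type*} [Field k]
variable {D E U V W M N P : Type*}
  [AddCommGroup D] [Module k D] [AddCommGroup E] [Module k E]
  [AddCommGroup U] [Module k U] [AddCommGroup V] [Module k V] [AddCommGroup W] [Module k W]
  [AddCommGroup M] [Module k M] [AddCommGroup N] [Module k N] [AddCommGroup P] [Module k P]

/-- `d ⊗ u ↦ (m ↦ u ⊗ Φ d m)` -/
noncomputable def evalE (Φ : D →ₗ[k] M →ₗ[k] N) : D ⊗[k] U →ₗ[k] M →ₗ[k] U ⊗[k] N :=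
  TensorProduct.lift (LinearMap.mk₂ k (fun d u => TensorProduct.mk k U N u ∘ₗ Φ d)
    (by intros; ext; simp [TensorProduct.tmul_add]) (by intros; ext; simp)
    (by intros; ext; simp [TensorProduct.add_tmul])
    (by intros; ext; simp [TensorProduct.smul_tmul']))

@[simp] theorem evalE_tmul (Φ : D →ₗ[k] M →ₗ[k] N) (d : D) (u : U) (m : M) :
    evalE Φ (d ⊗ₜ[k] u) m = u ⊗ₜ[k] Φ d m := rfl

/-- The map `u ⊗ m ↦ u₍₀₎ ⊗ Φ(u₍₋₁₎) m`. -/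
noncomputable def opE (δ : U →ₗ[k] D ⊗[k] U) (Φ : D →ₗ[k] M →ₗ[k] N) : U ⊗[k] M →ₗ[k] U ⊗[k] N :=
  TensorProduct.lift (evalE Φ ∘ₗ δ)

@[simp] theorem opE_tmul (δ : U →ₗ[k] D ⊗[k] U) (Φ : D →ₗ[k] M →ₗ[k] N) (u : U) (m : M) :
    opE δ Φ (u ⊗ₜ[k] m) = evalE Φ (δ u) m := rfl

/-- The operator `u ↦ φ(u₍₋₁₎) u₍₀₎` attached to a functional `φ`. A linear map `δ` is determined by
these operators, so identities between coactions are checked on them. -/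
noncomputable def op (δ : U →ₗ[k] D ⊗[k] U) : (D →ₗ[k] k) →ₗ[k] U →ₗ[k] U where
  toFun φ := (TensorProduct.lid k U).toLinearMap ∘ₗ φ.rTensor U ∘ₗ δ
  map_add' φ ψ := by ext; simp [LinearMap.rTensor_add]
  map_smul' c φ := by ext; simp [LinearMap.rTensor_smul]

theorem op_apply (δ : U →ₗ[k] D ⊗[k] U) (φ : D →ₗ[k] k) (u : U) :
    op δ φ u = TensorProduct.lid k U (φ.rTensor U (δ u)) := rfl

/-- Functionals on the left factor separate the elements of a tensor product. -/
theorem eq_of_forall_functional {t t' : D ⊗[k] U}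
    (h : ∀ φ : D →ₗ[k] k, TensorProduct.lid k U (φ.rTensor U t) =
      TensorProduct.lid k U (φ.rTensor U t')) : t = t' := by
  let b := Module.Free.chooseBasis k D
  apply (TensorProduct.equivFinsuppOfBasisLeft (N := U) b).injective
  ext i
  have key : ∀ t : D ⊗[k] U, TensorProduct.equivFinsuppOfBasisLeft b t i =
      TensorProduct.lid k U ((b.coord i).rTensor U t) := by
    intro t
    induction t using TensorProduct.induction_on with
    | zero => simp
    | tmul d u => simp
    | add x y hx hy => simp [hx, hy]
  rw [key, key, h]

/-- A linear map is colinear if and only if it commutes with all the operators `op`. -/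
theorem colinear_iff {δ : U →ₗ[k] D ⊗[k] U} {δ' : V →ₗ[k] D ⊗[k] V} (f : U →ₗ[k] V) :
    (∀ u, δ' (f u) = f.lTensor D (δ u)) ↔ ∀ φ, f ∘ₗ op δ φ = op δ' φ ∘ₗ f := by
  have key : ∀ (φ : D →ₗ[k] k) (t : D ⊗[k] U), TensorProduct.lid k V (φ.rTensor V (f.lTensor D t)) =
      f (TensorProduct.lid k U (φ.rTensor U t)) := by
    intro φ t
    induction t using TensorProduct.induction_on with
    | zero => simp
    | tmul d u => simp
    | add x y hx hy => simp [hx, hy]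
  constructor
  · intro h φ
    ext u
    simp [op_apply, h, key]
  · intro h u
    refine eq_of_forall_functional fun φ => ?_
    rw [key]
    exact (LinearMap.congr_fun (h φ) u).symm

/-- The coaction of `D ⊗ E` on `U ⊗ V`. -/
noncomputable def tens (δ₁ : U →ₗ[k] D ⊗[k] U) (δ₂ : V →ₗ[k] E ⊗[k] V) :
    U ⊗[k] V →ₗ[k] (D ⊗[k] E) ⊗[k] (U ⊗[k] V) :=
  (TensorProduct.tensorTensorTensorComm k D U E V).toLinearMap ∘ₗ TensorProduct.map δ₁ δ₂

/-- Corestriction of a coaction along `π : D → E`. -/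
noncomputable def push (π : D →ₗ[k] E) (δ : U →ₗ[k] D ⊗[k] U) : U →ₗ[k] E ⊗[k] U :=
  π.rTensor U ∘ₗ δ

theorem op_push (π : D →ₗ[k] E) (δ : U →ₗ[k] D ⊗[k] U) (φ : E →ₗ[k] k) :
    op (push π δ) φ = op δ (φ ∘ₗ π) := by
  ext u
  simp [op_apply, push, LinearMap.rTensor_comp_apply]

theorem opE_push (π : D →ₗ[k] E) (δ : U →ₗ[k] D ⊗[k] U) (Φ : E →ₗ[k] M →ₗ[k] N) :
    opE (push π δ) Φ = opE δ (Φ ∘ₗ π) := by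
  ext u m
  simp only [push, TensorProduct.AlgebraTensorModule.curry_apply, LinearMap.restrictScalars_self,
    TensorProduct.curry_apply, opE_tmul, LinearMap.comp_apply]
  induction δ u using TensorProduct.induction_on with
  | zero => simp
  | tmul d u => simp
  | add x y hx hy => simp [hx, hy]

theorem op_tens (δ₁ : U →ₗ[k] D ⊗[k] U) (δ₂ : V →ₗ[k] E ⊗[k] V) (φ : D ⊗[k] E →ₗ[k] k) :
    op (tens δ₁ δ₂) φ = opE δ₁ (op δ₂ ∘ₗ TensorProduct.curry φ) := by
  ext u v
  simp only [tens, op_apply, TensorProduct.AlgebraTensorModule.curry_apply,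
    LinearMap.restrictScalars_self, TensorProduct.curry_apply, opE_tmul, LinearMap.comp_apply,
    TensorProduct.map_tmul, LinearEquiv.coe_coe]
  induction δ₁ u using TensorProduct.induction_on with
  | zero => simp
  | tmul d u =>
    simp only [evalE_tmul, LinearMap.comp_apply, op_apply]
    induction δ₂ v using TensorProduct.induction_on with
    | zero => simp
    | tmul e v => simp
    | add x y hx hy => simp only [TensorProduct.tmul_add, map_add, hx, hy]
  | add x y hx hy => simp only [TensorProduct.add_tmul, map_add, hx, hy, LinearMap.add_apply]

variable [Coalgebra k D] [Coalgebra k E]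

/-- The linear map `δ` is a left coaction of the coalgebra `D` on `U`. -/
structure IsCoaction (δ : U →ₗ[k] D ⊗[k] U) : Prop where
  counit : ∀ u, (counit (R := k) (A := D)).rTensor U (δ u) = 1 ⊗ₜ[k] u
  coassoc : ∀ u, TensorProduct.assoc k D D U ((comul (R := k)).rTensor U (δ u)) =
    δ.lTensor D (δ u)

/-- The convolution product `d ↦ Ψ(d₂) ∘ Φ(d₁)` of families of operators. Note the order. -/
noncomputable def cmp (Φ : D →ₗ[k] M →ₗ[k] N) (Ψ : D →ₗ[k] N →ₗ[k] P) : D →ₗ[k] M →ₗ[k] P :=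
  TensorProduct.lift (LinearMap.mk₂ k (fun a b => Ψ b ∘ₗ Φ a)
    (by intros; ext; simp) (by intros; ext; simp)
    (by intros; ext; simp) (by intros; ext; simp)) ∘ₗ comul

theorem cmp_apply (Φ : D →ₗ[k] M →ₗ[k] N) (Ψ : D →ₗ[k] N →ₗ[k] P) (d : D) :
    cmp Φ Ψ d = cop2 k d fun a b => Ψ b ∘ₗ Φ a := by
  rw [cop2, cmp, LinearMap.comp_apply, ← sweedler_eq_lift]
  rfl

/-- The convolution product `d ↦ φ(d₁) ψ(d₂)` of functionals. -/
noncomputable def dconv (φ ψ : D →ₗ[k] k) : D →ₗ[k] k :=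
  TensorProduct.lift (LinearMap.mk₂ k (fun a b => φ a * ψ b)
    (by intros; simp [add_mul]) (by intros; simp [mul_assoc])
    (by intros; simp [mul_add]) (by intros; simp [mul_left_comm])) ∘ₗ comul

theorem dconv_apply (φ ψ : D →ₗ[k] k) (d : D) :
    dconv φ ψ d = cop2 k d fun a b => φ a * ψ b := by
  rw [cop2, dconv, LinearMap.comp_apply, ← sweedler_eq_lift]
  rfl

theorem opE_opE {δ : U →ₗ[k] D ⊗[k] U} (hδ : IsCoaction δ) (Φ : D →ₗ[k] M →ₗ[k] N)
    (Ψ : D →ₗ[k] N →ₗ[k] P) : opE δ Ψ ∘ₗ opE δ Φ = opE δ (cmp Φ Ψ) := by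
  let G : D ⊗[k] (D ⊗[k] U) →ₗ[k] M →ₗ[k] U ⊗[k] P := TensorProduct.lift
    (LinearMap.mk₂ k (fun d t => evalE Ψ t ∘ₗ Φ d)
    (by intros; ext; simp) (by intros; ext; simp)
    (by intros; ext; simp) (by intros; ext; simp))
  have h1 : ∀ (t : D ⊗[k] U) (m : M), opE δ Ψ (evalE Φ t m) = G (δ.lTensor D t) m := by
    intro t m
    induction t using TensorProduct.induction_on with
    | zero => simp
    | tmul d u => simp [G]
    | add x y hx hy => simp [hx, hy]
  have h2 : ∀ (t : D ⊗[k] U) (m : M), evalE (cmp Φ Ψ) t m =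
      G (TensorProduct.assoc k D D U ((comul (R := k)).rTensor U t)) m := by
    intro t m
    induction t using TensorProduct.induction_on with
    | zero => simp
    | tmul d u =>
      rw [LinearMap.rTensor_tmul, evalE_tmul, cmp, LinearMap.comp_apply]
      induction comul (R := k) d using TensorProduct.induction_on with
      | zero => simp
      | tmul a b => simp [G]
      | add x y hx hy => simp [hx, hy, TensorProduct.add_tmul, TensorProduct.tmul_add]
    | add x y hx hy => simp [hx, hy]
  ext u m
  simp [h1, h2, hδ.coassoc]

theorem op_op {δ : U →ₗ[k] D ⊗[k] U} (hδ : IsCoaction δ) (φ ψ : D →ₗ[k] k) :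
    op δ ψ ∘ₗ op δ φ = op δ (dconv φ ψ) := by
  let G : D ⊗[k] (D ⊗[k] U) →ₗ[k] U := TensorProduct.lift
    (LinearMap.mk₂ k (fun d t => φ d • TensorProduct.lid k U (ψ.rTensor U t))
    (by intros; simp [add_smul]) (by intros; simp [mul_smul])
    (by intros; simp) (by intro c m n; rw [map_smul, map_smul, smul_comm]))
  have h1 : ∀ (t : D ⊗[k] U), op δ ψ (TensorProduct.lid k U (φ.rTensor U t)) =
      G (δ.lTensor D t) := by
    intro t
    induction t using TensorProduct.induction_on with
    | zero => simp
    | tmul d u => simp [G, op_apply]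
    | add x y hx hy => simp [hx, hy]
  have h2 : ∀ (t : D ⊗[k] U), TensorProduct.lid k U ((dconv φ ψ).rTensor U t) =
      G (TensorProduct.assoc k D D U ((comul (R := k)).rTensor U t)) := by
    intro t
    induction t using TensorProduct.induction_on with
    | zero => simp
    | tmul d u =>
      rw [LinearMap.rTensor_tmul, LinearMap.rTensor_tmul, dconv, LinearMap.comp_apply]
      induction comul (R := k) d using TensorProduct.induction_on with
      | zero => simp
      | tmul a b => simp [G, mul_smul]
      | add x y hx hy =>
        simp only [map_add, TensorProduct.add_tmul, hx, hy]
    | add x y hx hy => simp [hx, hy]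
  ext u
  rw [LinearMap.comp_apply, op_apply δ φ, h1, op_apply, h2, hδ.coassoc]

theorem op_counit {δ : U →ₗ[k] D ⊗[k] U} (hδ : IsCoaction δ) :
    op δ counit = LinearMap.id := by
  ext u; simp [op_apply, hδ.counit]

theorem opE_counit {δ : U →ₗ[k] D ⊗[k] U} (hδ : IsCoaction δ) (f : M →ₗ[k] N) :
    opE δ ((counit (R := k) (A := D)).smulRight f) = f.lTensor U := by
  have h : ∀ (t : D ⊗[k] U) (m : M), evalE ((counit (R := k) (A := D)).smulRight f) t m =
     (TensorProduct.lid k U ((counit (R := k)).rTensor U t)) ⊗ₜ[k] f m := by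
    intro t m
    induction t using TensorProduct.induction_on with
    | zero => simp
    | tmul d u => simp [TensorProduct.smul_tmul']
    | add x y hx hy => simp [hx, hy, TensorProduct.add_tmul]
  ext u m
  simp [h, hδ.counit]

/-- The axioms of a coaction, in terms of the operators `op`. -/
theorem isCoaction_of_op {δ : U →ₗ[k] D ⊗[k] U} (h1 : op δ counit = LinearMap.id)
    (h2 : ∀ φ ψ, op δ ψ ∘ₗ op δ φ = op δ (dconv φ ψ)) : IsCoaction δ where
  counit u := by
    apply (TensorProduct.lid k U).injective
    have := LinearMap.congr_fun h1 u
    rw [op_apply] at this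
    simpa using this
  coassoc u := by
    refine eq_of_forall_functional fun φ => eq_of_forall_functional fun ψ => ?_
    have e1 : ∀ t : D ⊗[k] U, TensorProduct.lid k U (ψ.rTensor U (TensorProduct.lid k _
      (φ.rTensor _ (δ.lTensor D t)))) = op δ ψ (TensorProduct.lid k U (φ.rTensor U t)) := by
      intro t
      induction t using TensorProduct.induction_on with
      | zero => simp
      | tmul d u => simp [op_apply]
      | add x y hx hy => simp only [map_add, hx, hy]
    have e2 : ∀ t : D ⊗[k] U, TensorProduct.lid k U (ψ.rTensor U (TensorProduct.lid k _
      (φ.rTensor _ (TensorProduct.assoc k D D U ((comul (R := k)).rTensor U t))))) =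
        TensorProduct.lid k U ((dconv φ ψ).rTensor U t) := by
      intro t
      induction t using TensorProduct.induction_on with
      | zero => simp
      | tmul d u =>
        rw [LinearMap.rTensor_tmul, LinearMap.rTensor_tmul, dconv, LinearMap.comp_apply]
        induction comul (R := k) d using TensorProduct.induction_on with
        | zero => simp
        | tmul a b => simp [smul_smul]
        | add x y hx hy =>
          simp only [map_add, TensorProduct.add_tmul, hx, hy]
      | add x y hx hy => simp only [map_add, hx, hy]
    rw [e1, e2]
    exact (LinearMap.congr_fun (h2 φ ψ) u).symm

theorem dconv_comp (π : D →ₗc[k] E) (φ ψ : E →ₗ[k] k) :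
    dconv φ ψ ∘ₗ π.toLinearMap = dconv (φ ∘ₗ π.toLinearMap) (ψ ∘ₗ π.toLinearMap) := by
  ext1 d
  simp only [dconv, LinearMap.comp_apply]
  have : comul (R := k) (π d) = TensorProduct.map π.toLinearMap π.toLinearMap (comul d) :=
    (LinearMap.congr_fun π.map_comp_comul d).symm
  erw [this]
  induction comul (R := k) d using TensorProduct.induction_on with
  | zero => simp
  | tmul a b => simp
  | add x y hx hy => simp only [map_add, hx, hy]

theorem IsCoaction.push {δ : U →ₗ[k] D ⊗[k] U} (hδ : IsCoaction δ) (π : D →ₗc[k] E) :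
    IsCoaction (push π.toLinearMap δ) := by
  apply isCoaction_of_op
  · rw [op_push, ← op_counit hδ]
    congr 1
    exact π.counit_comp
  · intro φ ψ
    rw [op_push, op_push, op_push, op_op hδ, dconv_comp]

theorem cop2_eq {V : Type*} [AddCommGroup V] [Module k V] (d : D) (G : D ⊗[k] D →ₗ[k] V)
    (F : D → D → V) (h : ∀ a b, F a b = G (a ⊗ₜ[k] b)) : cop2 k d F = G (comul d) := by
  have := sweedler_eq_lift (k := k) (comul (R := k) d) (TensorProduct.curry G)
  have e : TensorProduct.lift (TensorProduct.curry G) = G := by ext; rfl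
  simp only [TensorProduct.curry_apply, e] at this
  rw [← this, cop2]
  congr 1
  ext a b
  exact h a b

/-- The comultiplication of `D ⊗ E` as an iterated Sweedler sum. -/
theorem comul_tmul_apply {V : Type*} [AddCommGroup V] [Module k V] (d : D) (e : E)
    (G : (D ⊗[k] E) ⊗[k] (D ⊗[k] E) →ₗ[k] V) :
    G (comul (d ⊗ₜ[k] e)) = cop2 k d fun d₁ d₂ => cop2 k e fun e₁ e₂ =>
      G ((d₁ ⊗ₜ[k] e₁) ⊗ₜ[k] (d₂ ⊗ₜ[k] e₂)) := by
  have h1 := (TensorProduct.exists_finset (Coalgebra.comul (R := k) d)).choose_spec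
  have h2 := (TensorProduct.exists_finset (comul (R := k) e)).choose_spec
  rw [TensorProduct.comul_tmul, h1, h2]
  simp only [cop2, sweedler, TensorProduct.sum_tmul, TensorProduct.tmul_sum, map_sum]
  rw [Finset.sum_comm]
  rfl

theorem IsCoaction.tens {δ₁ : U →ₗ[k] D ⊗[k] U} {δ₂ : V →ₗ[k] E ⊗[k] V} (h₁ : IsCoaction δ₁)
    (h₂ : IsCoaction δ₂) : IsCoaction (tens δ₁ δ₂) := by
  have hop : ∀ (φ ψ : D ⊗[k] E →ₗ[k] k), cmp (op δ₂ ∘ₗ TensorProduct.curry φ)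
      (op δ₂ ∘ₗ TensorProduct.curry ψ) = op δ₂ ∘ₗ TensorProduct.curry (dconv φ ψ) := by
    intro φ ψ
    ext1 d
    rw [cmp_apply, LinearMap.comp_apply]
    have : TensorProduct.curry (dconv φ ψ) d = cop2 k d fun a b =>
        dconv (TensorProduct.curry φ a) (TensorProduct.curry ψ b) := by
      ext e
      rw [TensorProduct.curry_apply, dconv, LinearMap.comp_apply, comul_tmul_apply]
      simp only [cop2, sweedler, LinearMap.sum_apply]
      refine Finset.sum_congr rfl fun p _ => ?_
      rw [dconv_apply]
      rfl
    rw [this]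
    simp only [cop2, sweedler, map_sum]
    refine Finset.sum_congr rfl fun p _ => ?_
    rw [← op_op h₂]
    rfl
  apply isCoaction_of_op
  · rw [op_tens]
    have : op δ₂ ∘ₗ TensorProduct.curry (Coalgebra.counit (R := k) (A := D ⊗[k] E)) =
        (Coalgebra.counit (R := k) (A := D)).smulRight LinearMap.id := by
      ext1 d
      rw [← op_counit h₂, LinearMap.smulRight_apply, ← map_smul, LinearMap.comp_apply]
      congr 1
      ext e
      simp [mul_comm]
    rw [this, opE_counit h₁, LinearMap.lTensor_id]
  · intro φ ψ
    rw [op_tens, op_tens, op_tens, opE_opE h₁, hop]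

end Coaction

/-! ### Tensor products of coactions, and convolution of functionals -/

namespace Coaction
variable {k : Type*} [Field k]
variable {D E F G U V W M N P U' V' : Type*}
  [AddCommGroup D] [Module k D] [AddCommGroup E] [Module k E] [AddCommGroup F] [Module k F]
  [AddCommGroup G] [Module k G]
  [AddCommGroup U] [Module k U] [AddCommGroup V] [Module k V] [AddCommGroup W] [Module k W]
  [AddCommGroup U'] [Module k U'] [AddCommGroup V'] [Module k V']
  [AddCommGroup M] [Module k M] [AddCommGroup N] [Module k N] [AddCommGroup P] [Module k P]

theorem tens_tmul (δ₁ : U →ₗ[k] D ⊗[k] U) (δ₂ : V →ₗ[k] E ⊗[k] V) (u : U) (v : V) :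
    tens δ₁ δ₂ (u ⊗ₜ[k] v) =
      TensorProduct.tensorTensorTensorComm k D U E V (δ₁ u ⊗ₜ[k] δ₂ v) := rfl

theorem tens_push_right (π : E →ₗ[k] F) (δ₁ : U →ₗ[k] D ⊗[k] U) (δ₂ : V →ₗ[k] E ⊗[k] V) :
    tens δ₁ (push π δ₂) = push (π.lTensor D) (tens δ₁ δ₂) := by
  ext u v
  simp only [TensorProduct.AlgebraTensorModule.curry_apply, LinearMap.restrictScalars_self,
    TensorProduct.curry_apply, push, LinearMap.comp_apply, tens_tmul]
  induction δ₁ u using TensorProduct.induction_on with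
  | zero => simp
  | add x y hx hy => simp only [TensorProduct.add_tmul, map_add, hx, hy]
  | tmul d u =>
    induction δ₂ v using TensorProduct.induction_on with
    | zero => simp
    | add x y hx hy => simp only [TensorProduct.tmul_add, map_add, hx, hy]
    | tmul e v => simp

theorem tens_push_left (π : D →ₗ[k] F) (δ₁ : U →ₗ[k] D ⊗[k] U) (δ₂ : V →ₗ[k] E ⊗[k] V) :
    tens (push π δ₁) δ₂ = push (π.rTensor E) (tens δ₁ δ₂) := by
  ext u v
  simp only [TensorProduct.AlgebraTensorModule.curry_apply, LinearMap.restrictScalars_self,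
    TensorProduct.curry_apply, push, LinearMap.comp_apply, tens_tmul]
  induction δ₁ u using TensorProduct.induction_on with
  | zero => simp
  | add x y hx hy => simp only [TensorProduct.add_tmul, map_add, hx, hy]
  | tmul d u =>
    induction δ₂ v using TensorProduct.induction_on with
    | zero => simp
    | add x y hx hy => simp only [TensorProduct.tmul_add, map_add, hx, hy]
    | tmul e v => simp

theorem assoc_op_tens_tens (δ₁ : U →ₗ[k] D ⊗[k] U) (δ₂ : V →ₗ[k] E ⊗[k] V) (δ₃ : W →ₗ[k] F ⊗[k] W)
    (φ : (D ⊗[k] E) ⊗[k] F →ₗ[k] k) (t : (U ⊗[k] V) ⊗[k] W) :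
    TensorProduct.assoc k U V W (op (tens (tens δ₁ δ₂) δ₃) φ t) =
      op (tens δ₁ (tens δ₂ δ₃)) (φ ∘ₗ (TensorProduct.assoc k D E F).symm.toLinearMap)
        (TensorProduct.assoc k U V W t) := by
  suffices h : (TensorProduct.assoc k U V W).toLinearMap ∘ₗ op (tens (tens δ₁ δ₂) δ₃) φ =
      op (tens δ₁ (tens δ₂ δ₃)) (φ ∘ₗ (TensorProduct.assoc k D E F).symm.toLinearMap) ∘ₗ
        (TensorProduct.assoc k U V W).toLinearMap from LinearMap.congr_fun h t
  ext u v w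
  simp only [TensorProduct.AlgebraTensorModule.curry_apply, LinearMap.restrictScalars_self,
    TensorProduct.curry_apply, LinearMap.comp_apply, LinearEquiv.coe_coe,
    TensorProduct.assoc_tmul, op_apply, tens_tmul]
  induction δ₁ u using TensorProduct.induction_on with
  | zero => simp
  | add x y hx hy => simp only [TensorProduct.add_tmul, map_add, hx, hy]
  | tmul d u =>
    induction δ₂ v using TensorProduct.induction_on with
    | zero => simp
    | add x y hx hy => simp only [TensorProduct.add_tmul, TensorProduct.tmul_add, map_add, hx, hy]
    | tmul e v =>
      induction δ₃ w using TensorProduct.induction_on with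
      | zero => simp
      | add x y hx hy => simp only [TensorProduct.tmul_add, map_add, hx, hy]
      | tmul e v => simp

theorem tens_colinear {δ₁ : U →ₗ[k] D ⊗[k] U} {δ₂ : V →ₗ[k] E ⊗[k] V} {δ₁' : U' →ₗ[k] D ⊗[k] U'}
    {δ₂' : V' →ₗ[k] E ⊗[k] V'} {f : U →ₗ[k] U'} {g : V →ₗ[k] V'}
    (hf : ∀ u, δ₁' (f u) = f.lTensor D (δ₁ u)) (hg : ∀ v, δ₂' (g v) = g.lTensor E (δ₂ v))
    (t : U ⊗[k] V) :
    tens δ₁' δ₂' (TensorProduct.map f g t) =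
      (TensorProduct.map f g).lTensor (D ⊗[k] E) (tens δ₁ δ₂ t) := by
  induction t using TensorProduct.induction_on with
  | zero => simp
  | add x y hx hy => simp only [map_add, hx, hy]
  | tmul u v =>
    simp only [TensorProduct.map_tmul, tens_tmul, hf, hg]
    induction δ₁ u using TensorProduct.induction_on with
    | zero => simp
    | add x y hx hy => simp only [TensorProduct.add_tmul, map_add, hx, hy]
    | tmul d u =>
      induction δ₂ v using TensorProduct.induction_on with
      | zero => simp
      | add x y hx hy => simp only [TensorProduct.tmul_add, map_add, hx, hy]
      | tmul e v => simp

theorem push_colinear {δ : U →ₗ[k] D ⊗[k] U} {δ' : V →ₗ[k] D ⊗[k] V} {f : U →ₗ[k] V}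
    (hf : ∀ u, δ' (f u) = f.lTensor D (δ u)) (π : D →ₗ[k] E) (u : U) :
    push π δ' (f u) = f.lTensor E (push π δ u) := by
  simp only [push, LinearMap.comp_apply, hf]
  rw [← LinearMap.comp_apply, LinearMap.rTensor_comp_lTensor, ← LinearMap.lTensor_comp_rTensor]
  rfl

theorem op_natural {δ : U →ₗ[k] D ⊗[k] U} {δ' : V →ₗ[k] D ⊗[k] V} {f : U →ₗ[k] V}
    (hf : ∀ u, δ' (f u) = f.lTensor D (δ u)) (φ : D →ₗ[k] k) (u : U) :
    f (op δ φ u) = op δ' φ (f u) :=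
  LinearMap.congr_fun ((colinear_iff f).1 hf φ) u

/-- The functional `d ⊗ e ↦ φ(d) ψ(e)`. -/
noncomputable def tmulFun (φ : D →ₗ[k] k) (ψ : E →ₗ[k] k) : D ⊗[k] E →ₗ[k] k :=
  (TensorProduct.lid k k).toLinearMap ∘ₗ TensorProduct.map φ ψ

@[simp] theorem tmulFun_tmul (φ : D →ₗ[k] k) (ψ : E →ₗ[k] k) (d : D) (e : E) :
    tmulFun φ ψ (d ⊗ₜ[k] e) = φ d * ψ e := rfl

/-- A trilinear form as a functional on `D ⊗ (E ⊗ F)`. -/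
noncomputable def tri (τ : D →ₗ[k] E →ₗ[k] F →ₗ[k] k) : D ⊗[k] (E ⊗[k] F) →ₗ[k] k :=
  TensorProduct.lift ((TensorProduct.uncurry (RingHom.id k) E F k) ∘ₗ τ)

@[simp] theorem tri_tmul (τ : D →ₗ[k] E →ₗ[k] F →ₗ[k] k) (d : D) (e : E) (f : F) :
    tri τ (d ⊗ₜ[k] (e ⊗ₜ[k] f)) = τ d e f := rfl

theorem op_tmulFun (δ₁ : U →ₗ[k] D ⊗[k] U) (δ₂ : V →ₗ[k] E ⊗[k] V) (φ : D →ₗ[k] k)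
    (ψ : E →ₗ[k] k) : op (tens δ₁ δ₂) (tmulFun φ ψ) = TensorProduct.map (op δ₁ φ) (op δ₂ ψ) := by
  ext u v
  simp only [TensorProduct.AlgebraTensorModule.curry_apply, LinearMap.restrictScalars_self,
    TensorProduct.curry_apply, op_apply, tens_tmul, TensorProduct.map_tmul]
  induction δ₁ u using TensorProduct.induction_on with
  | zero => simp
  | add x y hx hy => simp only [TensorProduct.add_tmul, map_add, hx, hy]
  | tmul d u =>
    induction δ₂ v using TensorProduct.induction_on with
    | zero => simp
    | add x y hx hy => simp only [TensorProduct.tmul_add, map_add, hx, hy]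
    | tmul e v => simp [TensorProduct.smul_tmul', smul_smul, mul_comm]

variable [Coalgebra k D] [Coalgebra k E] [Coalgebra k F] [Coalgebra k G]

theorem dconv_tmul (φ ψ : D ⊗[k] E →ₗ[k] k) (d : D) (e : E) :
    dconv φ ψ (d ⊗ₜ[k] e) = cop2 k d fun a b =>
      dconv (TensorProduct.curry φ a) (TensorProduct.curry ψ b) e := by
  rw [dconv, LinearMap.comp_apply, comul_tmul_apply]
  simp only [cop2, sweedler]
  refine Finset.sum_congr rfl fun p _ => ?_
  rw [dconv_apply]
  rfl

theorem curry_dconv (φ ψ : D ⊗[k] E →ₗ[k] k) (d : D) :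
    TensorProduct.curry (dconv φ ψ) d = cop2 k d fun a b =>
      dconv (TensorProduct.curry φ a) (TensorProduct.curry ψ b) := by
  ext e
  rw [TensorProduct.curry_apply, dconv_tmul]
  simp only [cop2, sweedler, LinearMap.sum_apply]

/-- `dconv` as a bilinear map. -/
noncomputable def dconvL : (D →ₗ[k] k) →ₗ[k] (D →ₗ[k] k) →ₗ[k] D →ₗ[k] k :=
  LinearMap.mk₂ k dconv
    (fun φ φ' ψ => by
      ext d; rw [LinearMap.add_apply]; simp only [dconv_apply, cop2, sweedler]
      rw [← Finset.sum_add_distrib]; simp [add_mul])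
    (fun c φ ψ => by
      ext d; rw [LinearMap.smul_apply]; simp only [dconv_apply, cop2, sweedler]
      rw [Finset.smul_sum]; simp [mul_assoc])
    (fun φ φ' ψ => by
      ext d; rw [LinearMap.add_apply]; simp only [dconv_apply, cop2, sweedler]
      rw [← Finset.sum_add_distrib]; simp [mul_add])
    (fun c φ ψ => by
      ext d; rw [LinearMap.smul_apply]; simp only [dconv_apply, cop2, sweedler]
      rw [Finset.smul_sum]; simp [mul_left_comm])

theorem dconvL_apply (φ ψ : D →ₗ[k] k) : dconvL φ ψ = dconv φ ψ := rfl

theorem dconv_dconv_tmul (φ ψ χ : D ⊗[k] E →ₗ[k] k) (d : D) (e : E) :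
    dconv φ (dconv ψ χ) (d ⊗ₜ[k] e) = cop3 k d fun a b c =>
      dconv (TensorProduct.curry φ a)
        (dconv (TensorProduct.curry ψ b) (TensorProduct.curry χ c)) e := by
  rw [dconv_tmul]
  simp only [cop3, cop2, sweedler]
  refine Finset.sum_congr rfl fun p _ => ?_
  rw [curry_dconv, ← dconvL_apply]
  simp only [cop2, sweedler, map_sum, LinearMap.sum_apply]
  rfl

theorem counit_dconv (φ : D →ₗ[k] k) : dconv counit φ = φ := by
  ext d
  rw [dconv_apply, cop2_eq d (φ ∘ₗ (TensorProduct.lid k D).toLinearMap ∘ₗ counit.rTensor D)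
    _ (fun a b => by simp)]
  simp [LinearMap.comp_apply, Coalgebra.rTensor_counit_comul]

theorem dconv_counit (φ : D →ₗ[k] k) : dconv φ counit = φ := by
  ext d
  rw [dconv_apply, cop2_eq d (φ ∘ₗ (TensorProduct.rid k D).toLinearMap ∘ₗ counit.lTensor D)
    _ (fun a b => by simp [mul_comm])]
  simp [LinearMap.comp_apply, Coalgebra.lTensor_counit_comul]

theorem dconv_tri (φ ψ : D ⊗[k] (E ⊗[k] F) →ₗ[k] k) (d : D) (e : E) (f : F) :
    dconv φ ψ (d ⊗ₜ[k] (e ⊗ₜ[k] f)) = cop2 k d fun a₁ a₂ => cop2 k e fun b₁ b₂ =>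
      cop2 k f fun c₁ c₂ => φ (a₁ ⊗ₜ[k] (b₁ ⊗ₜ[k] c₁)) * ψ (a₂ ⊗ₜ[k] (b₂ ⊗ₜ[k] c₂)) := by
  rw [dconv_tmul]
  simp only [cop2, sweedler]
  refine Finset.sum_congr rfl fun p _ => ?_
  rw [dconv_tmul]
  simp only [cop2, sweedler]
  refine Finset.sum_congr rfl fun p _ => ?_
  rw [dconv_apply]
  rfl

end Coaction

open Coaction

/-! ### The reassociator as a functional -/

namespace DualQuasiHopfAlgebra
variable (k : Type u) (H : Type v) [Field k] [NonAssocRing H] [Module k H]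
  [IsScalarTower k H H] [SMulCommClass k H H] [Coalgebra k H] [DualQuasiHopfAlgebra k H]

/-- The multiplication of `H` as a morphism of coalgebras. -/
noncomputable def mulHom : H ⊗[k] H →ₗc[k] H where
  toLinearMap := LinearMap.mul' k H
  counit_comp := by
    ext a b
    simp [counit_mul, mul_comm]
  map_comp_comul := by
    ext a b
    simp only [TensorProduct.AlgebraTensorModule.curry_apply, LinearMap.restrictScalars_self,
      TensorProduct.curry_apply, LinearMap.comp_apply, LinearMap.mul'_apply]
    rw [comul_tmul_apply, comul_mul]
    simp

/-- The multiplication of `H` as a linear map. -/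
noncomputable abbrev mulL : H ⊗[k] H →ₗ[k] H := LinearMap.mul' k H

theorem dconv_σ_σinv : dconv (tri (σ (k := k) (H := H))) (tri σinv) = counit := by
  ext a b c
  simp only [TensorProduct.AlgebraTensorModule.curry_apply, LinearMap.restrictScalars_self,
    TensorProduct.curry_apply]
  rw [dconv_tri]
  simp only [tri_tmul, σ_mul_σinv]
  simp [mul_comm, mul_left_comm]

theorem dconv_σinv_σ : dconv (tri (σinv (k := k) (H := H))) (tri σ) = counit := by
  ext a b c
  simp only [TensorProduct.AlgebraTensorModule.curry_apply, LinearMap.restrictScalars_self,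
    TensorProduct.curry_apply]
  rw [dconv_tri]
  simp only [tri_tmul, σinv_mul_σ]
  simp [mul_comm, mul_left_comm]

/-- Quasi-associativity of the multiplication, paired with a functional. -/
theorem dconv_quasi_assoc (φ : H →ₗ[k] k) :
    dconv (φ ∘ₗ mulL k H ∘ₗ (mulL k H).lTensor H) (tri σ) =
      dconv (tri σ) (φ ∘ₗ mulL k H ∘ₗ (mulL k H).rTensor H ∘ₗ
        (TensorProduct.assoc k H H H).symm.toLinearMap) := by
  ext a b c
  simp only [TensorProduct.AlgebraTensorModule.curry_apply, LinearMap.restrictScalars_self,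
    TensorProduct.curry_apply]
  rw [dconv_tri, dconv_tri]
  have h := congrArg φ (quasi_assoc (k := k) a b c)
  simp only [cop2, sweedler, map_sum, map_smul, smul_eq_mul] at h
  simpa [cop2, sweedler, mul_comm] using h

/-- The cocycle condition on `σ` as an identity between functionals on `H ⊗ (H ⊗ (H ⊗ H))`. -/
theorem dconv_cocycle :
    dconv (tri (σ (k := k) (H := H)) ∘ₗ ((mulL k H).lTensor H).lTensor H)
      (tri σ ∘ₗ (mulL k H).rTensor (H ⊗[k] H) ∘ₗ
        (TensorProduct.assoc k H H (H ⊗[k] H)).symm.toLinearMap) =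
    dconv (tmulFun counit (tri σ)) (dconv
      (tri σ ∘ₗ ((mulL k H).rTensor H ∘ₗ
        (TensorProduct.assoc k H H H).symm.toLinearMap).lTensor H)
      (tmulFun (tri σ) counit ∘ₗ ((TensorProduct.assoc k H (H ⊗[k] H) H).symm.toLinearMap ∘ₗ
        (TensorProduct.assoc k H H H).symm.toLinearMap.lTensor H))) := by
  ext a b c d
  simp only [TensorProduct.AlgebraTensorModule.curry_apply, LinearMap.restrictScalars_self,
    TensorProduct.curry_apply, LinearMap.comp_apply]
  trans cop2 k a fun a₁ a₂ => cop2 k b fun b₁ b₂ => cop2 k c fun c₁ c₂ => cop2 k d fun d₁ d₂ =>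
      σ (k := k) a₁ b₁ (c₁ * d₁) * σ (a₂ * b₂) c₂ d₂
  · rw [dconv_tmul]
    simp only [cop2, sweedler]
    refine Finset.sum_congr rfl fun p _ => ?_
    rw [dconv_tri]
    rfl
  rw [cocycle]
  -- Convolution with `ε ⊗ σ` acts on the last three arguments only.
  have key : ∀ (X : H ⊗[k] (H ⊗[k] (H ⊗[k] H)) →ₗ[k] k) t,
      dconv (tmulFun counit (tri (σ (k := k) (H := H)))) X (a ⊗ₜ[k] t) =
        dconv (tri σ) (TensorProduct.curry X a) t := by
    intro X t
    rw [dconv_tmul]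
    have := cop2_eq a (LinearMap.applyₗ t ∘ₗ dconvL (tri (σ (k := k) (H := H))) ∘ₗ
      TensorProduct.curry X ∘ₗ
      (TensorProduct.lid k H).toLinearMap ∘ₗ counit.rTensor H) (fun a₁ a₂ =>
      dconv (TensorProduct.curry (tmulFun counit (tri (σ (k := k) (H := H)))) a₁)
        (TensorProduct.curry X a₂) t) (fun a b => by
          have : TensorProduct.curry (tmulFun counit (tri (σ (k := k) (H := H)))) a =
            counit (R := k) a • tri σ := by ext; rfl
          rw [this, ← dconvL_apply]
          simp)
    rw [this]
    simp [LinearMap.comp_apply, Coalgebra.rTensor_counit_comul, dconvL_apply]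
  rw [key, curry_dconv]
  rw [← dconvL_apply]
  simp only [cop2, sweedler, map_sum, LinearMap.sum_apply]
  refine Finset.sum_congr rfl fun p _ => ?_
  rw [dconvL_apply, dconv_dconv_tmul]
  simp only [cop3, cop2, sweedler]
  refine Finset.sum_congr rfl fun q _ => Finset.sum_congr rfl fun r _ => ?_
  rw [dconv_dconv_tmul]
  simp only [cop3, cop2, sweedler]
  refine Finset.sum_congr rfl fun q' _ => Finset.sum_congr rfl fun r' _ => ?_
  set B := TensorProduct.curry (TensorProduct.curry (TensorProduct.curry
    (tmulFun (tri (σ (k := k) (H := H))) counit ∘ₗ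
      ((TensorProduct.assoc k H (H ⊗[k] H) H).symm.toLinearMap ∘ₗ
        (TensorProduct.assoc k H H H).symm.toLinearMap.lTensor H)) p.2) r.2) r'.2 with hB
  have hB' : B = σ (k := k) p.2 r.2 r'.2 • counit := by
    rw [hB]; ext; rfl
  have hd : ∀ (ψ : H →ₗ[k] k) (c : k), dconv ψ (c • counit) = c • ψ := fun ψ c => by
    rw [← dconvL_apply, map_smul, dconvL_apply, dconv_counit]
  rw [hB', hd, dconv_apply]
  simp only [cop2, sweedler]
  refine Finset.sum_congr rfl fun s _ => ?_
  simp [mul_assoc, mul_comm, mul_left_comm]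

end DualQuasiHopfAlgebra

namespace Coaction
variable {k : Type*} [Field k]
variable {D E F G U V W M N P U' V' : Type*}
  [AddCommGroup D] [Module k D] [AddCommGroup E] [Module k E] [AddCommGroup F] [Module k F]
  [AddCommGroup G] [Module k G]
  [AddCommGroup U] [Module k U] [AddCommGroup V] [Module k V] [AddCommGroup W] [Module k W]
  [AddCommGroup U'] [Module k U'] [AddCommGroup V'] [Module k V']

/-- The map `f` is colinear along `π`: it carries the coaction of `D`, pushed along `π`, to the
coaction of `E`. -/
def IsSemicolinear (δ : U →ₗ[k] D ⊗[k] U) (δ' : V →ₗ[k] E ⊗[k] V) (π : D →ₗ[k] E)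
    (f : U →ₗ[k] V) : Prop := ∀ u, δ' (f u) = TensorProduct.map π f (δ u)

theorem IsSemicolinear.op {δ : U →ₗ[k] D ⊗[k] U} {δ' : V →ₗ[k] E ⊗[k] V} {π : D →ₗ[k] E}
    {f : U →ₗ[k] V} (h : IsSemicolinear δ δ' π f) (φ : E →ₗ[k] k) (u : U) :
    op δ' φ (f u) = f (op δ (φ ∘ₗ π) u) := by
  rw [op_apply, h u, op_apply]
  induction δ u using TensorProduct.induction_on with
  | zero => simp
  | add x y hx hy => simp only [map_add, hx, hy]
  | tmul d u => simp

theorem IsSemicolinear.tens {δ₁ : U →ₗ[k] D ⊗[k] U} {δ₂ : V →ₗ[k] E ⊗[k] V}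
    {δ₁' : U' →ₗ[k] F ⊗[k] U'} {δ₂' : V' →ₗ[k] G ⊗[k] V'} {f : U →ₗ[k] U'} {g : V →ₗ[k] V'}
    {π : D →ₗ[k] F} {ρ : E →ₗ[k] G}
    (hf : IsSemicolinear δ₁ δ₁' π f) (hg : IsSemicolinear δ₂ δ₂' ρ g) :
    IsSemicolinear (tens δ₁ δ₂) (tens δ₁' δ₂') (TensorProduct.map π ρ) (TensorProduct.map f g) := by
  intro t
  induction t using TensorProduct.induction_on with
  | zero => simp
  | add x y hx hy => simp only [map_add, hx, hy]
  | tmul u v =>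
    simp only [TensorProduct.map_tmul, tens_tmul, hf u, hg v]
    induction δ₁ u using TensorProduct.induction_on with
    | zero => simp
    | add x y hx hy => simp only [TensorProduct.add_tmul, map_add, hx, hy]
    | tmul d u =>
      induction δ₂ v using TensorProduct.induction_on with
      | zero => simp
      | add x y hx hy => simp only [TensorProduct.tmul_add, map_add, hx, hy]
      | tmul e v => simp

theorem IsSemicolinear.id (δ : U →ₗ[k] D ⊗[k] U) :
    IsSemicolinear δ δ LinearMap.id LinearMap.id := fun u => by simp

theorem isSemicolinear_assoc_symm (δ₁ : U →ₗ[k] D ⊗[k] U) (δ₂ : V →ₗ[k] E ⊗[k] V)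
    (δ₃ : W →ₗ[k] F ⊗[k] W) : IsSemicolinear (tens δ₁ (tens δ₂ δ₃)) (tens (tens δ₁ δ₂) δ₃)
      (TensorProduct.assoc k D E F).symm.toLinearMap
      (TensorProduct.assoc k U V W).symm.toLinearMap := by
  suffices h : tens (tens δ₁ δ₂) δ₃ ∘ₗ (TensorProduct.assoc k U V W).symm.toLinearMap =
      TensorProduct.map (TensorProduct.assoc k D E F).symm.toLinearMap
      (TensorProduct.assoc k U V W).symm.toLinearMap ∘ₗ (tens δ₁ (tens δ₂ δ₃)) from
    LinearMap.congr_fun h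
  ext u v w
  simp only [TensorProduct.AlgebraTensorModule.curry_apply, LinearMap.restrictScalars_self,
    TensorProduct.curry_apply, LinearMap.comp_apply, LinearEquiv.coe_coe,
    TensorProduct.assoc_symm_tmul, tens_tmul]
  induction δ₁ u using TensorProduct.induction_on with
  | zero => simp
  | add x y hx hy => simp only [TensorProduct.add_tmul, map_add, hx, hy]
  | tmul d u =>
    induction δ₂ v using TensorProduct.induction_on with
    | zero => simp
    | add x y hx hy => simp only [TensorProduct.add_tmul, TensorProduct.tmul_add, map_add, hx, hy]
    | tmul e v =>
      induction δ₃ w using TensorProduct.induction_on with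
      | zero => simp
      | add x y hx hy => simp only [TensorProduct.tmul_add, map_add, hx, hy]
      | tmul e v => simp

end Coaction

/-! ### The associativity constraint -/

namespace Coaction
section Quasi

variable {k : Type*} {H : Type*} [Field k] [NonAssocRing H] [Module k H]
  [IsScalarTower k H H] [SMulCommClass k H H] [Coalgebra k H] [DualQuasiHopfAlgebra k H]
variable {U V W Z : Type*}
  [AddCommGroup U] [Module k U] [AddCommGroup V] [Module k V] [AddCommGroup W] [Module k W]
  [AddCommGroup Z] [Module k Z]
variable (δU : U →ₗ[k] H ⊗[k] U) (δV : V →ₗ[k] H ⊗[k] V) (δW : W →ₗ[k] H ⊗[k] W)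
  (δZ : Z →ₗ[k] H ⊗[k] Z)

/-- The diagonal coaction `u ⊗ v ↦ u₍₋₁₎ v₍₋₁₎ ⊗ (u₍₀₎ ⊗ v₍₀₎)`. -/
noncomputable def diag : U ⊗[k] V →ₗ[k] H ⊗[k] (U ⊗[k] V) := push (mulL k H) (tens δU δV)

/-- The map `(u ⊗ v) ⊗ w ↦ σ⁻¹(u₍₋₁₎, v₍₋₁₎, w₍₋₁₎) u₍₀₎ ⊗ (v₍₀₎ ⊗ w₍₀₎)`. -/
noncomputable def assocL : (U ⊗[k] V) ⊗[k] W →ₗ[k] U ⊗[k] (V ⊗[k] W) :=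
  op (tens δU (tens δV δW)) (tri σinv) ∘ₗ (TensorProduct.assoc k U V W).toLinearMap

/-- The map `u ⊗ (v ⊗ w) ↦ σ(u₍₋₁₎, v₍₋₁₎, w₍₋₁₎) (u₍₀₎ ⊗ v₍₀₎) ⊗ w₍₀₎`. -/
noncomputable def assocLinv : U ⊗[k] (V ⊗[k] W) →ₗ[k] (U ⊗[k] V) ⊗[k] W :=
  (TensorProduct.assoc k U V W).symm.toLinearMap ∘ₗ op (tens δU (tens δV δW)) (tri σ)

theorem op_diag_right (φ : H →ₗ[k] k) : op (diag δU (diag δV δW)) φ =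
    op (tens δU (tens δV δW)) (φ ∘ₗ mulL k H ∘ₗ (mulL k H).lTensor H) := by
  rw [diag, diag, op_push, tens_push_right, op_push]
  rfl

theorem op_diag_left (φ : H →ₗ[k] k) (t : (U ⊗[k] V) ⊗[k] W) :
    TensorProduct.assoc k U V W (op (diag (diag δU δV) δW) φ t) =
    op (tens δU (tens δV δW)) (φ ∘ₗ mulL k H ∘ₗ (mulL k H).rTensor H ∘ₗ
      (TensorProduct.assoc k H H H).symm.toLinearMap) (TensorProduct.assoc k U V W t) := by
  rw [diag, diag, op_push, tens_push_left, op_push]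
  exact assoc_op_tens_tens δU δV δW _ t

variable {δU δV δW δZ}

theorem IsCoaction.diag (hU : IsCoaction δU) (hV : IsCoaction δV) : IsCoaction (diag δU δV) :=
  (hU.tens hV).push (mulHom k H)

theorem op_σ_op_σinv (hU : IsCoaction δU) (hV : IsCoaction δV) (hW : IsCoaction δW)
    (t : U ⊗[k] (V ⊗[k] W)) :
    op (tens δU (tens δV δW)) (tri σ) (op (tens δU (tens δV δW)) (tri σinv) t) = t := by
  rw [← LinearMap.comp_apply, op_op (hU.tens (hV.tens hW)), dconv_σinv_σ,
    op_counit (hU.tens (hV.tens hW)), LinearMap.id_apply]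

theorem op_σinv_op_σ (hU : IsCoaction δU) (hV : IsCoaction δV) (hW : IsCoaction δW)
    (t : U ⊗[k] (V ⊗[k] W)) :
    op (tens δU (tens δV δW)) (tri σinv) (op (tens δU (tens δV δW)) (tri σ) t) = t := by
  rw [← LinearMap.comp_apply, op_op (hU.tens (hV.tens hW)), dconv_σ_σinv,
    op_counit (hU.tens (hV.tens hW)), LinearMap.id_apply]

theorem assocLinv_assocL (hU : IsCoaction δU) (hV : IsCoaction δV) (hW : IsCoaction δW)
    (t : (U ⊗[k] V) ⊗[k] W) : assocLinv δU δV δW (assocL δU δV δW t) = t := by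
  simp only [assocLinv, assocL, LinearMap.comp_apply, op_σ_op_σinv hU hV hW, LinearEquiv.coe_coe,
    LinearEquiv.symm_apply_apply]

theorem assocL_assocLinv (hU : IsCoaction δU) (hV : IsCoaction δV) (hW : IsCoaction δW)
    (t : U ⊗[k] (V ⊗[k] W)) : assocL δU δV δW (assocLinv δU δV δW t) = t := by
  simp only [assocLinv, assocL, LinearMap.comp_apply, op_σinv_op_σ hU hV hW, LinearEquiv.coe_coe,
    LinearEquiv.apply_symm_apply]

theorem assocLinv_colinear (hU : IsCoaction δU) (hV : IsCoaction δV) (hW : IsCoaction δW)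
    (t : U ⊗[k] (V ⊗[k] W)) : diag (diag δU δV) δW (assocLinv δU δV δW t) =
      (assocLinv δU δV δW).lTensor H (diag δU (diag δV δW) t) := by
  revert t
  rw [colinear_iff]
  intro φ
  refine LinearMap.ext fun t => (TensorProduct.assoc k U V W).injective ?_
  simp only [LinearMap.comp_apply, op_diag_left, op_diag_right, assocLinv, LinearEquiv.coe_coe,
    LinearEquiv.apply_symm_apply]
  rw [← LinearMap.comp_apply, ← LinearMap.comp_apply, op_op (hU.tens (hV.tens hW)),
    op_op (hU.tens (hV.tens hW)), dconv_quasi_assoc]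

theorem assocLinv_natural {U' V' W' : Type*} [AddCommGroup U'] [Module k U'] [AddCommGroup V']
    [Module k V'] [AddCommGroup W'] [Module k W'] {δU' : U' →ₗ[k] H ⊗[k] U'}
    {δV' : V' →ₗ[k] H ⊗[k] V'} {δW' : W' →ₗ[k] H ⊗[k] W'}
    {f : U →ₗ[k] U'} {g : V →ₗ[k] V'} {h : W →ₗ[k] W'}
    (hf : ∀ u, δU' (f u) = f.lTensor H (δU u)) (hg : ∀ v, δV' (g v) = g.lTensor H (δV v))
    (hh : ∀ w, δW' (h w) = h.lTensor H (δW w)) :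
    assocLinv δU' δV' δW' ∘ₗ TensorProduct.map f (TensorProduct.map g h) =
      TensorProduct.map (TensorProduct.map f g) h ∘ₗ assocLinv δU δV δW := by
  refine LinearMap.ext fun t => ?_
  have key := op_natural (tens_colinear hf (tens_colinear hg hh)) (tri (σ (k := k) (H := H))) t
  simp only [assocLinv, LinearMap.comp_apply, ← key, LinearEquiv.coe_coe]
  generalize op (tens δU (tens δV δW)) (tri (σ (k := k) (H := H))) t = s
  suffices h : (TensorProduct.assoc k U' V' W').symm.toLinearMap ∘ₗ
      TensorProduct.map f (TensorProduct.map g h) = TensorProduct.map (TensorProduct.map f g) h ∘ₗ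
      (TensorProduct.assoc k U V W).symm.toLinearMap from LinearMap.congr_fun h s
  ext u v w
  simp

theorem lid_colinear (u : k ⊗[k] U) : δU (TensorProduct.lid k U u) =
    (TensorProduct.lid k U).toLinearMap.lTensor H (diag (TensorProduct.mk k H k 1) δU u) := by
  revert u
  apply (colinear_iff (TensorProduct.lid k U).toLinearMap).2
  intro φ
  rw [diag, op_push, op_tens]
  refine TensorProduct.ext' fun c u => ?_
  have : TensorProduct.curry (φ ∘ₗ mulL k H) (1 : H) = φ := by ext; simp
  simp [this]

theorem rid_colinear (u : U ⊗[k] k) : δU (TensorProduct.rid k U u) =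
    (TensorProduct.rid k U).toLinearMap.lTensor H (diag δU (TensorProduct.mk k H k 1) u) := by
  revert u
  apply (colinear_iff (TensorProduct.rid k U).toLinearMap).2
  intro φ
  rw [diag, op_push, op_tens]
  refine TensorProduct.ext' fun u c => ?_
  simp only [LinearMap.comp_apply, LinearEquiv.coe_coe, TensorProduct.rid_tmul, map_smul, op_apply,
    opE_tmul]
  induction δU u using TensorProduct.induction_on with
  | zero => simp
  | add x y hx hy => simp only [map_add, hx, hy, LinearMap.add_apply, smul_add]
  | tmul d u => simp [op_apply, smul_smul, mul_comm]

theorem op_tens_unit_congr {φ ψ : H ⊗[k] (H ⊗[k] H) →ₗ[k] k}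
    (h : ∀ a b, φ (a ⊗ₜ[k] (1 ⊗ₜ[k] b)) = ψ (a ⊗ₜ[k] (1 ⊗ₜ[k] b))) :
    op (tens δU (tens (TensorProduct.mk k H k 1) δV)) φ =
      op (tens δU (tens (TensorProduct.mk k H k 1) δV)) ψ := by
  ext u v
  simp only [TensorProduct.AlgebraTensorModule.curry_apply, LinearMap.restrictScalars_self,
    TensorProduct.curry_apply, op_apply, tens_tmul, LinearMap.comp_apply]
  induction δU u using TensorProduct.induction_on with
  | zero => simp
  | add x y hx hy => simp only [TensorProduct.add_tmul, map_add, hx, hy]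
  | tmul d u =>
    induction δV v using TensorProduct.induction_on with
    | zero => simp
    | add x y hx hy => simp only [TensorProduct.tmul_add, map_add, hx, hy]
    | tmul e v => simp [h]

theorem triangle_lin (hU : IsCoaction δU) (hV : IsCoaction δV)
    (hk : IsCoaction (TensorProduct.mk k H k 1)) (t : (U ⊗[k] k) ⊗[k] V) :
    (TensorProduct.lid k V).toLinearMap.lTensor U (assocL δU (TensorProduct.mk k H k 1) δV t) =
      (TensorProduct.rid k U).toLinearMap.rTensor V t := by
  have h1 : op (tens δU (tens (TensorProduct.mk k H k 1) δV)) (tri (σ (k := k) (H := H))) =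
      LinearMap.id := by
    rw [← op_counit (hU.tens (hk.tens hV))]
    apply op_tens_unit_congr
    intro a b
    simp [σ_one, counit_one, mul_comm]
  have h2 : op (tens δU (tens (TensorProduct.mk k H k 1) δV)) (tri (σinv (k := k) (H := H))) =
      LinearMap.id := by
    refine LinearMap.ext fun t => ?_
    have := op_σ_op_σinv hU hk hV t
    rwa [h1] at this
  rw [assocL, h2]
  induction t using TensorProduct.induction_on with
  | zero => simp
  | add x y hx hy => simp only [map_add, hx, hy]
  | tmul x v =>
    induction x using TensorProduct.induction_on with
    | zero => simp
    | add x y hx hy => simp only [TensorProduct.add_tmul, map_add, hx, hy]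
    | tmul u c => simp [TensorProduct.smul_tmul']

/-- One side of the pentagon as a single operator; its functional is the left side of the cocycle
condition. -/
theorem assocLinv_diag (hU : IsCoaction δU) (hV : IsCoaction δV) (hW : IsCoaction δW)
    (hZ : IsCoaction δZ) (t : U ⊗[k] (V ⊗[k] (W ⊗[k] Z))) :
    assocLinv (diag δU δV) δW δZ (assocLinv δU δV (diag δW δZ) t) =
      (TensorProduct.assoc k (U ⊗[k] V) W Z).symm ((TensorProduct.assoc k U V (W ⊗[k] Z)).symm
        (op (tens δU (tens δV (tens δW δZ)))
          (dconv (tri (σ (k := k) (H := H)) ∘ₗ ((mulL k H).lTensor H).lTensor H)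
            (tri σ ∘ₗ (mulL k H).rTensor (H ⊗[k] H) ∘ₗ
              (TensorProduct.assoc k H H (H ⊗[k] H)).symm.toLinearMap)) t)) := by
  rw [← op_op (hU.tens (hV.tens (hW.tens hZ))), LinearMap.comp_apply]
  simp only [assocLinv, LinearMap.comp_apply, diag, tens_push_right, tens_push_left, op_push,
    LinearEquiv.coe_coe]
  congr 1
  exact (isSemicolinear_assoc_symm δU δV (tens δW δZ)).op _ _

/-- The other side of the pentagon; its functional is the right side of the cocycle condition. -/
theorem assocLinv_whisker (hU : IsCoaction δU) (hV : IsCoaction δV) (hW : IsCoaction δW)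
    (hZ : IsCoaction δZ) (t : U ⊗[k] (V ⊗[k] (W ⊗[k] Z))) :
    (assocLinv δU δV δW).rTensor Z (assocLinv δU (diag δV δW) δZ
      ((assocLinv δV δW δZ).lTensor U t)) =
      (TensorProduct.assoc k (U ⊗[k] V) W Z).symm ((TensorProduct.assoc k U V (W ⊗[k] Z)).symm
        (op (tens δU (tens δV (tens δW δZ)))
          (dconv (tmulFun counit (tri (σ (k := k) (H := H)))) (dconv
      (tri σ ∘ₗ ((mulL k H).rTensor H ∘ₗ
        (TensorProduct.assoc k H H H).symm.toLinearMap).lTensor H)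
      (tmulFun (tri σ) counit ∘ₗ ((TensorProduct.assoc k H (H ⊗[k] H) H).symm.toLinearMap ∘ₗ
        (TensorProduct.assoc k H H H).symm.toLinearMap.lTensor H)))) t)) := by
  rw [← op_op (hU.tens (hV.tens (hW.tens hZ))), ← op_op (hU.tens (hV.tens (hW.tens hZ))),
    LinearMap.comp_apply, LinearMap.comp_apply, op_tmulFun, op_counit hU]
  have e2 : ∀ t, assocLinv δU (diag δV δW) δZ
      ((TensorProduct.assoc k V W Z).symm.toLinearMap.lTensor U t) =
      (TensorProduct.assoc k U (V ⊗[k] W) Z).symm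
        ((TensorProduct.assoc k V W Z).symm.toLinearMap.lTensor U
        (op (tens δU (tens δV (tens δW δZ))) (tri (σ (k := k) (H := H)) ∘ₗ ((mulL k H).rTensor H ∘ₗ
        (TensorProduct.assoc k H H H).symm.toLinearMap).lTensor H) t)) := by
    intro t
    simp only [assocLinv, LinearMap.comp_apply, diag, tens_push_right, tens_push_left, op_push,
      LinearEquiv.coe_coe]
    congr 1
    refine (((IsSemicolinear.id δU).tens (isSemicolinear_assoc_symm δV δW δZ)).op _ _).trans ?_
    rw [LinearMap.lTensor_comp]
    rfl
  have e3 : ∀ t, (assocLinv δU δV δW).rTensor Z ((TensorProduct.assoc k U (V ⊗[k] W) Z).symm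
        ((TensorProduct.assoc k V W Z).symm.toLinearMap.lTensor U t)) =
      (TensorProduct.assoc k (U ⊗[k] V) W Z).symm ((TensorProduct.assoc k U V (W ⊗[k] Z)).symm
        (op (tens δU (tens δV (tens δW δZ))) (tmulFun (tri (σ (k := k) (H := H))) counit ∘ₗ
          ((TensorProduct.assoc k H (H ⊗[k] H) H).symm.toLinearMap ∘ₗ
        (TensorProduct.assoc k H H H).symm.toLinearMap.lTensor H)) t)) := by
    intro t
    have s := (isSemicolinear_assoc_symm δU (tens δV δW) δZ).op
      (tmulFun (tri (σ (k := k) (H := H))) counit)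
      ((TensorProduct.assoc k V W Z).symm.toLinearMap.lTensor U t)
    have s' := ((IsSemicolinear.id δU).tens (isSemicolinear_assoc_symm δV δW δZ)).op
      (tmulFun (tri (σ (k := k) (H := H))) counit ∘ₗ
        (TensorProduct.assoc k H (H ⊗[k] H) H).symm.toLinearMap) t
    rw [op_tmulFun, op_counit hZ] at s
    rw [assocLinv, LinearMap.rTensor_comp_apply]
    refine (congrArg _ (s.trans (congrArg _ s'))).trans ?_
    have pent : ∀ y : U ⊗[k] (V ⊗[k] (W ⊗[k] Z)),
        (TensorProduct.assoc k U V W).symm.toLinearMap.rTensor Z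
        ((TensorProduct.assoc k U (V ⊗[k] W) Z).symm
        ((TensorProduct.assoc k V W Z).symm.toLinearMap.lTensor U y)) =
        (TensorProduct.assoc k (U ⊗[k] V) W Z).symm
          ((TensorProduct.assoc k U V (W ⊗[k] Z)).symm y) := by
      intro y
      suffices h : (TensorProduct.assoc k U V W).symm.toLinearMap.rTensor Z ∘ₗ
        (TensorProduct.assoc k U (V ⊗[k] W) Z).symm.toLinearMap ∘ₗ
        (TensorProduct.assoc k V W Z).symm.toLinearMap.lTensor U =
        (TensorProduct.assoc k (U ⊗[k] V) W Z).symm.toLinearMap ∘ₗ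
          (TensorProduct.assoc k U V (W ⊗[k] Z)).symm.toLinearMap from LinearMap.congr_fun h y
      ext u v w z
      simp
    exact pent _
  rw [← e3, ← e2]
  congr 2
  exact LinearMap.lTensor_comp_apply U (TensorProduct.assoc k V W Z).symm.toLinearMap _ t

theorem pentagon_lin_inv (hU : IsCoaction δU) (hV : IsCoaction δV) (hW : IsCoaction δW)
    (hZ : IsCoaction δZ) (t : U ⊗[k] (V ⊗[k] (W ⊗[k] Z))) :
    (assocLinv δU δV δW).rTensor Z (assocLinv δU (diag δV δW) δZ
      ((assocLinv δV δW δZ).lTensor U t)) =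
    assocLinv (diag δU δV) δW δZ (assocLinv δU δV (diag δW δZ) t) := by
  rw [assocLinv_diag hU hV hW hZ, assocLinv_whisker hU hV hW hZ, dconv_cocycle]

end Quasi
end Coaction

/-! ### The monoidal category of finite-dimensional comodules -/

/-- A finite-dimensional left comodule over the coalgebra `H`. -/
structure FdComod (k : Type u) (H : Type v) [Field k] [NonAssocRing H] [Module k H]
    [IsScalarTower k H H] [SMulCommClass k H H] [Coalgebra k H] [DualQuasiHopfAlgebra k H] where
  carrier : Type u
  [addCommGroup : AddCommGroup carrier]
  [module : Module k carrier]
  [finite : FiniteDimensional k carrier]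
  coact : carrier →ₗ[k] H ⊗[k] carrier
  isCoaction : IsCoaction coact

namespace FdComod

variable {k : Type u} {H : Type v} [Field k] [NonAssocRing H] [Module k H]
  [IsScalarTower k H H] [SMulCommClass k H H] [Coalgebra k H] [DualQuasiHopfAlgebra k H]

attribute [instance] addCommGroup module finite

instance : CoeSort (FdComod k H) (Type u) := ⟨carrier⟩

/-- Morphisms of comodules are the colinear maps. -/
@[ext]
structure Hom (M N : FdComod k H) where
  lin : M →ₗ[k] N
  map_coact : ∀ m, N.coact (lin m) = lin.lTensor H (M.coact m)

instance : Category (FdComod k H) where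
  Hom := Hom
  id M := ⟨LinearMap.id, fun m => by simp⟩
  comp f g := ⟨g.lin ∘ₗ f.lin,
    fun m => by simp [g.map_coact, f.map_coact, LinearMap.lTensor_comp_apply]⟩

theorem hom_ext {M N : FdComod k H} {f g : M ⟶ N} (h : Hom.lin f = Hom.lin g) : f = g :=
  Hom.ext h

theorem comp_lin {M N P : FdComod k H} (f : M ⟶ N) (g : N ⟶ P) :
    Hom.lin (f ≫ g) = Hom.lin g ∘ₗ Hom.lin f := rfl

/-- An isomorphism from mutually inverse linear maps, one of which is colinear. -/
def isoMk {M N : FdComod k H} (f : M →ₗ[k] N) (g : N →ₗ[k] M) (hfg : ∀ m, g (f m) = m)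
    (hgf : ∀ n, f (g n) = n) (h : ∀ m, N.coact (f m) = f.lTensor H (M.coact m)) : M ≅ N where
  hom := ⟨f, h⟩
  inv := ⟨g, fun n => by
    have := congrArg (g.lTensor H) (h (g n))
    rw [hgf, ← LinearMap.lTensor_comp_apply,
      show g ∘ₗ f = LinearMap.id from LinearMap.ext hfg, LinearMap.lTensor_id] at this
    exact this.symm⟩
  hom_inv_id := hom_ext (LinearMap.ext hfg)
  inv_hom_id := hom_ext (LinearMap.ext hgf)

/-- The tensor product of comodules, with the diagonal coaction. -/
noncomputable def tensorObj (U V : FdComod k H) : FdComod k H where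
  carrier := U ⊗[k] V
  coact := diag U.coact V.coact
  isCoaction := U.isCoaction.diag V.isCoaction

variable (k H) in
/-- The unit object: `k` with the coaction `c ↦ 1 ⊗ c`. -/
noncomputable def tensorUnit : FdComod k H where
  carrier := k
  coact := TensorProduct.mk k H k 1
  isCoaction :=
    { counit := fun u => by simp [counit_one]
      coassoc := fun u => by simp [comul_one] }

/-- The tensor product of colinear maps. -/
noncomputable def tensorHom {U U' V V' : FdComod k H} (f : U ⟶ U') (g : V ⟶ V') :
    tensorObj U V ⟶ tensorObj U' V' where
  lin := TensorProduct.map (Hom.lin f) (Hom.lin g)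
  map_coact := push_colinear (tens_colinear (Hom.map_coact f) (Hom.map_coact g)) _

variable (U V W Z : FdComod k H)

/-- The associativity constraint, given by `σ⁻¹`. -/
noncomputable def associator :
    tensorObj (tensorObj U V) W ≅ tensorObj U (tensorObj V W) :=
  (isoMk (M := tensorObj U (tensorObj V W)) (N := tensorObj (tensorObj U V) W)
    (assocLinv U.coact V.coact W.coact) (assocL U.coact V.coact W.coact)
    (assocL_assocLinv U.isCoaction V.isCoaction W.isCoaction)
    (assocLinv_assocL U.isCoaction V.isCoaction W.isCoaction)
    (assocLinv_colinear U.isCoaction V.isCoaction W.isCoaction)).symm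

/-- The left unit constraint `k ⊗ U ≅ U`. -/
noncomputable def leftUnitor : tensorObj (tensorUnit k H) U ≅ U :=
  isoMk (M := tensorObj (tensorUnit k H) U) (N := U)
    (TensorProduct.lid k U).toLinearMap (TensorProduct.lid k U).symm.toLinearMap
    (LinearEquiv.symm_apply_apply (TensorProduct.lid k U))
    (LinearEquiv.apply_symm_apply (TensorProduct.lid k U)) (lid_colinear (δU := U.coact))

/-- The right unit constraint `U ⊗ k ≅ U`. -/
noncomputable def rightUnitor : tensorObj U (tensorUnit k H) ≅ U :=
  isoMk (M := tensorObj U (tensorUnit k H)) (N := U)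
    (TensorProduct.rid k U).toLinearMap (TensorProduct.rid k U).symm.toLinearMap
    (LinearEquiv.symm_apply_apply (TensorProduct.rid k U))
    (LinearEquiv.apply_symm_apply (TensorProduct.rid k U)) (rid_colinear (δU := U.coact))

noncomputable instance : MonoidalCategoryStruct (FdComod k H) where
  tensorObj := tensorObj
  whiskerLeft X _ _ f := tensorHom (𝟙 X) f
  whiskerRight f Y := tensorHom f (𝟙 Y)
  tensorHom := tensorHom
  tensorUnit := tensorUnit k H
  associator := associator
  leftUnitor := leftUnitor
  rightUnitor := rightUnitor

theorem tensorHom_lin {U U' V V' : FdComod k H} (f : U ⟶ U') (g : V ⟶ V') :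
    Hom.lin (f ⊗ₘ g) = TensorProduct.map (Hom.lin f) (Hom.lin g) := rfl
theorem whiskerLeft_lin (U : FdComod k H) {V V' : FdComod k H} (g : V ⟶ V') :
    Hom.lin (U ◁ g) = (Hom.lin g).lTensor U := rfl
theorem whiskerRight_lin {U U' : FdComod k H} (f : U ⟶ U') (V : FdComod k H) :
    Hom.lin (f ▷ V) = (Hom.lin f).rTensor V := rfl

noncomputable instance : MonoidalCategory (FdComod k H) where
  tensorHom_def f g := hom_ext <| by
    rw [comp_lin, whiskerLeft_lin, whiskerRight_lin, tensorHom_lin]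
    exact (LinearMap.lTensor_comp_rTensor _ _ _).symm
  id_tensorHom_id _ _ := hom_ext <| TensorProduct.map_id
  tensorHom_comp_tensorHom f₁ f₂ g₁ g₂ := hom_ext <| (TensorProduct.map_comp _ _ _ _).symm
  whiskerLeft_id _ _ := hom_ext <| TensorProduct.map_id
  id_whiskerRight _ _ := hom_ext <| TensorProduct.map_id
  associator_naturality {U V W U' V' W'} f g h := by
    rw [← Iso.inv_comp_eq, ← Category.assoc, ← Iso.eq_comp_inv]
    exact hom_ext (assocLinv_natural (Hom.map_coact f) (Hom.map_coact g) (Hom.map_coact h)).symm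
  leftUnitor_naturality f := hom_ext <| TensorProduct.ext' fun c u => by
    exact ((Hom.lin f).map_smul c u).symm
  rightUnitor_naturality f := hom_ext <| TensorProduct.ext' fun u c => by
    exact ((Hom.lin f).map_smul c u).symm
  pentagon U V W Z := by
    have h : U ◁ (α_ V W Z).inv ≫ (α_ U (V ⊗ W) Z).inv ≫ (α_ U V W).inv ▷ Z =
        (α_ U V (W ⊗ Z)).inv ≫ (α_ (U ⊗ V) W Z).inv := hom_ext <| LinearMap.ext fun t =>
      pentagon_lin_inv U.isCoaction V.isCoaction W.isCoaction Z.isCoaction t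
    have wl : ∀ {A B : FdComod k H} (X : FdComod k H) (e : A ≅ B), X ◁ e.hom ≫ X ◁ e.inv = 𝟙 _ := by
      intro A B X e
      refine hom_ext ?_
      have := congrArg (fun f => (Hom.lin f).lTensor X) e.hom_inv_id
      refine Eq.trans (LinearMap.lTensor_comp _ _ _).symm (this.trans (LinearMap.lTensor_id _ _))
    have wr : ∀ {A B : FdComod k H} (X : FdComod k H) (e : A ≅ B), e.hom ▷ X ≫ e.inv ▷ X = 𝟙 _ := by
      intro A B X e
      refine hom_ext ?_
      have := congrArg (fun f => (Hom.lin f).rTensor X) e.hom_inv_id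
      refine Eq.trans (LinearMap.rTensor_comp _ _ _).symm (this.trans (LinearMap.rTensor_id _ _))
    have h2 : (α_ (U ⊗ V) W Z).hom ≫ (α_ U V (W ⊗ Z)).hom ≫ (U ◁ (α_ V W Z).inv ≫
      (α_ U (V ⊗ W) Z).inv ≫ (α_ U V W).inv ▷ Z) = 𝟙 _ := by rw [h]; simp
    have h3 : ((α_ U V W).hom ▷ Z ≫ (α_ U (V ⊗ W) Z).hom ≫ U ◁ (α_ V W Z).hom) ≫
        (U ◁ (α_ V W Z).inv ≫ (α_ U (V ⊗ W) Z).inv ≫ (α_ U V W).inv ▷ Z) = 𝟙 _ := by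
      simp only [Category.assoc]
      rw [← Category.assoc (U ◁ (α_ V W Z).hom), wl, Category.id_comp, Iso.hom_inv_id_assoc, wr]
    have h4 : (U ◁ (α_ V W Z).inv ≫ (α_ U (V ⊗ W) Z).inv ≫ (α_ U V W).inv ▷ Z) ≫
        ((α_ (U ⊗ V) W Z).hom ≫ (α_ U V (W ⊗ Z)).hom) = 𝟙 _ := by rw [h]; simp
    calc _ = ((α_ U V W).hom ▷ Z ≫ (α_ U (V ⊗ W) Z).hom ≫ U ◁ (α_ V W Z).hom) ≫ 𝟙 _ := by simp
      _ = _ := by rw [← h4, ← Category.assoc, h3, Category.id_comp]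
  triangle U V := hom_ext <| LinearMap.ext fun t =>
    triangle_lin U.isCoaction V.isCoaction (tensorUnit k H).isCoaction t

end FdComod

/-! ### Matrix coefficients and zigzags -/

namespace Coaction
variable {k : Type*} [Field k]
variable {D E F G U V W A B : Type*}
  [AddCommGroup D] [Module k D] [AddCommGroup E] [Module k E] [AddCommGroup F] [Module k F]
  [AddCommGroup G] [Module k G]
  [AddCommGroup U] [Module k U] [AddCommGroup V] [Module k V] [AddCommGroup W] [Module k W]
  [AddCommGroup A] [Module k A] [AddCommGroup B] [Module k B]

section Iterated
variable [Coalgebra k D] [Coalgebra k E]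

variable (k D) in
/-- The twofold comultiplication `d ↦ d₁ ⊗ (d₂ ⊗ d₃)`. -/
noncomputable def comul3 : D →ₗ[k] D ⊗[k] (D ⊗[k] D) := comul.lTensor D ∘ₗ comul

variable (k D) in
/-- The fourfold comultiplication, bracketed to the right. -/
noncomputable def comul5 : D →ₗ[k] D ⊗[k] (D ⊗[k] (D ⊗[k] (D ⊗[k] D))) :=
  ((comul3 k D).lTensor D).lTensor D ∘ₗ comul3 k D

theorem cop3_eq (d : D) (T : D ⊗[k] (D ⊗[k] D) →ₗ[k] V) (f : D → D → D → V)
    (h : ∀ a b c, f a b c = T (a ⊗ₜ[k] (b ⊗ₜ[k] c))) : cop3 k d f = T (comul3 k D d) := by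
  refine cop2_eq d (T ∘ₗ comul.lTensor D) _ fun a b => ?_
  exact cop2_eq b (T ∘ₗ TensorProduct.mk k D _ a) _ fun _ _ => h _ _ _

theorem cop5_eq (d : D) (T : D ⊗[k] (D ⊗[k] (D ⊗[k] (D ⊗[k] D))) →ₗ[k] V)
    (f : D → D → D → D → D → V)
    (h : ∀ a b c x y, f a b c x y = T (a ⊗ₜ[k] (b ⊗ₜ[k] (c ⊗ₜ[k] (x ⊗ₜ[k] y))))) :
    cop5 k d f = T (comul5 k D d) := by
  refine cop3_eq d (T ∘ₗ ((comul3 k D).lTensor D).lTensor D) _ fun a b c => ?_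
  exact cop3_eq c (T ∘ₗ TensorProduct.mk k D _ a ∘ₗ TensorProduct.mk k D _ b) _
    fun _ _ _ => h _ _ _ _ _

theorem cop2_comm (d : D) (e : E) (f : D → D → E → E → V) :
    (cop2 k d fun a b => cop2 k e fun x y => f a b x y) =
      cop2 k e fun x y => cop2 k d fun a b => f a b x y := by
  simp only [cop2, sweedler]
  exact Finset.sum_comm

theorem cop3_comm (d : D) (e : E) (f : D → D → D → E → E → E → V) :
    (cop3 k d fun a b c => cop3 k e fun x y z => f a b c x y z) =
      cop3 k e fun x y z => cop3 k d fun a b c => f a b c x y z := by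
  simp only [cop3]
  simp only [cop2_comm (D := D) (E := E)]

theorem apply_comul3_tmul (d : D) (e : E)
    (T : (D ⊗[k] E) ⊗[k] ((D ⊗[k] E) ⊗[k] (D ⊗[k] E)) →ₗ[k] V) :
    T (comul3 k (D ⊗[k] E) (d ⊗ₜ[k] e)) = cop3 k d fun d₁ d₂ d₃ => cop3 k e fun e₁ e₂ e₃ =>
      T ((d₁ ⊗ₜ[k] e₁) ⊗ₜ[k] ((d₂ ⊗ₜ[k] e₂) ⊗ₜ[k] (d₃ ⊗ₜ[k] e₃))) := by
  refine (comul_tmul_apply d e (T ∘ₗ comul.lTensor (D ⊗[k] E))).trans ?_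
  simp only [cop3]
  congr 1; ext d₁ d'
  rw [← cop2_comm]
  congr 1; ext e₁ e'
  exact comul_tmul_apply d' e' (T ∘ₗ TensorProduct.mk k _ _ (d₁ ⊗ₜ[k] e₁))

theorem apply_comul5_tmul (d : D) (e : E)
    (T : (D ⊗[k] E) ⊗[k] ((D ⊗[k] E) ⊗[k] ((D ⊗[k] E) ⊗[k] ((D ⊗[k] E) ⊗[k] (D ⊗[k] E))))
      →ₗ[k] V) :
    T (comul5 k (D ⊗[k] E) (d ⊗ₜ[k] e)) = cop5 k d fun d₁ d₂ d₃ d₄ d₅ =>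
      cop5 k e fun e₁ e₂ e₃ e₄ e₅ =>
      T ((d₁ ⊗ₜ[k] e₁) ⊗ₜ[k] ((d₂ ⊗ₜ[k] e₂) ⊗ₜ[k] ((d₃ ⊗ₜ[k] e₃) ⊗ₜ[k]
        ((d₄ ⊗ₜ[k] e₄) ⊗ₜ[k] (d₅ ⊗ₜ[k] e₅))))) := by
  refine (apply_comul3_tmul d e
    (T ∘ₗ ((comul3 k (D ⊗[k] E)).lTensor (D ⊗[k] E)).lTensor (D ⊗[k] E))).trans ?_
  simp only [cop5]
  congr 1; ext d₁ d₂ d'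
  rw [← cop3_comm]
  congr 1; ext e₁ e₂ e'
  exact apply_comul3_tmul d' e' (T ∘ₗ TensorProduct.mk k _ _ (d₁ ⊗ₜ[k] e₁) ∘ₗ
    TensorProduct.mk k _ _ (d₂ ⊗ₜ[k] e₂))

end Iterated

section Coefficients

variable {ι : Type*} (b : Module.Basis ι k W) (δ : W →ₗ[k] D ⊗[k] W)

/-- The matrix coefficients of a coaction: `δ(bᵢ) = ∑ⱼ coef i j ⊗ bⱼ`. -/
noncomputable def coef (i j : ι) : D := TensorProduct.rid k D ((b.coord j).lTensor D (δ (b i)))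

theorem coord_op (φ : D →ₗ[k] k) (i j : ι) : b.coord j (op δ φ (b i)) = φ (coef b δ i j) := by
  rw [op_apply, coef]
  induction δ (b i) using TensorProduct.induction_on with
  | zero => simp
  | add x y hx hy => simp only [map_add, hx, hy]
  | tmul d u => simp [mul_comm]

variable [Fintype ι]

theorem op_basis (φ : D →ₗ[k] k) (i : ι) : op δ φ (b i) = ∑ j, φ (coef b δ i j) • b j := by
  rw [← b.sum_repr (op δ φ (b i))]
  exact Finset.sum_congr rfl fun j _ => by rw [← coord_op, Module.Basis.coord_apply]

theorem coact_basis (i : ι) : δ (b i) = ∑ j, coef b δ i j ⊗ₜ[k] b j := by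
  refine eq_of_forall_functional fun φ => ?_
  rw [← op_apply, op_basis]
  simp

variable [Coalgebra k D] {δ}

theorem comul_coef (hδ : IsCoaction δ) (i j : ι) :
    comul (R := k) (coef b δ i j) = ∑ l, coef b δ i l ⊗ₜ[k] coef b δ l j := by
  have h1 := hδ.coassoc (b i)
  rw [coact_basis b δ i] at h1
  simp only [map_sum, LinearMap.rTensor_tmul, LinearMap.lTensor_tmul] at h1
  have h2 := congrArg ((TensorProduct.rid k D).toLinearMap.lTensor D ∘ₗ
    ((b.coord j).lTensor D).lTensor D) h1
  have e : ∀ (t : D ⊗[k] D) (w : W), (TensorProduct.rid k D).toLinearMap.lTensor D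
      (((b.coord j).lTensor D).lTensor D (TensorProduct.assoc k D D W (t ⊗ₜ[k] w))) =
      b.coord j w • t := by
    intro t w
    induction t using TensorProduct.induction_on with
    | zero => simp
    | add x y hx hy => simp only [TensorProduct.add_tmul, map_add, hx, hy, smul_add]
    | tmul x y => simp
  simp only [map_sum, LinearMap.comp_apply, e, LinearMap.lTensor_tmul] at h2
  classical
  simp only [Module.Basis.coord_apply, b.repr_self, Finsupp.single_apply, ite_smul, one_smul,
    zero_smul, Finset.sum_ite_eq', Finset.mem_univ, if_true] at h2
  rw [h2]
  exact Finset.sum_congr rfl fun l _ => rfl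

theorem comul3_coef (hδ : IsCoaction δ) (i j : ι) :
    comul3 k D (coef b δ i j) =
      ∑ l, ∑ m, coef b δ i l ⊗ₜ[k] (coef b δ l m ⊗ₜ[k] coef b δ m j) := by
  rw [comul3, LinearMap.comp_apply, comul_coef b hδ]
  simp only [map_sum, LinearMap.lTensor_tmul, comul_coef b hδ, TensorProduct.tmul_sum]

theorem comul5_coef (hδ : IsCoaction δ) (i j : ι) :
    comul5 k D (coef b δ i j) =
      ∑ l, ∑ m, ∑ n, ∑ o, coef b δ i l ⊗ₜ[k] (coef b δ l m ⊗ₜ[k] (coef b δ m n ⊗ₜ[k]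
        (coef b δ n o ⊗ₜ[k] coef b δ o j))) := by
  rw [comul5, LinearMap.comp_apply, comul3_coef b hδ]
  simp only [map_sum, LinearMap.lTensor_tmul, comul3_coef b hδ, TensorProduct.tmul_sum]

end Coefficients

section DualPairing

variable [FiniteDimensional k W]

/-- Through `κ : A ≃ W*`, the coaction of `E` on `A` is the transpose of the coaction of `D` on `W`
along `s`. The identification `κ` is a parameter so that both `(X ⊗ Y)*` and `Y* ⊗ X*` can serve as
`A` for `W = X ⊗ Y`. -/
def IsAdjoint (κ : A ≃ₗ[k] Module.Dual k W) (δ : W →ₗ[k] D ⊗[k] W) (δA : A →ₗ[k] E ⊗[k] A)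
    (s : D →ₗ[k] E) : Prop :=
  ∀ (ψ : E →ₗ[k] k) (a : A) (w : W), κ (op δA ψ a) w = κ a (op δ (ψ ∘ₗ s) w)

/-- The tensor `∑ᵢ κ⁻¹(bⁱ) ⊗ t(bᵢ)` representing `t`. -/
noncomputable def coevT (κ : A ≃ₗ[k] Module.Dual k W) : (W →ₗ[k] W) →ₗ[k] A ⊗[k] W :=
  κ.symm.toLinearMap.rTensor W ∘ₗ (dualTensorHomEquiv k W W).symm.toLinearMap

theorem coevT_basis {ι : Type*} [Fintype ι] (b : Module.Basis ι k W) (κ : A ≃ₗ[k] Module.Dual k W)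
    (t : W →ₗ[k] W) : coevT κ t = ∑ i, κ.symm (b.coord i) ⊗ₜ[k] t (b i) := by
  have : (dualTensorHomEquiv k W W).symm t = ∑ i, b.coord i ⊗ₜ[k] t (b i) := by
    rw [LinearEquiv.symm_apply_eq, map_sum]
    refine b.ext fun j => ?_
    classical
    simp [LinearMap.sum_apply, Finsupp.single_apply, ite_smul]
  rw [coevT, LinearMap.comp_apply, LinearEquiv.coe_coe, this]
  simp

/-- The evaluation `w ⊗ x ↦ κ(x)(t w)` twisted by `t`. -/
noncomputable def evT (κ : B ≃ₗ[k] Module.Dual k W) (t : W →ₗ[k] W) : W ⊗[k] B →ₗ[k] k :=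
  TensorProduct.lift (κ.toLinearMap.flip ∘ₗ t)

@[simp] theorem evT_tmul (κ : B ≃ₗ[k] Module.Dual k W) (t : W →ₗ[k] W) (w : W) (x : B) :
    evT κ t (w ⊗ₜ[k] x) = κ x (t w) := rfl

variable {ι : Type*} [Fintype ι] (b : Module.Basis ι k W)
variable {κ : A ≃ₗ[k] Module.Dual k W} {δ : W →ₗ[k] D ⊗[k] W} {δA : A →ₗ[k] E ⊗[k] A}
  {s : D →ₗ[k] E}

theorem IsAdjoint.coact_basis (h : IsAdjoint κ δ δA s) (j : ι) :
    δA (κ.symm (b.coord j)) = ∑ i, s (coef b δ i j) ⊗ₜ[k] κ.symm (b.coord i) := by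
  refine eq_of_forall_functional fun φ => κ.injective (b.ext fun i => ?_)
  rw [← op_apply, h, LinearEquiv.apply_symm_apply, coord_op]
  classical
  simp [LinearMap.sum_apply, Finsupp.single_apply]

variable [Coalgebra k D]

/-- On the tensor representing `op δ l`, a functional of the two coactions acts by convolution: it
only changes `l`. -/
theorem op_coevT (h : IsAdjoint κ δ δA s) (hδ : IsCoaction δ) (p : D →ₗ[k] F) (l : D →ₗ[k] k)
    (τ : E ⊗[k] F →ₗ[k] k) :
    op (tens δA (push p δ)) τ (coevT κ (op δ l)) = coevT κ (op δ (τ ∘ₗ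
      TensorProduct.map s ((TensorProduct.lid k F).toLinearMap ∘ₗ TensorProduct.map l p) ∘ₗ
        comul3 k D)) := by
  let b := Module.finBasis k W
  have hp : ∀ i, push p δ (b i) = ∑ j, p (coef b δ i j) ⊗ₜ[k] b j := by
    intro i; rw [push, LinearMap.comp_apply, Coaction.coact_basis b δ i]; simp
  rw [coevT_basis b, coevT_basis b]
  simp only [op_basis b, map_sum, TensorProduct.tmul_sum, TensorProduct.tmul_smul, map_smul]
  simp only [op_apply, tens_tmul, h.coact_basis b, hp, TensorProduct.sum_tmul,
    TensorProduct.tmul_sum, map_sum, LinearMap.comp_apply, comul3_coef b hδ,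
    TensorProduct.tensorTensorTensorComm_tmul, LinearMap.rTensor_tmul, TensorProduct.lid_tmul,
    TensorProduct.map_tmul, LinearEquiv.coe_coe, Finset.smul_sum, smul_smul, Finset.sum_smul,
    TensorProduct.tmul_smul, map_smul, smul_eq_mul]
  have key : ∀ f : Fin (Module.finrank k W) → Fin (Module.finrank k W) →
      Fin (Module.finrank k W) → Fin (Module.finrank k W) → A ⊗[k] W,
      ∑ x, ∑ y, ∑ z, ∑ t, f x y z t = ∑ t, ∑ z, ∑ x, ∑ y, f x y z t := by
    intro f
    simp only [← Fintype.sum_prod_type']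
    exact Fintype.sum_equiv ⟨fun p => (p.2.2.2, p.2.2.1, p.1, p.2.1),
      fun q => (q.2.2.1, q.2.2.2, q.2.1, q.1), fun _ => rfl, fun _ => rfl⟩ _ _ fun _ => rfl
  exact key _

/-- The zigzag on the dual, for arbitrary functionals `l` and `m` in the coevaluation and evaluation
and `τ` in place of the associator: it is the transpose of an explicit operator `op`. This gives one
of the triangle identities, and also the comparison maps between duals of tensor products. -/
theorem transpose_zigzag {κB : B ≃ₗ[k] Module.Dual k W} {δB : B →ₗ[k] G ⊗[k] B} {s' : D →ₗ[k] G}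
    (h : IsAdjoint κ δ δA s) (h' : IsAdjoint κB δ δB s')
    (hδ : IsCoaction δ) (p : D →ₗ[k] F) (l m : D →ₗ[k] k)
    (τ : E →ₗ[k] F →ₗ[k] G →ₗ[k] k) (x : B) (w : W) :
    κ (TensorProduct.rid k A ((evT κB (op δ m)).lTensor A
      (op (tens δA (tens (push p δ) δB)) (tri τ)
        (TensorProduct.assoc k A W B (coevT κ (op δ l) ⊗ₜ[k] x))))) w =
    κB x (op δ (tri τ ∘ₗ TensorProduct.map s ((TensorProduct.lid k _).toLinearMap ∘ₗ
      TensorProduct.map l (TensorProduct.map p ((TensorProduct.lid k _).toLinearMap ∘ₗ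
        TensorProduct.map m s'))) ∘ₗ comul5 k D) w) := by
  let b := Module.finBasis k W
  have hp : ∀ i, push p δ (b i) = ∑ j, p (coef b δ i j) ⊗ₜ[k] b j := by
    intro i; rw [push, LinearMap.comp_apply, Coaction.coact_basis b δ i]; simp
  have hev : ∀ i j, evT κB (op δ m) (b i ⊗ₜ[k] κB.symm (b.coord j)) = m (coef b δ i j) :=
    fun i j => by rw [evT_tmul, LinearEquiv.apply_symm_apply, coord_op]
  classical
  suffices hh : κ.toLinearMap ∘ₗ (TensorProduct.rid k A).toLinearMap ∘ₗ
      (evT κB (op δ m)).lTensor A ∘ₗ op (tens δA (tens (push p δ) δB)) (tri τ) ∘ₗ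
      (TensorProduct.assoc k A W B).toLinearMap ∘ₗ TensorProduct.mk k _ B (coevT κ (op δ l)) =
      LinearMap.lcomp k k (op δ (tri τ ∘ₗ TensorProduct.map s
      ((TensorProduct.lid k _).toLinearMap ∘ₗ
        TensorProduct.map l (TensorProduct.map p ((TensorProduct.lid k _).toLinearMap ∘ₗ
        TensorProduct.map m s'))) ∘ₗ comul5 k D)) ∘ₗ κB.toLinearMap from
    LinearMap.congr_fun (LinearMap.congr_fun hh x) w
  refine (b.dualBasis.map κB.symm).ext fun j => b.ext fun i => ?_
  simp only [LinearMap.comp_apply, LinearEquiv.coe_coe, Module.Basis.map_apply,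
    Module.Basis.coe_dualBasis, LinearMap.lcomp_apply, LinearEquiv.apply_symm_apply,
    TensorProduct.mk_apply, coord_op]
  rw [coevT_basis b]
  simp only [op_basis b, map_sum, TensorProduct.tmul_sum, TensorProduct.tmul_smul, map_smul,
    TensorProduct.sum_tmul, TensorProduct.assoc_tmul, ← TensorProduct.smul_tmul']
  simp only [op_apply (tens _ _), tens_tmul, h.coact_basis b, h'.coact_basis b, hp,
    TensorProduct.sum_tmul,
    TensorProduct.tmul_sum, map_sum, comul5_coef b hδ,
    TensorProduct.tensorTensorTensorComm_tmul, LinearMap.rTensor_tmul, TensorProduct.lid_tmul,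
    TensorProduct.map_tmul, Finset.smul_sum, smul_smul, TensorProduct.rid_tmul,
    TensorProduct.tmul_smul, map_smul, smul_eq_mul, tri_tmul, LinearMap.lTensor_tmul, hev,
    LinearMap.sum_apply, LinearMap.smul_apply, LinearEquiv.apply_symm_apply,
    Module.Basis.coord_apply, b.repr_self, LinearMap.comp_apply, LinearEquiv.coe_coe,
    Finsupp.single_apply, Finset.sum_ite_eq, Finset.mem_univ, mul_ite, mul_one, mul_zero, if_true]
  refine Finset.sum_congr rfl fun x _ => Finset.sum_congr rfl fun y _ => ?_
  rw [Finset.sum_comm]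
  refine Finset.sum_congr rfl fun z _ => Finset.sum_congr rfl fun t _ => ?_
  ring

/-- The zigzag on `W`, for arbitrary functionals `l`, `m` and `τ`. -/
theorem zigzag (h : IsAdjoint κ δ δA s) (hδ : IsCoaction δ) (p : D →ₗ[k] F) (p' : D →ₗ[k] G)
    (l m : D →ₗ[k] k) (τ : F →ₗ[k] E →ₗ[k] G →ₗ[k] k) (w : W) :
    TensorProduct.lid k W ((evT κ (op δ m)).rTensor W ((TensorProduct.assoc k W A W).symm
      (op (tens (push p δ) (tens δA (push p' δ))) (tri τ) (w ⊗ₜ[k] coevT κ (op δ l))))) =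
    op δ (tri τ ∘ₗ TensorProduct.map p ((TensorProduct.lid k _).toLinearMap ∘ₗ
      TensorProduct.map m (TensorProduct.map s ((TensorProduct.lid k _).toLinearMap ∘ₗ
        TensorProduct.map l p'))) ∘ₗ comul5 k D) w := by
  let b := Module.finBasis k W
  have hp : ∀ i, push p δ (b i) = ∑ j, p (coef b δ i j) ⊗ₜ[k] b j := by
    intro i; rw [push, LinearMap.comp_apply, Coaction.coact_basis b δ i]; simp
  have hp' : ∀ i, push p' δ (b i) = ∑ j, p' (coef b δ i j) ⊗ₜ[k] b j := by
    intro i; rw [push, LinearMap.comp_apply, Coaction.coact_basis b δ i]; simp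
  have hev : ∀ i j, evT κ (op δ m) (b i ⊗ₜ[k] κ.symm (b.coord j)) = m (coef b δ i j) :=
    fun i j => by rw [evT_tmul, LinearEquiv.apply_symm_apply, coord_op]
  suffices hh : (TensorProduct.lid k W).toLinearMap ∘ₗ (evT κ (op δ m)).rTensor W ∘ₗ
      (TensorProduct.assoc k W A W).symm.toLinearMap ∘ₗ
      op (tens (push p δ) (tens δA (push p' δ))) (tri τ) ∘ₗ
      (TensorProduct.mk k W _).flip (coevT κ (op δ l)) =
      op δ (tri τ ∘ₗ TensorProduct.map p ((TensorProduct.lid k _).toLinearMap ∘ₗ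
      TensorProduct.map m (TensorProduct.map s ((TensorProduct.lid k _).toLinearMap ∘ₗ
        TensorProduct.map l p'))) ∘ₗ comul5 k D) from LinearMap.congr_fun hh w
  refine b.ext fun i => ?_
  simp only [LinearMap.comp_apply, LinearEquiv.coe_coe, LinearMap.flip_apply,
    TensorProduct.mk_apply]
  rw [coevT_basis b]
  simp only [op_basis b, map_sum, TensorProduct.tmul_sum, TensorProduct.tmul_smul, map_smul]
  simp only [op_apply (tens _ _), tens_tmul, h.coact_basis b, hp, hp',
    TensorProduct.sum_tmul,
    TensorProduct.tmul_sum, map_sum, comul5_coef b hδ,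
    TensorProduct.tensorTensorTensorComm_tmul, LinearMap.rTensor_tmul, TensorProduct.lid_tmul,
    TensorProduct.map_tmul, Finset.smul_sum, smul_smul, TensorProduct.assoc_symm_tmul,
    TensorProduct.tmul_smul, map_smul, smul_eq_mul, tri_tmul, hev,
    LinearMap.comp_apply, LinearEquiv.coe_coe, Finset.sum_smul]
  simp only [← Fintype.sum_prod_type']
  refine Fintype.sum_equiv ⟨fun p => (p.2.2.1, p.2.2.2.2, p.2.2.2.1, p.1, p.2.1),
    fun q => (q.2.2.2.1, q.2.2.2.2, q.1, q.2.2.1, q.2.1), fun _ => rfl, fun _ => rfl⟩ _ _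
    fun p => ?_
  simp only [Equiv.coe_fn_mk]
  congr 1
  ring

end DualPairing

end Coaction

/-! ### Coactions on dual spaces -/

namespace Coaction
variable {k : Type*} [Field k]
variable {D E F G U V W A B X Y A₁ A₂ : Type*}
  [AddCommGroup D] [Module k D] [AddCommGroup E] [Module k E] [AddCommGroup F] [Module k F]
  [AddCommGroup G] [Module k G]
  [AddCommGroup U] [Module k U] [AddCommGroup V] [Module k V] [AddCommGroup W] [Module k W]
  [AddCommGroup A] [Module k A] [AddCommGroup B] [Module k B]
  [AddCommGroup X] [Module k X] [AddCommGroup Y] [Module k Y]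
  [AddCommGroup A₁] [Module k A₁] [AddCommGroup A₂] [Module k A₂]

theorem IsSemicolinear.comp {δ : U →ₗ[k] D ⊗[k] U} {δ' : V →ₗ[k] E ⊗[k] V} {δ'' : W →ₗ[k] F ⊗[k] W}
    {π : D →ₗ[k] E} {ρ : E →ₗ[k] F} {f : U →ₗ[k] V} {g : V →ₗ[k] W}
    (hg : IsSemicolinear δ' δ'' ρ g) (hf : IsSemicolinear δ δ' π f) :
    IsSemicolinear δ δ'' (ρ ∘ₗ π) (g ∘ₗ f) := fun u => by
  rw [LinearMap.comp_apply, hg, hf, TensorProduct.map_comp, LinearMap.comp_apply]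

theorem IsSemicolinear.symm {δ : U →ₗ[k] D ⊗[k] U} {δ' : V →ₗ[k] E ⊗[k] V}
    {π : D ≃ₗ[k] E} {f : U ≃ₗ[k] V}
    (hf : IsSemicolinear δ δ' π.toLinearMap f.toLinearMap) :
    IsSemicolinear δ' δ π.symm.toLinearMap f.symm.toLinearMap := fun v => by
  have := hf (f.symm v)
  simp only [LinearEquiv.coe_coe, LinearEquiv.apply_symm_apply] at this
  rw [this, ← LinearMap.comp_apply (TensorProduct.map _ _), ← TensorProduct.map_comp]
  simp

@[simp] theorem push_id (δ : U →ₗ[k] D ⊗[k] U) : push LinearMap.id δ = δ := by simp [push]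

section Dual
variable [FiniteDimensional k W]
variable {κ : A ≃ₗ[k] Module.Dual k W} {δ : W →ₗ[k] D ⊗[k] W} {δA : A →ₗ[k] E ⊗[k] A}
  {s : D →ₗ[k] E}

theorem IsAdjoint.push_target (h : IsAdjoint κ δ δA s) (π : E →ₗ[k] F) :
    IsAdjoint κ δ (push π δA) (π ∘ₗ s) := fun ψ a w => by rw [op_push, h]; rfl

theorem IsAdjoint.of_push {π : F →ₗ[k] D} {δ : W →ₗ[k] F ⊗[k] W}
    (h : IsAdjoint κ (push π δ) δA s) :
    IsAdjoint κ δ δA (s ∘ₗ π) := fun ψ a w => by rw [h, op_push]; rfl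

/-- The coaction `φ ↦ ∑ᵢ φ(bᵢ₍₀₎) s(bᵢ₍₋₁₎) ⊗ bⁱ` on the dual space. A basis is chosen for the
definition; by `dualCoact_apply` any basis gives the same map. -/
noncomputable def dualCoact (s : D →ₗ[k] E) (δ : W →ₗ[k] D ⊗[k] W) :
    Module.Dual k W →ₗ[k] E ⊗[k] Module.Dual k W :=
  ∑ i, (TensorProduct.mk k E _).flip ((Module.finBasis k W).coord i) ∘ₗ s ∘ₗ
    (TensorProduct.rid k D).toLinearMap ∘ₗ
      (LinearMap.applyₗ (δ (Module.finBasis k W i))) ∘ₗ LinearMap.lTensorHom D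

theorem dualCoact_isAdjoint (s : D →ₗ[k] E) (δ : W →ₗ[k] D ⊗[k] W) :
    IsAdjoint (LinearEquiv.refl k _) δ (dualCoact s δ) s := by
  intro ψ φ w
  rw [LinearEquiv.refl_apply, LinearEquiv.refl_apply]
  have key : ∀ (w : W), ψ (s (TensorProduct.rid k D (φ.lTensor D (δ w)))) =
      φ (op δ (ψ ∘ₗ s) w) := by
    intro w
    rw [op_apply]
    induction δ w using TensorProduct.induction_on with
    | zero => simp
    | add x y hx hy => simp only [map_add, hx, hy]
    | tmul d u => simp [mul_comm]
  have h2 : op (dualCoact s δ) ψ φ = ∑ i, φ (op δ (ψ ∘ₗ s) (Module.finBasis k W i)) •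
      (Module.finBasis k W).coord i := by
    rw [op_apply, dualCoact]
    simp [LinearMap.sum_apply, ← key]
  have h3 : op (dualCoact s δ) ψ φ = φ ∘ₗ op δ (ψ ∘ₗ s) := by
    rw [h2]
    refine (Module.finBasis k W).ext fun j => ?_
    simp [LinearMap.sum_apply, Finsupp.single_apply]
  rw [h3, LinearMap.comp_apply]

theorem op_dualCoact (s : D →ₗ[k] E) (δ : W →ₗ[k] D ⊗[k] W) (ψ : E →ₗ[k] k)
    (φ : Module.Dual k W) : op (dualCoact s δ) ψ φ = φ ∘ₗ op δ (ψ ∘ₗ s) :=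
  LinearMap.ext fun w => dualCoact_isAdjoint s δ ψ φ w

theorem dualCoact_apply {ι : Type*} [Fintype ι] (b : Module.Basis ι k W)
    (s : D →ₗ[k] E) (δ : W →ₗ[k] D ⊗[k] W) (φ : Module.Dual k W) :
    dualCoact s δ φ = ∑ i, s (TensorProduct.rid k D (φ.lTensor D (δ (b i)))) ⊗ₜ[k] b.coord i := by
  refine eq_of_forall_functional fun ψ => ?_
  rw [← op_apply, op_dualCoact]
  have key : ∀ (w : W), ψ (s (TensorProduct.rid k D (φ.lTensor D (δ w)))) =
      φ (op δ (ψ ∘ₗ s) w) := by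
    intro w
    rw [op_apply]
    induction δ w using TensorProduct.induction_on with
    | zero => simp
    | add x y hx hy => simp only [map_add, hx, hy]
    | tmul d u => simp [mul_comm]
  classical
  refine b.ext fun j => ?_
  simp [LinearMap.sum_apply, Finsupp.single_apply, key]

/-- Coalgebra anti-morphisms. Anti-comultiplicativity is stated for the convolution product of
functionals, which is equivalent to the statement for elements by `IsAntiCoalg.comul_apply`. -/
structure IsAntiCoalg [Coalgebra k D] [Coalgebra k E] (s : D →ₗ[k] E) : Prop where
  counit_comp : counit (R := k) ∘ₗ s = counit
  dconv_comp : ∀ φ ψ : E →ₗ[k] k, dconv φ ψ ∘ₗ s = dconv (ψ ∘ₗ s) (φ ∘ₗ s)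

theorem IsCoaction.dual [Coalgebra k D] [Coalgebra k E] (hδ : IsCoaction δ) (hs : IsAntiCoalg s) :
    IsCoaction (dualCoact s δ) := by
  apply isCoaction_of_op
  · ext φ w
    rw [op_dualCoact, hs.counit_comp, op_counit hδ]
    rfl
  · intro ψ ψ'
    ext φ w
    rw [LinearMap.comp_apply, op_dualCoact, op_dualCoact, op_dualCoact, hs.dconv_comp,
      ← op_op hδ]
    rfl

theorem op_evT [Coalgebra k D] (h : IsAdjoint κ δ δA s) (hδ : IsCoaction δ) (p : D →ₗ[k] F)
    (m : D →ₗ[k] k) (τ : F ⊗[k] E →ₗ[k] k) :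
    evT κ (op δ m) ∘ₗ op (tens (push p δ) δA) τ = evT κ (op δ (τ ∘ₗ
      TensorProduct.map p ((TensorProduct.lid k E).toLinearMap ∘ₗ TensorProduct.map m s) ∘ₗ
        comul3 k D)) := by
  let b := Module.finBasis k W
  have hp : ∀ i, push p δ (b i) = ∑ j, p (coef b δ i j) ⊗ₜ[k] b j := by
    intro i; rw [push, LinearMap.comp_apply, Coaction.coact_basis b δ i]; simp
  have hev : ∀ m i j, evT κ (op δ m) (b i ⊗ₜ[k] κ.symm (b.coord j)) = m (coef b δ i j) :=
    fun m i j => by rw [evT_tmul, LinearEquiv.apply_symm_apply, coord_op]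
  classical
  refine (b.tensorProduct (b.dualBasis.map κ.symm)).ext fun ij => ?_
  obtain ⟨i, j⟩ := ij
  simp only [Module.Basis.tensorProduct_apply, LinearMap.comp_apply, Module.Basis.map_apply,
    Module.Basis.coe_dualBasis, hev]
  simp only [op_apply (tens _ _), tens_tmul, h.coact_basis b, hp, TensorProduct.sum_tmul,
    TensorProduct.tmul_sum, map_sum, comul3_coef b hδ, LinearMap.comp_apply, LinearEquiv.coe_coe,
    TensorProduct.tensorTensorTensorComm_tmul, LinearMap.rTensor_tmul, TensorProduct.lid_tmul,
    TensorProduct.map_tmul, map_smul, smul_eq_mul, hev,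
    TensorProduct.tmul_smul]
  rw [Finset.sum_comm]
  refine Finset.sum_congr rfl fun x _ => Finset.sum_congr rfl fun y _ => ?_
  ring

end Dual

section TensorDual
variable [FiniteDimensional k X] [FiniteDimensional k Y]

variable (k X Y) in
/-- The identification `Y* ⊗ X* ≃ (X ⊗ Y)*`, with the order of the factors reversed as for duals in
a monoidal category. -/
noncomputable def tensorDual :
    (Module.Dual k Y ⊗[k] Module.Dual k X) ≃ₗ[k] Module.Dual k (X ⊗[k] Y) :=
  TensorProduct.comm k _ _ ≪≫ₗ TensorProduct.dualDistribEquiv k X Y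

@[simp] theorem tensorDual_tmul (φ : Module.Dual k Y) (ξ : Module.Dual k X) (x : X) (y : Y) :
    tensorDual k X Y (φ ⊗ₜ[k] ξ) (x ⊗ₜ[k] y) = ξ x * φ y := rfl

variable {δX : X →ₗ[k] D ⊗[k] X} {δY : Y →ₗ[k] D ⊗[k] Y} {s : D →ₗ[k] E}

theorem tensorDual_isAdjoint (δX : X →ₗ[k] D ⊗[k] X) (δY : Y →ₗ[k] D ⊗[k] Y) (s : D →ₗ[k] E) :
    IsAdjoint (tensorDual k X Y) (tens δX δY)
    (tens (dualCoact s δY) (dualCoact s δX))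
    ((TensorProduct.comm k E E).toLinearMap ∘ₗ TensorProduct.map s s) := by
  intro ψ a w
  let x := Module.finBasis k X
  let y := Module.finBasis k Y
  have hX := (dualCoact_isAdjoint s δX).coact_basis x
  have hY := (dualCoact_isAdjoint s δY).coact_basis y
  simp only [LinearEquiv.refl_symm, LinearEquiv.refl_apply] at hX hY
  suffices hh : (tensorDual k X Y).toLinearMap ∘ₗ op (tens (dualCoact s δY) (dualCoact s δX)) ψ =
      LinearMap.lcomp k k (op (tens δX δY) (ψ ∘ₗ (TensorProduct.comm k E E).toLinearMap ∘ₗ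
        TensorProduct.map s s)) ∘ₗ (tensorDual k X Y).toLinearMap from
    LinearMap.congr_fun (LinearMap.congr_fun hh a) w
  refine (y.dualBasis.tensorProduct x.dualBasis).ext fun ji =>
    (x.tensorProduct y).ext fun pq => ?_
  obtain ⟨j, i⟩ := ji
  obtain ⟨p, q⟩ := pq
  simp only [Module.Basis.tensorProduct_apply, LinearMap.comp_apply, LinearEquiv.coe_coe,
    Module.Basis.coe_dualBasis, LinearMap.lcomp_apply, op_apply, tens_tmul, hX, hY,
    Coaction.coact_basis x δX, Coaction.coact_basis y δY, TensorProduct.sum_tmul,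
    TensorProduct.tmul_sum, map_sum, TensorProduct.tensorTensorTensorComm_tmul,
    LinearMap.rTensor_tmul, TensorProduct.lid_tmul, map_smul, LinearMap.smul_apply,
    LinearMap.sum_apply, tensorDual_tmul, Module.Basis.coord_apply, Module.Basis.repr_self,
    TensorProduct.map_tmul, TensorProduct.comm_tmul, Finsupp.single_apply, smul_eq_mul]
  simp

end TensorDual

section FourFold
variable {H : Type*} [NonAssocRing H] [Module k H]
  [IsScalarTower k H H] [SMulCommClass k H H] [Coalgebra k H] [DualQuasiHopfAlgebra k H]

/-- The reassociation of vector spaces, without any reassociator. -/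
noncomputable def reassoc (k A₁ A₂ X Y : Type*) [Field k] [AddCommGroup A₁] [Module k A₁]
    [AddCommGroup A₂] [Module k A₂] [AddCommGroup X] [Module k X] [AddCommGroup Y] [Module k Y] :
    ((A₁ ⊗[k] (A₂ ⊗[k] X)) ⊗[k] Y) ≃ₗ[k] ((A₁ ⊗[k] A₂) ⊗[k] (X ⊗[k] Y)) :=
  TensorProduct.congr (TensorProduct.assoc k A₁ A₂ X).symm (LinearEquiv.refl k Y) ≪≫ₗ
    TensorProduct.assoc k (A₁ ⊗[k] A₂) X Y

@[simp] theorem reassoc_tmul (a : A₁) (b : A₂) (x : X) (y : Y) :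
    reassoc k A₁ A₂ X Y ((a ⊗ₜ[k] (b ⊗ₜ[k] x)) ⊗ₜ[k] y) = (a ⊗ₜ[k] b) ⊗ₜ[k] (x ⊗ₜ[k] y) := rfl

@[simp] theorem reassoc_symm_tmul (a : A₁) (b : A₂) (x : X) (y : Y) :
    (reassoc k A₁ A₂ X Y).symm ((a ⊗ₜ[k] b) ⊗ₜ[k] (x ⊗ₜ[k] y)) =
      (a ⊗ₜ[k] (b ⊗ₜ[k] x)) ⊗ₜ[k] y := rfl

theorem isSemicolinear_reassoc (δ₁ : A₁ →ₗ[k] D ⊗[k] A₁) (δ₂ : A₂ →ₗ[k] E ⊗[k] A₂)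
    (δX : X →ₗ[k] F ⊗[k] X) (δY : Y →ₗ[k] G ⊗[k] Y) :
    IsSemicolinear (tens (tens δ₁ (tens δ₂ δX)) δY) (tens (tens δ₁ δ₂) (tens δX δY))
      (reassoc k D E F G).toLinearMap (reassoc k A₁ A₂ X Y).toLinearMap := by
  have h2 : IsSemicolinear (tens (tens (tens δ₁ δ₂) δX) δY) (tens (tens δ₁ δ₂) (tens δX δY))
      (TensorProduct.assoc k (D ⊗[k] E) F G).toLinearMap
      (TensorProduct.assoc k (A₁ ⊗[k] A₂) X Y).toLinearMap :=
    (isSemicolinear_assoc_symm (tens δ₁ δ₂) δX δY).symm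
  exact h2.comp ((isSemicolinear_assoc_symm δ₁ δ₂ δX).tens (IsSemicolinear.id δY))

variable (k H) in
/-- The four-variable form `ν` as a functional. -/
noncomputable def nuFun : (H ⊗[k] H) ⊗[k] (H ⊗[k] H) →ₗ[k] k :=
  dconv (tmulFun (tri (σ (k := k) (H := H))) counit ∘ₗ (reassoc k H H H H).symm.toLinearMap)
    (tri (σinv (k := k) (H := H)) ∘ₗ (mulL k H).rTensor (H ⊗[k] H))

variable (k H) in
/-- The four-variable form `μ` as a functional. -/
noncomputable def muFun : (H ⊗[k] H) ⊗[k] (H ⊗[k] H) →ₗ[k] k :=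
  dconv (tri (σ (k := k) (H := H)) ∘ₗ (mulL k H).rTensor (H ⊗[k] H))
    (tmulFun (tri (σinv (k := k) (H := H))) counit ∘ₗ (reassoc k H H H H).symm.toLinearMap)

theorem dconv_four (φ ψ : (H ⊗[k] H) ⊗[k] (H ⊗[k] H) →ₗ[k] k) (a b c d : H) :
    dconv φ ψ ((a ⊗ₜ[k] b) ⊗ₜ[k] (c ⊗ₜ[k] d)) =
    cop2 k a fun a₁ a₂ => cop2 k b fun b₁ b₂ => cop2 k c fun c₁ c₂ =>
      dconv (TensorProduct.curry (TensorProduct.curry φ (a₁ ⊗ₜ[k] b₁)) c₁)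
        (TensorProduct.curry (TensorProduct.curry ψ (a₂ ⊗ₜ[k] b₂)) c₂) d := by
  rw [dconv_tmul]
  refine (cop2_eq (a ⊗ₜ[k] b) (LinearMap.applyₗ (c ⊗ₜ[k] d) ∘ₗ TensorProduct.lift
    (dconvL.compl₁₂ (TensorProduct.curry φ) (TensorProduct.curry ψ))) _
    fun _ _ => rfl).trans ?_
  refine (comul_tmul_apply a b _).trans ?_
  refine congrArg (cop2 k a) (funext fun a₁ => funext fun a₂ => ?_)
  refine congrArg (cop2 k b) (funext fun b₁ => funext fun b₂ => ?_)
  exact dconv_tmul (TensorProduct.curry φ (a₁ ⊗ₜ[k] b₁)) (TensorProduct.curry ψ (a₂ ⊗ₜ[k] b₂)) c d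

theorem nuFun_tmul (a b c d : H) :
    nuFun k H ((a ⊗ₜ[k] b) ⊗ₜ[k] (c ⊗ₜ[k] d)) = nu k a b c d := by
  rw [nuFun, dconv_four, nu]
  refine congrArg (cop2 k a) (funext fun a₁ => funext fun a₂ => ?_)
  refine congrArg (cop2 k b) (funext fun b₁ => funext fun b₂ => ?_)
  refine congrArg (cop2 k c) (funext fun c₁ => funext fun c₂ => ?_)
  have h : TensorProduct.curry (TensorProduct.curry (tmulFun (tri (σ (k := k) (H := H))) counit ∘ₗ
      (reassoc k H H H H).symm.toLinearMap) (a₁ ⊗ₜ[k] b₁)) c₁ =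
      σ (k := k) a₁ b₁ c₁ • counit (R := k) (A := H) := by ext d; rfl
  rw [h, ← dconvL_apply, map_smul, LinearMap.smul_apply, dconvL_apply, counit_dconv]
  rfl

theorem muFun_tmul (a b c d : H) :
    muFun k H ((a ⊗ₜ[k] b) ⊗ₜ[k] (c ⊗ₜ[k] d)) = mu k a b c d := by
  rw [muFun, dconv_four, mu]
  refine congrArg (cop2 k a) (funext fun a₁ => funext fun a₂ => ?_)
  refine congrArg (cop2 k b) (funext fun b₁ => funext fun b₂ => ?_)
  refine congrArg (cop2 k c) (funext fun c₁ => funext fun c₂ => ?_)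
  have h : TensorProduct.curry (TensorProduct.curry
      (tmulFun (tri (σinv (k := k) (H := H))) counit ∘ₗ (reassoc k H H H H).symm.toLinearMap)
        (a₂ ⊗ₜ[k] b₂)) c₂ =
      σinv (k := k) a₂ b₂ c₂ • counit (R := k) (A := H) := by ext d; rfl
  rw [h, ← dconvL_apply, map_smul, dconvL_apply, dconv_counit]
  exact mul_comm _ _

variable {δ₁ : A₁ →ₗ[k] H ⊗[k] A₁} {δ₂ : A₂ →ₗ[k] H ⊗[k] A₂} {δX : X →ₗ[k] H ⊗[k] X}
  {δY : Y →ₗ[k] H ⊗[k] Y}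

/-- The rebracketing in the coevaluation of a tensor product is the operator attached to `ν`. -/
theorem assocL_assocLinv_four (h₁ : IsCoaction δ₁) (h₂ : IsCoaction δ₂) (hX : IsCoaction δX)
    (hY : IsCoaction δY) (t : (A₁ ⊗[k] (A₂ ⊗[k] X)) ⊗[k] Y) :
    assocL (diag δ₁ δ₂) δX δY ((assocLinv δ₁ δ₂ δX).rTensor Y t) =
      op (tens (tens δ₁ δ₂) (tens δX δY)) (nuFun k H) (reassoc k A₁ A₂ X Y t) := by
  rw [nuFun, ← op_op ((h₁.tens h₂).tens (hX.tens hY)), LinearMap.comp_apply]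
  have h := (isSemicolinear_reassoc δ₁ δ₂ δX δY).op (tmulFun (tri (σ (k := k) (H := H))) counit ∘ₗ
      (reassoc k H H H H).symm.toLinearMap) t
  rw [LinearEquiv.coe_coe] at h
  rw [h, LinearMap.comp_assoc, LinearEquiv.symm_comp, LinearMap.comp_id, op_tmulFun, op_counit hY,
    assocL, diag, tens_push_left, op_push]
  have e : (assocLinv δ₁ δ₂ δX).rTensor Y t =
      (TensorProduct.assoc k A₁ A₂ X).symm.toLinearMap.rTensor Y
      ((op (tens δ₁ (tens δ₂ δX)) (tri (σ (k := k) (H := H)))).rTensor Y t) := by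
    rw [Coaction.assocLinv, LinearMap.rTensor_comp_apply]
  rw [e]
  rfl

/-- The rebracketing in the evaluation of a tensor product is the operator attached to `μ`. -/
theorem assocL_assocLinv_four' (h₁ : IsCoaction δ₁) (h₂ : IsCoaction δ₂) (hX : IsCoaction δX)
    (hY : IsCoaction δY) (t : (A₁ ⊗[k] A₂) ⊗[k] (X ⊗[k] Y)) :
    (assocL δ₁ δ₂ δX).rTensor Y (assocLinv (diag δ₁ δ₂) δX δY t) =
      (reassoc k A₁ A₂ X Y).symm (op (tens (tens δ₁ δ₂) (tens δX δY)) (muFun k H) t) := by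
  rw [muFun, ← op_op ((h₁.tens h₂).tens (hX.tens hY)), LinearMap.comp_apply]
  set u := op (tens (tens δ₁ δ₂) (tens δX δY)) (tri (σ (k := k) (H := H)) ∘ₗ
    (mulL k H).rTensor (H ⊗[k] H)) t with hu
  have h := (isSemicolinear_reassoc δ₁ δ₂ δX δY).symm.op
    (tmulFun (tri (σinv (k := k) (H := H))) counit) u
  rw [LinearEquiv.coe_coe] at h
  have e : assocLinv (diag δ₁ δ₂) δX δY t = (TensorProduct.assoc k _ X Y).symm u := by
    rw [hu, Coaction.assocLinv, diag, tens_push_left, op_push]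
    rfl
  rw [← h, op_tmulFun, op_counit hY, e, assocL, LinearMap.rTensor_comp_apply]
  rfl

end FourFold

end Coaction

/-! ### The twists as functionals -/

namespace DualQuasiHopfAlgebra
variable {k : Type*} {H : Type*} [Field k] [NonAssocRing H] [Module k H]
  [IsScalarTower k H H] [SMulCommClass k H H] [Coalgebra k H] [DualQuasiHopfAlgebra k H]

variable (k H) in
theorem isAntiCoalg_s : IsAntiCoalg (antipode (k := k) (H := H)) where
  counit_comp := LinearMap.ext counit_s
  dconv_comp φ ψ := by
    ext h
    rw [LinearMap.comp_apply, dconv, LinearMap.comp_apply, comul_s, dconv_apply]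
    simp [cop2, sweedler, mul_comm]

theorem isAntiCoalg_sInv (hs : Function.Bijective (antipode (k := k) (H := H))) :
    IsAntiCoalg (sInv k hs) := by
  have h1 : ∀ x, sInv k hs (antipode (k := k) x) = x :=
    (LinearEquiv.ofBijective (antipode (k := k) (H := H)) hs).symm_apply_apply
  have h2 : ∀ x, antipode (k := k) (sInv k hs x) = x :=
    (LinearEquiv.ofBijective (antipode (k := k) (H := H)) hs).apply_symm_apply
  have h3 : ∀ φ : H →ₗ[k] k, (φ ∘ₗ sInv k hs) ∘ₗ antipode = φ := fun φ => by
    ext x; simp [h1]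
  constructor
  · ext x
    rw [LinearMap.comp_apply, ← counit_s, h2]
  · intro φ ψ
    have := (isAntiCoalg_s k H).dconv_comp (ψ ∘ₗ sInv k hs) (φ ∘ₗ sInv k hs)
    rw [h3, h3] at this
    rw [← this]
    ext x
    simp [h2]

variable (k H) in
/-- The form `λ` as a functional on `H ⊗ H`. -/
noncomputable def lamFun : H ⊗[k] H →ₗ[k] k :=
  nuFun k H ∘ₗ TensorProduct.map ((TensorProduct.comm k H H).toLinearMap ∘ₗ
    TensorProduct.map antipode antipode)
    ((TensorProduct.lid k (H ⊗[k] H)).toLinearMap ∘ₗ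
      TensorProduct.map (tmulFun (α (k := k) (H := H)) α) LinearMap.id) ∘ₗ comul3 k (H ⊗[k] H)

variable (k H) in
/-- The form `χ` as a functional on `H ⊗ H`. -/
noncomputable def chiFun : H ⊗[k] H →ₗ[k] k :=
  muFun k H ∘ₗ TensorProduct.map LinearMap.id
    ((TensorProduct.lid k (H ⊗[k] H)).toLinearMap ∘ₗ
      TensorProduct.map (tmulFun (β (k := k) (H := H)) β)
      ((TensorProduct.comm k H H).toLinearMap ∘ₗ
    TensorProduct.map antipode antipode)) ∘ₗ comul3 k (H ⊗[k] H)

theorem lamFun_tmul (a b : H) : lamFun k H (a ⊗ₜ[k] b) = lam k a b := by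
  rw [lamFun, ← LinearMap.comp_assoc, LinearMap.comp_apply, apply_comul3_tmul, lam]
  refine congrArg (cop3 k a) (funext fun a₁ => funext fun a₂ => funext fun a₃ => ?_)
  refine congrArg (cop3 k b) (funext fun b₁ => funext fun b₂ => funext fun b₃ => ?_)
  simp [nuFun_tmul]
  ring

theorem chiFun_tmul (a b : H) : chiFun k H (a ⊗ₜ[k] b) = chi k a b := by
  rw [chiFun, ← LinearMap.comp_assoc, LinearMap.comp_apply, apply_comul3_tmul, chi]
  refine congrArg (cop3 k a) (funext fun a₁ => funext fun a₂ => funext fun a₃ => ?_)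
  refine congrArg (cop3 k b) (funext fun b₁ => funext fun b₂ => funext fun b₃ => ?_)
  simp [muFun_tmul]
  ring

variable (k H) in
/-- The map `a ⊗ b ↦ s(b) s(a)`. -/
noncomputable def smulS : H ⊗[k] H →ₗ[k] H := mulL k H ∘ₗ (TensorProduct.comm k H H).toLinearMap ∘ₗ
    TensorProduct.map antipode antipode

variable (k H) in
/-- The form `f` as a functional on `H ⊗ H`. -/
noncomputable def twistFFun : H ⊗[k] H →ₗ[k] k :=
  tri (σinv (k := k) (H := H)) ∘ₗ TensorProduct.map (smulS k H)
    ((TensorProduct.lid k _).toLinearMap ∘ₗ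
      TensorProduct.map (lamFun k H) (TensorProduct.map (mulL k H)
        ((TensorProduct.lid k _).toLinearMap ∘ₗ
        TensorProduct.map (β ∘ₗ mulL k H) (antipode (k := k) ∘ₗ mulL k H)))) ∘ₗ comul5 k (H ⊗[k] H)

variable (k H) in
/-- The form `g` as a functional on `H ⊗ H`. -/
noncomputable def twistGFun : H ⊗[k] H →ₗ[k] k :=
  tri (σinv (k := k) (H := H)) ∘ₗ TensorProduct.map (antipode (k := k) ∘ₗ mulL k H)
    ((TensorProduct.lid k _).toLinearMap ∘ₗ
      TensorProduct.map (α ∘ₗ mulL k H) (TensorProduct.map (mulL k H)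
        ((TensorProduct.lid k _).toLinearMap ∘ₗ
        TensorProduct.map (chiFun k H) (smulS k H)))) ∘ₗ comul5 k (H ⊗[k] H)

theorem twistFFun_tmul (a b : H) : twistFFun k H (a ⊗ₜ[k] b) = twistF k a b := by
  rw [twistFFun, ← LinearMap.comp_assoc, LinearMap.comp_apply, apply_comul5_tmul, twistF]
  refine congrArg (cop5 k a) (funext fun a₁ => funext fun a₂ => funext fun a₃ => funext fun a₄ =>
    funext fun a₅ => ?_)
  refine congrArg (cop5 k b) (funext fun b₁ => funext fun b₂ => funext fun b₃ => funext fun b₄ =>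
    funext fun b₅ => ?_)
  simp [lamFun_tmul, smulS]
  ring

theorem twistGFun_tmul (a b : H) : twistGFun k H (a ⊗ₜ[k] b) = twistG k a b := by
  rw [twistGFun, ← LinearMap.comp_assoc, LinearMap.comp_apply, apply_comul5_tmul, twistG]
  refine congrArg (cop5 k a) (funext fun a₁ => funext fun a₂ => funext fun a₃ => funext fun a₄ =>
    funext fun a₅ => ?_)
  refine congrArg (cop5 k b) (funext fun b₁ => funext fun b₂ => funext fun b₃ => funext fun b₄ =>
    funext fun b₅ => ?_)
  simp [chiFun_tmul, smulS]
  ring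

end DualQuasiHopfAlgebra

/-! ### Duals of tensor products -/

namespace CategoryTheory.ExactPairing
universe v₁ u₁
variable {C : Type u₁} [Category.{v₁} C] [MonoidalCategory C]

/-- The comparison between two left duals `A` and `B` of `W`. -/
def mate (A B W : C) [ExactPairing A W] [ExactPairing B W] : B ⟶ A :=
  (λ_ B).inv ≫ η_ A W ▷ B ≫ (α_ A W B).hom ≫ A ◁ ε_ B W ≫ (ρ_ A).hom

theorem whiskerLeft_mate_evaluation (A B W : C) [ExactPairing A W] [ExactPairing B W] :
    W ◁ mate A B W ≫ ε_ A W = ε_ B W := by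
  calc
    _ = 𝟙 _ ⊗≫ W ◁ η_ A W ▷ B ⊗≫ ((W ⊗ A) ◁ ε_ B W ≫ ε_ A W ▷ (𝟙_ C)) ⊗≫ 𝟙 _ := by
      rw [mate]; monoidal
    _ = 𝟙 _ ⊗≫ (W ◁ η_ A W ⊗≫ ε_ A W ▷ W) ▷ B ⊗≫ ε_ B W := by
      rw [whisker_exchange]; monoidal
    _ = _ := by rw [coevaluation_evaluation'']; monoidal

theorem hom_ext_evaluation {A W Z : C} [ExactPairing A W] {f g : Z ⟶ A}
    (h : W ◁ f ≫ ε_ A W = W ◁ g ≫ ε_ A W) : f = g := by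
  have key : ∀ f : Z ⟶ A, f = 𝟙 _ ⊗≫ η_ A W ▷ Z ⊗≫ A ◁ (W ◁ f ≫ ε_ A W) ⊗≫ 𝟙 _ := by
    intro f
    symm
    calc
      _ = 𝟙 _ ⊗≫ (η_ A W ▷ Z ≫ (A ⊗ W) ◁ f) ⊗≫ A ◁ ε_ A W ⊗≫ 𝟙 _ := by monoidal
      _ = 𝟙 _ ⊗≫ f ⊗≫ (η_ A W ▷ A ⊗≫ A ◁ ε_ A W) ⊗≫ 𝟙 _ := by
        rw [← whisker_exchange]; monoidal
      _ = f := by rw [evaluation_coevaluation'']; monoidal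
  rw [key f, h, ← key g]

theorem mate_comp_mate (A B W : C) [ExactPairing A W] [ExactPairing B W] :
    mate A B W ≫ mate B A W = 𝟙 B := by
  refine hom_ext_evaluation (W := W) ?_
  rw [MonoidalCategory.whiskerLeft_comp, Category.assoc, whiskerLeft_mate_evaluation,
    whiskerLeft_mate_evaluation, MonoidalCategory.whiskerLeft_id, Category.id_comp]

theorem tensor_coevaluation_eq {A₁ A₂ X Y : C} [ExactPairing A₁ Y] [ExactPairing A₂ X] :
    η_ (A₁ ⊗ A₂) (X ⊗ Y) = η_ A₁ Y ≫ (ρ_ A₁).inv ▷ Y ≫ (A₁ ◁ η_ A₂ X) ▷ Y ≫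
      (α_ A₁ A₂ X).inv ▷ Y ≫ (α_ (A₁ ⊗ A₂) X Y).hom := by
  rw [tensor_coevaluation]; monoidal

theorem tensor_evaluation_eq {A₁ A₂ X Y : C} [ExactPairing A₁ Y] [ExactPairing A₂ X] :
    ε_ (A₁ ⊗ A₂) (X ⊗ Y) = (α_ (X ⊗ Y) A₁ A₂).inv ≫ (α_ X Y A₁).hom ▷ A₂ ≫ (X ◁ ε_ A₁ Y) ▷ A₂ ≫
      (ρ_ X).hom ▷ A₂ ≫ ε_ A₂ X := by
  rw [tensor_evaluation]; monoidal

end CategoryTheory.ExactPairing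

namespace Coaction
section QuasiDual
variable {k : Type*} {H : Type*} [Field k] [NonAssocRing H] [Module k H]
  [IsScalarTower k H H] [SMulCommClass k H H] [Coalgebra k H] [DualQuasiHopfAlgebra k H]
variable {W A X Y A₁ A₂ : Type*} [AddCommGroup W] [Module k W] [AddCommGroup A] [Module k A]
  [AddCommGroup X] [Module k X] [AddCommGroup Y] [Module k Y]
  [AddCommGroup A₁] [Module k A₁] [AddCommGroup A₂] [Module k A₂]
  [FiniteDimensional k W] [FiniteDimensional k X] [FiniteDimensional k Y]
  {κ : A ≃ₗ[k] Module.Dual k W} {δ : W →ₗ[k] H ⊗[k] W} {δA : A →ₗ[k] H ⊗[k] A}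

/-- The coevaluation `k → A ⊗ W` attached to `t`. -/
noncomputable def coevMap (κ : A ≃ₗ[k] Module.Dual k W) (t : W →ₗ[k] W) : k →ₗ[k] A ⊗[k] W :=
  LinearMap.toSpanSingleton k _ (coevT κ t)

@[simp] theorem coevMap_apply (κ : A ≃ₗ[k] Module.Dual k W) (t : W →ₗ[k] W) (c : k) :
    coevMap κ t c = c • coevT κ t := rfl

theorem op_unit (φ : H →ₗ[k] k) (c : k) : op (TensorProduct.mk k H k 1) φ c = φ 1 * c := by
  simp [op_apply]

/-- The coevaluation is colinear by the antipode axiom for `α`. -/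
theorem coevMap_colinear (h : IsAdjoint κ δ δA antipode) (hδ : IsCoaction δ) (c : k) :
    diag δA δ (coevMap κ (op δ (α (k := k) (H := H))) c) =
      (coevMap κ (op δ α)).lTensor H (TensorProduct.mk k H k 1 c) := by
  revert c
  refine (colinear_iff _).2 fun φ => LinearMap.ext_ring ?_
  have h2 : ((φ ∘ₗ mulL k H) ∘ₗ TensorProduct.map antipode ((TensorProduct.lid k H).toLinearMap ∘ₗ
    TensorProduct.map (α (k := k) (H := H)) LinearMap.id) ∘ₗ comul3 k H) = φ 1 • α := by
    ext h
    rw [← LinearMap.comp_assoc, LinearMap.comp_apply,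
      ← cop3_eq h _ (fun a b c => φ (α (k := k) b • (antipode (k := k) a * c)))
        (fun a b c => by simp)]
    have := congrArg φ (s_α (k := k) h)
    simp only [cop3, cop2, sweedler, map_sum] at this ⊢
    rw [this]
    simp [mul_comm]
  have h1 := op_coevT h hδ LinearMap.id (α (k := k) (H := H)) (φ ∘ₗ mulL k H)
  rw [h2, push_id] at h1
  rw [LinearMap.comp_apply, LinearMap.comp_apply, op_unit, diag, op_push, coevMap_apply,
    coevMap_apply, one_smul, h1, map_smul, map_smul, mul_one]

/-- The evaluation is colinear by the antipode axiom for `β`. -/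
theorem evT_colinear (h : IsAdjoint κ δ δA antipode) (hδ : IsCoaction δ) (t : W ⊗[k] A) :
    TensorProduct.mk k H k 1 (evT κ (op δ (β (k := k) (H := H))) t) =
      (evT κ (op δ β)).lTensor H (diag δ δA t) := by
  revert t
  refine (colinear_iff _).2 fun φ => ?_
  have h2 : ((φ ∘ₗ mulL k H) ∘ₗ TensorProduct.map LinearMap.id
    ((TensorProduct.lid k H).toLinearMap ∘ₗ TensorProduct.map (β (k := k) (H := H)) antipode) ∘ₗ
      comul3 k H) = φ 1 • β := by
    ext h
    rw [← LinearMap.comp_assoc, LinearMap.comp_apply,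
      ← cop3_eq h _ (fun a b c => φ (β (k := k) b • (a * antipode (k := k) c)))
        (fun a b c => by simp)]
    have := congrArg φ (β_s (k := k) h)
    simp only [cop3, cop2, sweedler, map_sum] at this ⊢
    rw [this]
    simp [mul_comm]
  have h1 := op_evT h hδ LinearMap.id (β (k := k) (H := H)) (φ ∘ₗ mulL k H)
  rw [h2, push_id] at h1
  rw [diag, op_push, h1]
  refine TensorProduct.ext' fun w a => ?_
  rw [LinearMap.comp_apply, op_unit]
  simp

theorem coev_ev_triangle (h : IsAdjoint κ δ δA antipode) (hδ : IsCoaction δ) (c : k) (x : A) :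
    (evT κ (op δ (β (k := k) (H := H)))).lTensor A (assocL δA δ δA
      (coevMap κ (op δ α) c ⊗ₜ[k] x)) = (TensorProduct.rid k A).symm (c • x) := by
  rw [LinearEquiv.eq_symm_apply]
  refine κ.injective (LinearMap.ext fun w => ?_)
  have h1 := transpose_zigzag h h hδ LinearMap.id (α (k := k) (H := H)) β σinv x w
  have h2 : (tri (σinv (k := k) (H := H)) ∘ₗ TensorProduct.map antipode
      ((TensorProduct.lid k _).toLinearMap ∘ₗ
        TensorProduct.map α (TensorProduct.map LinearMap.id ((TensorProduct.lid k _).toLinearMap ∘ₗ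
        TensorProduct.map β antipode))) ∘ₗ comul5 k H) = counit := by
    ext h
    rw [← LinearMap.comp_assoc, LinearMap.comp_apply, ← σinv_antipode h]
    refine (cop5_eq h _ _ fun a b c x y => ?_).symm
    simp
    ring
  rw [h2, op_counit hδ, push_id] at h1
  rw [coevMap_apply, ← TensorProduct.smul_tmul', map_smul, map_smul, map_smul, map_smul, map_smul]
  exact congrArg (c • ·) h1

theorem ev_coev_triangle (h : IsAdjoint κ δ δA antipode) (hδ : IsCoaction δ) (c : k) (w : W) :
    (evT κ (op δ (β (k := k) (H := H)))).rTensor W (assocLinv δ δA δ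
      (w ⊗ₜ[k] coevMap κ (op δ α) c)) = (TensorProduct.lid k W).symm (c • w) := by
  rw [LinearEquiv.eq_symm_apply]
  have h1 := zigzag h hδ LinearMap.id LinearMap.id (α (k := k) (H := H)) β σ w
  have h2 : (tri (σ (k := k) (H := H)) ∘ₗ TensorProduct.map LinearMap.id
      ((TensorProduct.lid k _).toLinearMap ∘ₗ
        TensorProduct.map β (TensorProduct.map antipode ((TensorProduct.lid k _).toLinearMap ∘ₗ
        TensorProduct.map α LinearMap.id))) ∘ₗ comul5 k H) = counit := by
    ext h
    rw [← LinearMap.comp_assoc, LinearMap.comp_apply, ← σ_antipode h]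
    refine (cop5_eq h _ _ fun a b c x y => ?_).symm
    simp
    ring
  rw [h2, op_counit hδ, push_id] at h1
  rw [coevMap_apply, TensorProduct.tmul_smul, map_smul, map_smul, map_smul]
  exact congrArg (c • ·) h1

variable {δX : X →ₗ[k] H ⊗[k] X} {δY : Y →ₗ[k] H ⊗[k] Y}

/-- The coevaluation of `Y* ⊗ X*` and `X ⊗ Y` is the one twisted by `λ`. -/
theorem tensor_coev_lin (hX : IsCoaction δX) (hY : IsCoaction δY)
    (h₂ : IsCoaction (dualCoact (antipode (k := k)) δX))
    (h₁ : IsCoaction (dualCoact (antipode (k := k)) δY)) (c : k) :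
    assocL (diag (dualCoact antipode δY) (dualCoact antipode δX)) δX δY
      ((assocLinv (dualCoact antipode δY) (dualCoact antipode δX) δX).rTensor Y
      (((coevMap (LinearEquiv.refl k _) (op δX (α (k := k) (H := H)))).lTensor _).rTensor Y
      ((TensorProduct.rid k _).symm.toLinearMap.rTensor Y
        (coevMap (LinearEquiv.refl k _) (op δY (α (k := k) (H := H))) c)))) =
    coevMap (A := Module.Dual k Y ⊗[k] Module.Dual k X) (tensorDual k X Y)
      (op (tens δX δY) (lamFun k H)) c := by
  rw [assocL_assocLinv_four h₁ h₂ hX hY]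
  have h1 := op_coevT (tensorDual_isAdjoint δX δY (antipode (k := k) (H := H))) (hX.tens hY)
    LinearMap.id (tmulFun (α (k := k) (H := H)) α) (nuFun k H)
  rw [push_id] at h1
  rw [coevMap_apply, coevMap_apply, lamFun, ← h1, map_smul, map_smul, map_smul, map_smul]
  congr 3
  let x := Module.finBasis k X
  let y := Module.finBasis k Y
  rw [coevT_basis y, coevT_basis (x.tensorProduct y), op_tmulFun, Fintype.sum_prod_type]
  simp only [map_sum, LinearMap.rTensor_tmul, LinearMap.lTensor_tmul, LinearEquiv.coe_coe,
    TensorProduct.rid_symm_apply, coevMap_apply, one_smul, coevT_basis x, TensorProduct.sum_tmul,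
    TensorProduct.tmul_sum, LinearEquiv.refl_symm, LinearEquiv.refl_apply, reassoc_tmul,
    Module.Basis.tensorProduct_apply, TensorProduct.map_tmul]
  rw [Finset.sum_comm]
  refine Finset.sum_congr rfl fun i _ => Finset.sum_congr rfl fun j _ => ?_
  congr 1
  rw [LinearEquiv.eq_symm_apply]
  refine (x.tensorProduct y).ext fun pq => ?_
  rw [Module.Basis.coord_apply, Module.Basis.repr_self, Module.Basis.tensorProduct_apply',
    tensorDual_tmul]
  classical
  simp only [Module.Basis.coord_apply, Module.Basis.repr_self, Finsupp.single_apply, Prod.ext_iff,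
    ite_and]
  split_ifs <;> simp

/-- The evaluation of `Y* ⊗ X*` and `X ⊗ Y` is the one twisted by `χ`. -/
theorem tensor_ev_lin (hX : IsCoaction δX) (hY : IsCoaction δY)
    (h₂ : IsCoaction (dualCoact (antipode (k := k)) δX))
    (h₁ : IsCoaction (dualCoact (antipode (k := k)) δY))
    (t : (X ⊗[k] Y) ⊗[k] (Module.Dual k Y ⊗[k] Module.Dual k X)) :
    evT (LinearEquiv.refl k _) (op δX (β (k := k) (H := H)))
      ((TensorProduct.rid k X).toLinearMap.rTensor _
      (((evT (LinearEquiv.refl k _) (op δY (β (k := k) (H := H)))).lTensor X).rTensor _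
      ((assocL δX δY (dualCoact antipode δY)).rTensor _
      (assocLinv (diag δX δY) (dualCoact antipode δY) (dualCoact antipode δX) t)))) =
    evT (B := Module.Dual k Y ⊗[k] Module.Dual k X) (tensorDual k X Y)
      (op (tens δX δY) (chiFun k H)) t := by
  rw [assocL_assocLinv_four' hX hY h₁ h₂]
  have h1 := op_evT (tensorDual_isAdjoint δX δY (antipode (k := k) (H := H))) (hX.tens hY)
    LinearMap.id (tmulFun (β (k := k) (H := H)) β) (muFun k H)
  rw [push_id] at h1
  rw [chiFun, ← h1, LinearMap.comp_apply]
  generalize op (tens (tens δX δY) (tens (dualCoact antipode δY) (dualCoact antipode δX)))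
    (muFun k H) t = u
  rw [op_tmulFun]
  suffices hh : evT (LinearEquiv.refl k _) (op δX (β (k := k) (H := H))) ∘ₗ
      (TensorProduct.rid k X).toLinearMap.rTensor _ ∘ₗ
      ((evT (LinearEquiv.refl k _) (op δY (β (k := k) (H := H)))).lTensor X).rTensor _ ∘ₗ
      (reassoc k X Y (Module.Dual k Y) (Module.Dual k X)).symm.toLinearMap =
      evT (B := Module.Dual k Y ⊗[k] Module.Dual k X) (tensorDual k X Y)
        (TensorProduct.map (op δX β) (op δY β)) from LinearMap.congr_fun hh u
  refine TensorProduct.ext_fourfold' fun x y φ ξ => ?_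
  simp [mul_comm]

end QuasiDual
end Coaction

/-! ### Duals of comodules -/

namespace FdComod

variable {k : Type u} {H : Type v} [Field k] [NonAssocRing H] [Module k H]
  [IsScalarTower k H H] [SMulCommClass k H H] [Coalgebra k H] [DualQuasiHopfAlgebra k H]

/-- The dual space with the coaction through the antipode. Its evaluation is `U ⊗ dual U ⟶ 𝟙_`, so
`dual U` is the left dual in the convention of `ExactPairing`. -/
noncomputable def dual (U : FdComod k H) : FdComod k H where
  carrier := Module.Dual k U
  coact := dualCoact antipode U.coact
  isCoaction := U.isCoaction.dual (isAntiCoalg_s k H)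

/-- The dual space with the coaction through the inverse of the antipode. -/
noncomputable def codual (hs : Function.Bijective (antipode (k := k) (H := H))) (U : FdComod k H) :
    FdComod k H where
  carrier := Module.Dual k U
  coact := dualCoact (sInv k hs) U.coact
  isCoaction := U.isCoaction.dual (isAntiCoalg_sInv hs)

variable (U V X Y : FdComod k H)

theorem dual_isAdjoint : IsAdjoint (LinearEquiv.refl k _) U.coact (dual U).coact antipode :=
  dualCoact_isAdjoint _ _

/-- The coevaluation `1 ↦ ∑ᵢ uⁱ ⊗ α(uᵢ₍₋₁₎) uᵢ₍₀₎`. -/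
noncomputable def dualCoev : 𝟙_ (FdComod k H) ⟶ dual U ⊗ U :=
  let f : k →ₗ[k] Module.Dual k U ⊗[k] U := coevMap (LinearEquiv.refl k _) (op U.coact α)
  have hf := coevMap_colinear (dual_isAdjoint U) U.isCoaction
  Hom.mk (M := 𝟙_ (FdComod k H)) (N := dual U ⊗ U) f hf

/-- The evaluation `u ⊗ φ ↦ β(u₍₋₁₎) φ(u₍₀₎)`. -/
noncomputable def dualEv : U ⊗ dual U ⟶ 𝟙_ (FdComod k H) :=
  let f : U ⊗[k] Module.Dual k U →ₗ[k] k := evT (LinearEquiv.refl k _) (op U.coact β)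
  have hf := evT_colinear (dual_isAdjoint U) U.isCoaction
  Hom.mk (M := U ⊗ dual U) (N := 𝟙_ (FdComod k H)) f hf

/-- The triangle identities are the two axioms relating the reassociator and the antipode. -/
noncomputable instance dualPairing : ExactPairing (dual U) U where
  coevaluation' := dualCoev U
  evaluation' := dualEv U
  evaluation_coevaluation' := hom_ext <| TensorProduct.ext' fun c φ =>
    coev_ev_triangle (dual_isAdjoint U) U.isCoaction c φ
  coevaluation_evaluation' := hom_ext <| TensorProduct.ext' fun w c =>
    ev_coev_triangle (dual_isAdjoint U) U.isCoaction c w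

theorem tensorPairing_coevaluation_lin (c : k) :
    Hom.lin (η_ (dual Y ⊗ dual X) (X ⊗ Y)) c =
      coevMap (A := Module.Dual k Y ⊗[k] Module.Dual k X) (tensorDual k X Y)
        (op (tens X.coact Y.coact) (lamFun k H)) c := by
  rw [tensor_coevaluation_eq]
  exact tensor_coev_lin X.isCoaction Y.isCoaction (dual X).isCoaction (dual Y).isCoaction c

theorem tensorPairing_evaluation_lin (t : (X ⊗[k] Y) ⊗[k] (Module.Dual k Y ⊗[k] Module.Dual k X)) :
    Hom.lin (ε_ (dual Y ⊗ dual X) (X ⊗ Y)) t =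
      evT (B := Module.Dual k Y ⊗[k] Module.Dual k X) (tensorDual k X Y)
        (op (tens X.coact Y.coact) (chiFun k H)) t := by
  rw [tensor_evaluation_eq]
  exact tensor_ev_lin X.isCoaction Y.isCoaction (dual X).isCoaction (dual Y).isCoaction t

/-- The comparison of two duals as a linear map: a zigzag of the coevaluation of one and the
evaluation of the other. -/
theorem mate_lin (A B W : FdComod k H) [ExactPairing A W] [ExactPairing B W] (c : A ⊗[k] W)
    (hc : Hom.lin (η_ A W) (1 : k) = c) (e : W ⊗[k] B →ₗ[k] k)
    (he : ∀ t, Hom.lin (ε_ B W) t = e t) (x : B) :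
    Hom.lin (mate A B W) x = TensorProduct.rid k A (e.lTensor A
      (assocL A.coact W.coact B.coact (c ⊗ₜ[k] x))) := by
  have h : e = Hom.lin (ε_ B W) := LinearMap.ext fun t => (he t).symm
  subst hc
  subst h
  rfl

/-- The comparison between two duals of `X ⊗ Y`; by `dualTwistF_lin` it is given by `f`. -/
noncomputable def dualTwistF : dual (X ⊗ Y) ⟶ dual Y ⊗ dual X :=
  mate (dual Y ⊗ dual X) (dual (X ⊗ Y)) (X ⊗ Y)

/-- The comparison inverse to `dualTwistF`; by `dualTwistG_lin` it is given by `g`. -/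
noncomputable def dualTwistG : dual Y ⊗ dual X ⟶ dual (X ⊗ Y) :=
  mate (dual (X ⊗ Y)) (dual Y ⊗ dual X) (X ⊗ Y)

/-- The comparison `(X ⊗ Y)* → Y* ⊗ X*` is the transpose of the operator attached to `f`: the zigzag
of the coevaluation of `Y* ⊗ X*`, which contains `λ`, with the evaluation of `(X ⊗ Y)*`. -/
theorem dualTwistF_lin (φ : Module.Dual k (X ⊗[k] Y)) (t : X ⊗[k] Y) :
    tensorDual k X Y (Hom.lin (dualTwistF X Y) φ) t =
      φ (op (tens X.coact Y.coact) (twistFFun k H) t) := by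
  have h := tensorDual_isAdjoint X.coact Y.coact (antipode (k := k) (H := H))
  have h' := dualCoact_isAdjoint (antipode (k := k) (H := H)) (diag X.coact Y.coact)
  have key := transpose_zigzag (h.push_target (mulL k H)) h'.of_push
    (X.isCoaction.tens Y.isCoaction) (mulL k H) (lamFun k H) (β ∘ₗ mulL k H)
    σinv φ t
  rw [← op_push] at key
  exact (congrArg (fun z => tensorDual k X Y z t) (mate_lin (dual Y ⊗ dual X) (dual (X ⊗ Y)) (X ⊗ Y)
    _ ((tensorPairing_coevaluation_lin X Y 1).trans (one_smul k _)) _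
    (fun _ => rfl) φ)).trans key

/-- The comparison `Y* ⊗ X* → (X ⊗ Y)*` is the transpose of the operator attached to `g`. -/
theorem dualTwistG_lin (a : Module.Dual k Y ⊗[k] Module.Dual k X) (t : X ⊗[k] Y) :
    (show Module.Dual k (X ⊗[k] Y) from Hom.lin (dualTwistG X Y) a) t =
      tensorDual k X Y a (op (tens X.coact Y.coact) (twistGFun k H) t) := by
  have h := tensorDual_isAdjoint X.coact Y.coact (antipode (k := k) (H := H))
  have h' := dualCoact_isAdjoint (antipode (k := k) (H := H)) (diag X.coact Y.coact)
  have key := transpose_zigzag h'.of_push (h.push_target (mulL k H))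
    (X.isCoaction.tens Y.isCoaction) (mulL k H) (α ∘ₗ mulL k H) (chiFun k H)
    σinv a t
  rw [← op_push] at key
  exact (congrArg (fun z : Module.Dual k (X ⊗[k] Y) => z t) (mate_lin (dual (X ⊗ Y))
    (dual Y ⊗ dual X) (X ⊗ Y) _ (one_smul k _) _
    (tensorPairing_evaluation_lin X Y) a)).trans key

end FdComod

/-! ### Actions as half-braidings -/

namespace Coaction
section General
variable {k : Type*} [Field k]
variable {D E U V W M N U' : Type*}
  [AddCommGroup D] [Module k D] [AddCommGroup E] [Module k E]
  [AddCommGroup U] [Module k U] [AddCommGroup V] [Module k V] [AddCommGroup W] [Module k W]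
  [AddCommGroup M] [Module k M] [AddCommGroup N] [Module k N] [AddCommGroup U'] [Module k U']

theorem sweedler_eq (t : D ⊗[k] U) (G : D ⊗[k] U →ₗ[k] V) (F : D → U → V)
    (h : ∀ a b, F a b = G (a ⊗ₜ[k] b)) : sweedler t F = G t := by
  have := sweedler_eq_lift (k := k) t (TensorProduct.curry G)
  have e : TensorProduct.lift (TensorProduct.curry G) = G := by ext; rfl
  rw [e] at this
  rw [← this]
  exact congrArg (sweedler t) (funext fun a => funext fun b => h a b)

theorem op_eq_sweedler (δ : U →ₗ[k] D ⊗[k] U) (φ : D →ₗ[k] k) (u : U) :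
    op δ φ u = sweedler (δ u) fun d x => φ d • x :=
  (sweedler_eq (δ u) ((TensorProduct.lid k U).toLinearMap ∘ₗ φ.rTensor U) _
    fun a b => by simp).symm

/-- The map `u ⊗ m ↦ u₍₋₁₎ · m ⊗ u₍₀₎`. -/
noncomputable def braid (δ : U →ₗ[k] D ⊗[k] U) (Φ : D →ₗ[k] M →ₗ[k] N) : U ⊗[k] M →ₗ[k] N ⊗[k] U :=
  (TensorProduct.comm k U N).toLinearMap ∘ₗ opE δ Φ

theorem opE_natural {δ : U →ₗ[k] D ⊗[k] U} {δ' : U' →ₗ[k] D ⊗[k] U'} {f : U →ₗ[k] U'}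
    (h : ∀ u, δ' (f u) = f.lTensor D (δ u)) (Φ : D →ₗ[k] M →ₗ[k] N) :
    opE δ' Φ ∘ₗ f.rTensor M = f.rTensor N ∘ₗ opE δ Φ := by
  ext u m
  simp only [TensorProduct.AlgebraTensorModule.curry_apply, LinearMap.restrictScalars_self,
    TensorProduct.curry_apply, LinearMap.comp_apply, LinearMap.rTensor_tmul, opE_tmul, h]
  induction δ u using TensorProduct.induction_on with
  | zero => simp
  | add x y hx hy => simp only [map_add, hx, hy, LinearMap.add_apply]
  | tmul d u => simp

theorem braid_natural {δ : U →ₗ[k] D ⊗[k] U} {δ' : U' →ₗ[k] D ⊗[k] U'} {f : U →ₗ[k] U'}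
    (h : ∀ u, δ' (f u) = f.lTensor D (δ u)) (Φ : D →ₗ[k] M →ₗ[k] N) :
    braid δ' Φ ∘ₗ f.rTensor M = f.lTensor N ∘ₗ braid δ Φ := by
  rw [braid, LinearMap.comp_assoc, opE_natural h, braid]
  ext u m
  simp only [TensorProduct.AlgebraTensorModule.curry_apply, LinearMap.restrictScalars_self,
    TensorProduct.curry_apply, LinearMap.comp_apply, opE_tmul]
  induction evalE Φ (δ u) m using TensorProduct.induction_on with
  | zero => simp
  | add x y hx hy => simp only [map_add, hx, hy]
  | tmul d u => simp

theorem isSemicolinear_comm (δ₁ : U →ₗ[k] D ⊗[k] U) (δ₂ : V →ₗ[k] E ⊗[k] V) :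
    IsSemicolinear (tens δ₁ δ₂) (tens δ₂ δ₁) (TensorProduct.comm k D E).toLinearMap
      (TensorProduct.comm k U V).toLinearMap := by
  suffices h : tens δ₂ δ₁ ∘ₗ (TensorProduct.comm k U V).toLinearMap =
      TensorProduct.map (TensorProduct.comm k D E).toLinearMap
      (TensorProduct.comm k U V).toLinearMap ∘ₗ tens δ₁ δ₂ from LinearMap.congr_fun h
  ext u v
  simp only [TensorProduct.AlgebraTensorModule.curry_apply, LinearMap.restrictScalars_self,
    TensorProduct.curry_apply, LinearMap.comp_apply, LinearEquiv.coe_coe,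
    TensorProduct.comm_tmul, tens_tmul]
  induction δ₁ u using TensorProduct.induction_on with
  | zero => simp
  | add x y hx hy => simp only [TensorProduct.add_tmul, TensorProduct.tmul_add, map_add, hx, hy]
  | tmul d u =>
    induction δ₂ v using TensorProduct.induction_on with
    | zero => simp
    | add x y hx hy => simp only [TensorProduct.add_tmul, TensorProduct.tmul_add, map_add, hx, hy]
    | tmul e v => simp

theorem op_tens_comm (δ₁ : U →ₗ[k] D ⊗[k] U) (δ₂ : V →ₗ[k] E ⊗[k] V) (ψ : E ⊗[k] D →ₗ[k] k) :
    op (tens δ₂ δ₁) ψ ∘ₗ (TensorProduct.comm k U V).toLinearMap =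
      (TensorProduct.comm k U V).toLinearMap ∘ₗ
        opE δ₁ (op δ₂ ∘ₗ TensorProduct.curry (ψ ∘ₗ (TensorProduct.comm k D E).toLinearMap)) := by
  rw [← op_tens]
  exact LinearMap.ext ((isSemicolinear_comm δ₁ δ₂).op ψ)

/-- Pairing the coefficient space off `opE δ Φ` evaluates `Φ` at a matrix coefficient. -/
theorem rTensor_opE (δ : U →ₗ[k] D ⊗[k] U) (Φ : D →ₗ[k] M →ₗ[k] N) (ξ : U →ₗ[k] k) (u : U) (m : M) :
    TensorProduct.lid k N (ξ.rTensor N (opE δ Φ (u ⊗ₜ[k] m))) =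
      Φ (TensorProduct.rid k D (ξ.lTensor D (δ u))) m := by
  rw [opE_tmul]
  induction δ u using TensorProduct.induction_on with
  | zero => simp
  | add x y hx hy => simp only [map_add, hx, hy, LinearMap.add_apply]
  | tmul d u => simp

variable [Coalgebra k D] [Coalgebra k E]

theorem cmp_apply_sweedler (Φ : D →ₗ[k] M →ₗ[k] N) (Ψ : D →ₗ[k] N →ₗ[k] W) (d : D) (m : M) :
    cmp Φ Ψ d m = cop2 k d fun a b => Ψ b (Φ a m) := by
  rw [cmp_apply]
  simp [cop2, sweedler, LinearMap.sum_apply]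

theorem cmp_cmp_apply_sweedler {N' : Type*} [AddCommGroup N'] [Module k N']
    (Φ : D →ₗ[k] M →ₗ[k] N) (Ψ : D →ₗ[k] N →ₗ[k] W) (Θ : D →ₗ[k] W →ₗ[k] N') (d : D) (m : M) :
    cmp (cmp Φ Ψ) Θ d m = cop3 k d fun a b c => Θ c (Ψ b (Φ a m)) := by
  let G : D ⊗[k] (D ⊗[k] D) →ₗ[k] N' := TensorProduct.lift (LinearMap.flip (TensorProduct.lift
    (LinearMap.mk₂ k (fun b c => Θ c ∘ₗ Ψ b ∘ₗ Φ.flip m)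
    (by intros; ext; simp) (by intros; ext; simp)
    (by intros; ext; simp) (by intros; ext; simp))))
  rw [cop3_eq d G _ fun a b c => by simp [G], cmp_apply_sweedler, comul3, LinearMap.comp_apply,
    ← Coalgebra.coassoc_apply]
  refine cop2_eq d (G ∘ₗ (TensorProduct.assoc k D D D).toLinearMap ∘ₗ comul.rTensor D) _
    fun a b => ?_
  rw [cmp_apply_sweedler]
  simp only [LinearMap.comp_apply, LinearMap.rTensor_tmul, LinearEquiv.coe_coe]
  rw [cop2, sweedler, map_sum]
  conv_rhs => rw [(TensorProduct.exists_finset (Coalgebra.comul (R := k) a)).choose_spec]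
  simp [TensorProduct.sum_tmul, G]

end General

section Quasi
variable {k : Type*} {H : Type*} [Field k] [NonAssocRing H] [Module k H]
  [IsScalarTower k H H] [SMulCommClass k H H] [Coalgebra k H] [DualQuasiHopfAlgebra k H]
variable {U V M : Type*}
  [AddCommGroup U] [Module k U] [AddCommGroup V] [Module k V] [AddCommGroup M] [Module k M]
variable (δU : U →ₗ[k] H ⊗[k] U) (δV : V →ₗ[k] H ⊗[k] V) (δ : M →ₗ[k] H ⊗[k] M)
  (act : H →ₗ[k] M →ₗ[k] M)

/-- `h ↦ φ(h m₍₋₁₎) m₍₀₎` -/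
noncomputable def opMulLeft (φ : H →ₗ[k] k) : H →ₗ[k] M →ₗ[k] M :=
  op δ ∘ₗ TensorProduct.curry (φ ∘ₗ mulL k H)

/-- `h ↦ φ(m₍₋₁₎ h) m₍₀₎` -/
noncomputable def opMulRight (φ : H →ₗ[k] k) : H →ₗ[k] M →ₗ[k] M :=
  op δ ∘ₗ TensorProduct.curry ((φ ∘ₗ mulL k H) ∘ₗ (TensorProduct.comm k H H).toLinearMap)

theorem opMulLeft_apply (φ : H →ₗ[k] k) (h : H) (m : M) :
    opMulLeft δ φ h m = sweedler (δ m) fun m₁ m₀ => φ (h * m₁) • m₀ :=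
  op_eq_sweedler δ _ m

theorem opMulRight_apply (φ : H →ₗ[k] k) (h : H) (m : M) :
    opMulRight δ φ h m = sweedler (δ m) fun m₁ m₀ => φ (m₁ * h) • m₀ :=
  op_eq_sweedler δ _ m

/-- The compatibility of action and coaction in terms of functionals; by `braid_colinear_iff` it
expresses that `braid` is colinear. -/
theorem compat_iff : (∀ (h : H) (m : M),
    (cop2 k h fun h₁ h₂ => sweedler (δ m) fun m₁ m₀ => (h₁ * m₁) ⊗ₜ[k] act h₂ m₀) =
    cop2 k h fun h₁ h₂ => sweedler (δ (act h₁ m)) fun p₁ p₀ => (p₁ * h₂) ⊗ₜ[k] p₀) ↔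
    ∀ φ : H →ₗ[k] k, cmp (opMulLeft δ φ) act = cmp act (opMulRight δ φ) := by
  have h1 : ∀ φ h m, TensorProduct.lid k M (φ.rTensor M
      (cop2 k h fun h₁ h₂ => sweedler (δ m) fun m₁ m₀ => (h₁ * m₁) ⊗ₜ[k] act h₂ m₀)) =
      cmp (opMulLeft δ φ) act h m := by
    intro φ h m
    rw [cmp_apply_sweedler]
    simp [opMulLeft_apply, cop2, sweedler]
  have h2 : ∀ φ h m, TensorProduct.lid k M (φ.rTensor M
      (cop2 k h fun h₁ h₂ => sweedler (δ (act h₁ m)) fun p₁ p₀ => (p₁ * h₂) ⊗ₜ[k] p₀)) =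
      cmp act (opMulRight δ φ) h m := by
    intro φ h m
    rw [cmp_apply_sweedler]
    simp [opMulRight_apply, cop2, sweedler]
  constructor
  · intro h φ
    ext a m
    rw [← h1, ← h2, h]
  · intro h a m
    refine eq_of_forall_functional fun φ => ?_
    rw [h1, h2, h]

theorem braid_op_diag (hU : IsCoaction δU) (φ : H →ₗ[k] k) :
    braid δU act ∘ₗ op (diag δU δ) φ =
      (TensorProduct.comm k U M).toLinearMap ∘ₗ opE δU (cmp (opMulLeft δ φ) act) := by
  rw [← opE_opE hU, diag, op_push, op_tens, braid, LinearMap.comp_assoc, opMulLeft]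

theorem op_diag_braid (hU : IsCoaction δU) (φ : H →ₗ[k] k) :
    op (diag δ δU) φ ∘ₗ braid δU act =
      (TensorProduct.comm k U M).toLinearMap ∘ₗ opE δU (cmp act (opMulRight δ φ)) := by
  rw [← opE_opE hU, diag, op_push, braid, ← LinearMap.comp_assoc, op_tens_comm,
    LinearMap.comp_assoc, opMulRight]

theorem braid_colinear_iff (hU : IsCoaction δU) :
    (∀ t, diag δ δU (braid δU act t) = (braid δU act).lTensor H (diag δU δ t)) ↔
      ∀ φ : H →ₗ[k] k, opE δU (cmp (opMulLeft δ φ) act) = opE δU (cmp act (opMulRight δ φ)) := by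
  rw [colinear_iff]
  refine forall_congr' fun φ => ?_
  rw [braid_op_diag δU δ act hU, op_diag_braid δU δ act hU]
  exact ⟨fun h => LinearMap.ext fun t => (TensorProduct.comm k U M).injective
    (LinearMap.congr_fun h t), fun h => by rw [h]⟩

/-- `σ(a, b, m₍₋₁₎) m₍₀₎` -/
noncomputable def opσRight : H ⊗[k] H →ₗ[k] M →ₗ[k] M :=
  op δ ∘ₗ TensorProduct.curry (tri σ ∘ₗ (TensorProduct.assoc k H H H).toLinearMap)

/-- `σ(m₍₋₁₎, a, b) m₍₀₎` -/
noncomputable def opσLeft : H ⊗[k] H →ₗ[k] M →ₗ[k] M :=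
  op δ ∘ₗ TensorProduct.curry (tri σ ∘ₗ (TensorProduct.comm k (H ⊗[k] H) H).toLinearMap)

/-- `(u ⊗ v) ⊗ m ↦ u ⊗ (m ⊗ v)` -/
noncomputable def swapRight (k U V M : Type*) [Field k] [AddCommGroup U] [Module k U]
    [AddCommGroup V] [Module k V] [AddCommGroup M] [Module k M] :
    (U ⊗[k] V) ⊗[k] M ≃ₗ[k] U ⊗[k] (M ⊗[k] V) :=
  TensorProduct.assoc k U V M ≪≫ₗ
    TensorProduct.congr (LinearEquiv.refl k U) (TensorProduct.comm k V M)

/-- `σ(a, m₍₋₁₎, b) m₍₀₎` -/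
noncomputable def opσMid : H ⊗[k] H →ₗ[k] M →ₗ[k] M :=
  op δ ∘ₗ TensorProduct.curry (tri σ ∘ₗ (swapRight k H H H).toLinearMap)

/-- `ε(a) b · m` -/
noncomputable def actSnd : H ⊗[k] H →ₗ[k] M →ₗ[k] M :=
  TensorProduct.lift ((counit (R := k) (A := H)).smulRight act)

/-- `ε(b) a · m` -/
noncomputable def actFst : H ⊗[k] H →ₗ[k] M →ₗ[k] M :=
  actSnd act ∘ₗ (TensorProduct.comm k H H).toLinearMap

theorem opσRight_apply (a b : H) (m : M) :
    opσRight δ (a ⊗ₜ[k] b) m = sweedler (δ m) fun m₁ m₀ => σ (k := k) a b m₁ • m₀ :=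
  op_eq_sweedler δ _ m
theorem opσLeft_apply (a b : H) (m : M) :
    opσLeft δ (a ⊗ₜ[k] b) m = sweedler (δ m) fun m₁ m₀ => σ (k := k) m₁ a b • m₀ :=
  op_eq_sweedler δ _ m
theorem opσMid_apply (a b : H) (m : M) :
    opσMid δ (a ⊗ₜ[k] b) m = sweedler (δ m) fun m₁ m₀ => σ (k := k) a m₁ b • m₀ :=
  op_eq_sweedler δ _ m

theorem cmp_cmp_tmul {D E M₁ M₂ M₃ M₄ : Type*} [AddCommGroup D] [Module k D] [AddCommGroup E]
    [Module k E] [Coalgebra k D] [Coalgebra k E]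
    [AddCommGroup M₁] [Module k M₁] [AddCommGroup M₂]
    [Module k M₂] [AddCommGroup M₃] [Module k M₃] [AddCommGroup M₄] [Module k M₄]
    (Φ : D ⊗[k] E →ₗ[k] M₁ →ₗ[k] M₂) (Ψ : D ⊗[k] E →ₗ[k] M₂ →ₗ[k] M₃)
    (Θ : D ⊗[k] E →ₗ[k] M₃ →ₗ[k] M₄) (d : D) (e : E) (m : M₁) :
    cmp (cmp Φ Ψ) Θ (d ⊗ₜ[k] e) m = cop3 k d fun d₁ d₂ d₃ => cop3 k e fun e₁ e₂ e₃ =>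
      Θ (d₃ ⊗ₜ[k] e₃) (Ψ (d₂ ⊗ₜ[k] e₂) (Φ (d₁ ⊗ₜ[k] e₁) m)) := by
  let G : (D ⊗[k] E) ⊗[k] ((D ⊗[k] E) ⊗[k] (D ⊗[k] E)) →ₗ[k] M₄ :=
    TensorProduct.lift (LinearMap.flip (TensorProduct.lift
    (LinearMap.mk₂ k (fun b c => Θ c ∘ₗ Ψ b ∘ₗ Φ.flip m)
    (by intros; ext; simp) (by intros; ext; simp)
    (by intros; ext; simp) (by intros; ext; simp))))
  rw [cmp_cmp_apply_sweedler]
  refine (cop3_eq (d ⊗ₜ[k] e) G _ fun a b c => by simp [G]).trans ?_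
  exact apply_comul3_tmul d e G

/-- The associativity axiom of a Yetter-Drinfeld module, as an identity between families of
operators indexed by `H ⊗ H`. -/
theorem act_act_iff : (∀ (h g : H) (m : M),
    (cop3 k h fun h₁ h₂ h₃ => cop3 k g fun g₁ g₂ g₃ => sweedler (δ m) fun m₁ m₀ =>
      sweedler (δ (act (h₂ * g₂) m₀)) fun p₁ p₀ =>
        (σ h₁ g₁ m₁ * σ p₁ h₃ g₃ : k) • p₀) =
    cop2 k h fun h₁ h₂ => cop2 k g fun g₁ g₂ => sweedler (δ (act g₁ m)) fun p₁ p₀ =>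
      (σ h₁ p₁ g₂ : k) • act h₂ p₀) ↔
    cmp (cmp (opσRight δ) (act ∘ₗ mulL k H)) (opσLeft δ) =
      cmp (cmp (actSnd act) (opσMid δ)) (actFst act) := by
  have h1 : ∀ (h g : H) (m : M),
    (cop3 k h fun h₁ h₂ h₃ => cop3 k g fun g₁ g₂ g₃ => sweedler (δ m) fun m₁ m₀ =>
      sweedler (δ (act (h₂ * g₂) m₀)) fun p₁ p₀ =>
        (σ h₁ g₁ m₁ * σ p₁ h₃ g₃ : k) • p₀) =
      cmp (cmp (opσRight δ) (act ∘ₗ mulL k H)) (opσLeft δ) (h ⊗ₜ[k] g) m := by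
    intro h g m
    rw [cmp_cmp_tmul]
    refine congrArg (cop3 k h) (funext fun h₁ => funext fun h₂ => funext fun h₃ => ?_)
    refine congrArg (cop3 k g) (funext fun g₁ => funext fun g₂ => funext fun g₃ => ?_)
    rw [LinearMap.comp_apply, LinearMap.mul'_apply]
    have hG : ∀ x, sweedler (δ x) (fun p₁ p₀ => σ (k := k) p₁ h₃ g₃ • p₀) =
        opσLeft δ (h₃ ⊗ₜ[k] g₃) x := fun x => (opσLeft_apply δ _ _ _).symm
    rw [opσRight_apply]
    simp only [mul_smul]
    trans sweedler (δ m) fun m₁ m₀ => σ (k := k) h₁ g₁ m₁ •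
      opσLeft δ (h₃ ⊗ₜ[k] g₃) (act (h₂ * g₂) m₀)
    · simp only [← hG]
      simp only [sweedler, Finset.smul_sum]
    · simp only [sweedler, map_sum, map_smul]
  have h2 : ∀ (h g : H) (m : M), (cop2 k h fun h₁ h₂ => cop2 k g fun g₁ g₂ =>
      sweedler (δ (act g₁ m)) fun p₁ p₀ => (σ h₁ p₁ g₂ : k) • act h₂ p₀) =
      cmp (cmp (actSnd act) (opσMid δ)) (actFst act) (h ⊗ₜ[k] g) m := by
    intro h g m
    rw [cmp_cmp_tmul]
    have e : ∀ h₁ h₂ h₃ g₁ g₂ g₃ : H, (actFst act (h₃ ⊗ₜ[k] g₃)) (opσMid δ (h₂ ⊗ₜ[k] g₂)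
        (actSnd act (h₁ ⊗ₜ[k] g₁) m)) = counit (R := k) h₁ • counit (R := k) g₃ •
          act h₃ (opσMid δ (h₂ ⊗ₜ[k] g₂) (act g₁ m)) := by
      intros
      simp [actFst, actSnd]
    simp only [e]
    have e1 : ∀ (h₁ h₂ h₃ : H), (cop3 k g fun g₁ g₂ g₃ => counit (R := k) h₁ • counit (R := k) g₃ •
          act h₃ (opσMid δ (h₂ ⊗ₜ[k] g₂) (act g₁ m))) = counit (R := k) h₁ •
        cop2 k g fun g₁ g₂ => act h₃ (opσMid δ (h₂ ⊗ₜ[k] g₂) (act g₁ m)) := by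
      intro h₁ h₂ h₃
      simp only [cop3]
      have : ∀ g₁ g' : H, (cop2 k g' fun g₂ g₃ => counit (R := k) h₁ • counit (R := k) g₃ •
          act h₃ (opσMid δ (h₂ ⊗ₜ[k] g₂) (act g₁ m))) = counit (R := k) h₁ •
            act h₃ (opσMid δ (h₂ ⊗ₜ[k] g') (act g₁ m)) := by
        intro g₁ g'
        refine (cop2_eq g' (counit (R := k) h₁ • ((act h₃ ∘ₗ ((opσMid δ).flip (act g₁ m)) ∘ₗ
          TensorProduct.mk k H H h₂) ∘ₗ (TensorProduct.rid k H).toLinearMap ∘ₗ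
            (counit (R := k)).lTensor H)) _ fun a b => by simp).trans ?_
        simp
      simp only [this]
      simp only [cop2, sweedler, Finset.smul_sum]
    simp only [e1]
    let Q : H →ₗ[k] H →ₗ[k] M := LinearMap.mk₂ k
      (fun h₂ h₃ => cop2 k g fun g₁ g₂ => act h₃ (opσMid δ (h₂ ⊗ₜ[k] g₂) (act g₁ m)))
      (by intros; simp [cop2, sweedler, TensorProduct.add_tmul, Finset.sum_add_distrib])
      (by intros; simp [cop2, sweedler, ← TensorProduct.smul_tmul', Finset.smul_sum])
      (by intros; simp [cop2, sweedler, Finset.sum_add_distrib])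
      (by intros; simp [cop2, sweedler, Finset.smul_sum])
    refine Eq.trans ?_ (cop3_eq h (TensorProduct.lift Q ∘ₗ (TensorProduct.lid k _).toLinearMap ∘ₗ
      (counit (R := k)).rTensor (H ⊗[k] H)) _ fun a b c => by simp [Q]).symm
    have e3 : (counit (R := k)).rTensor (H ⊗[k] H) (comul3 k H h) =
        1 ⊗ₜ[k] comul (R := k) h := by
      rw [comul3, LinearMap.comp_apply, ← LinearMap.comp_apply,
        LinearMap.rTensor_comp_lTensor, ← LinearMap.lTensor_comp_rTensor, LinearMap.comp_apply,
        Coalgebra.rTensor_counit_comul]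
      simp
    rw [LinearMap.comp_apply, LinearMap.comp_apply, e3]
    simp only [LinearEquiv.coe_coe, TensorProduct.lid_tmul, one_smul]
    rw [← cop2_eq h (TensorProduct.lift Q) (fun h₂ h₃ => cop2 k g fun g₁ g₂ =>
      act h₃ (opσMid δ (h₂ ⊗ₜ[k] g₂) (act g₁ m))) fun a b => rfl]
    refine congrArg (cop2 k h) (funext fun h₁ => funext fun h₂ => ?_)
    refine congrArg (cop2 k g) (funext fun g₁ => funext fun g₂ => ?_)
    rw [opσMid_apply]
    simp [sweedler]
  constructor
  · intro h
    ext a b m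
    exact (h1 a b m).symm.trans ((h a b m).trans (h2 a b m))
  · intro h a b m
    rw [h1, h2, h]

theorem isSemicolinear_swapRight : IsSemicolinear (tens (tens δU δV) δ) (tens δU (tens δ δV))
    (swapRight k H H H).toLinearMap (swapRight k U V M).toLinearMap :=
  ((IsSemicolinear.id δU).tens (isSemicolinear_comm δV δ)).comp
    (isSemicolinear_assoc_symm δU δV δ).symm

theorem lTensor_braid (hU : IsCoaction δU) (t : (U ⊗[k] V) ⊗[k] M) :
    (braid δV act).lTensor U (TensorProduct.assoc k U V M t) =
      swapRight k U V M (opE (tens δU δV) (actSnd act) t) := by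
  induction t using TensorProduct.induction_on with
  | zero => simp
  | add x y hx hy => simp only [map_add, hx, hy]
  | tmul x m =>
    induction x using TensorProduct.induction_on with
    | zero => simp
    | add x y hx hy => simp only [TensorProduct.add_tmul, map_add, hx, hy]
    | tmul u v =>
      have hc := hU.counit u
      simp only [TensorProduct.assoc_tmul, LinearMap.lTensor_tmul, opE_tmul, tens_tmul, braid,
        LinearMap.comp_apply]
      have e : ∀ (a : H ⊗[k] U) (c : H ⊗[k] V), evalE (actSnd act)
          (TensorProduct.tensorTensorTensorComm k H U H V (a ⊗ₜ[k] c)) m =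
          (TensorProduct.assoc k U V M).symm
            (TensorProduct.lid k U ((counit (R := k)).rTensor U a) ⊗ₜ[k] evalE act c m) := by
        intro a c
        induction a using TensorProduct.induction_on with
        | zero => simp
        | add x y hx hy => simp only [TensorProduct.add_tmul, map_add, LinearMap.add_apply, hx, hy]
        | tmul h u =>
          induction c using TensorProduct.induction_on with
          | zero => simp
          | add x y hx hy =>
            simp only [TensorProduct.tmul_add, map_add, LinearMap.add_apply, hx, hy]
          | tmul g v => simp [actSnd, TensorProduct.tmul_smul, ← TensorProduct.smul_tmul']
      rw [e, hc]
      simp [swapRight]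

theorem rTensor_braid (hV : IsCoaction δV) (t : (U ⊗[k] V) ⊗[k] M) :
    (braid δU act).rTensor V ((TensorProduct.assoc k U M V).symm (swapRight k U V M t)) =
      (TensorProduct.assoc k M U V).symm (TensorProduct.comm k _ _
        (opE (tens δU δV) (actFst act) t)) := by
  induction t using TensorProduct.induction_on with
  | zero => simp
  | add x y hx hy => simp only [map_add, hx, hy]
  | tmul x m =>
    induction x using TensorProduct.induction_on with
    | zero => simp
    | add x y hx hy => simp only [TensorProduct.add_tmul, map_add, hx, hy]
    | tmul u v =>
      have hc := hV.counit v
      simp only [opE_tmul, tens_tmul, braid, swapRight, LinearEquiv.trans_apply,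
        TensorProduct.assoc_tmul, TensorProduct.congr_tmul, LinearEquiv.refl_apply,
        TensorProduct.comm_tmul, TensorProduct.assoc_symm_tmul, LinearMap.rTensor_tmul,
        LinearMap.comp_apply]
      have e : ∀ (a : H ⊗[k] U) (c : H ⊗[k] V), TensorProduct.comm k _ _ (evalE (actFst act)
          (TensorProduct.tensorTensorTensorComm k H U H V (a ⊗ₜ[k] c)) m) =
          TensorProduct.assoc k M U V (TensorProduct.comm k _ _ (evalE act a m) ⊗ₜ[k]
            (TensorProduct.lid k V ((counit (R := k)).rTensor V c))) := by
        intro a c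
        induction a using TensorProduct.induction_on with
        | zero => simp
        | add x y hx hy => simp only [TensorProduct.add_tmul, map_add, LinearMap.add_apply, hx, hy]
        | tmul h u =>
          induction c using TensorProduct.induction_on with
          | zero => simp
          | add x y hx hy =>
            simp only [TensorProduct.tmul_add, map_add, LinearMap.add_apply, hx, hy]
          | tmul g v => simp [actFst, actSnd, TensorProduct.tmul_smul]
      rw [e, hc]
      simp

variable {δU δV}

theorem hexagon_left (hU : IsCoaction δU) (hV : IsCoaction δV) (t : (U ⊗[k] V) ⊗[k] M) :
    assocLinv δ δU δV (braid (diag δU δV) act (assocLinv δU δV δ (TensorProduct.assoc k U V M t))) =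
      (TensorProduct.assoc k M U V).symm (TensorProduct.comm k _ _ (opE (tens δU δV)
        (cmp (cmp (opσRight δ) (act ∘ₗ mulL k H)) (opσLeft δ)) t)) := by
  have h1 : assocLinv δU δV δ (TensorProduct.assoc k U V M t) =
      opE (tens δU δV) (opσRight δ) t := by
    rw [assocLinv, LinearMap.comp_apply, LinearEquiv.coe_coe, LinearEquiv.symm_apply_eq]
    refine ((isSemicolinear_assoc_symm δU δV δ).symm.op (tri σ) t).trans ?_
    rw [op_tens]
    rfl
  have h2 : ∀ s, assocLinv δ δU δV (TensorProduct.comm k (U ⊗[k] V) M s) =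
      (TensorProduct.assoc k M U V).symm (TensorProduct.comm k _ _
        (opE (tens δU δV) (opσLeft δ) s)) := fun s =>
    congrArg (TensorProduct.assoc k M U V).symm
      (LinearMap.congr_fun (op_tens_comm (tens δU δV) δ (tri σ)) s)
  rw [h1, braid, diag, opE_push, LinearMap.comp_apply, LinearEquiv.coe_coe, h2,
    ← opE_opE (hU.tens hV), ← opE_opE (hU.tens hV)]
  rfl

theorem hexagon_right (hU : IsCoaction δU) (hV : IsCoaction δV) (t : (U ⊗[k] V) ⊗[k] M) :
    (braid δU act).rTensor V (assocLinv δU δ δV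
      ((braid δV act).lTensor U (TensorProduct.assoc k U V M t))) =
      (TensorProduct.assoc k M U V).symm (TensorProduct.comm k _ _ (opE (tens δU δV)
        (cmp (cmp (actSnd act) (opσMid δ)) (actFst act)) t)) := by
  rw [lTensor_braid δU δV act hU, ← opE_opE (hU.tens hV), ← opE_opE (hU.tens hV)]
  have h2 : ∀ s, assocLinv δU δ δV (swapRight k U V M s) =
      (TensorProduct.assoc k U M V).symm (swapRight k U V M (opE (tens δU δV) (opσMid δ) s)) := by
    intro s
    have := (isSemicolinear_swapRight δU δV δ).op (tri σ) s
    rw [op_tens (tens δU δV)] at this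
    exact congrArg (TensorProduct.assoc k U M V).symm this
  rw [h2, rTensor_braid δU δV act hV]
  rfl

/-- The tensor compatibility of `braid`, as a half-braiding, is the associativity axiom of the
action read through the coactions of `U` and `V`; compare `act_act_iff`. -/
theorem hexagon_iff (hU : IsCoaction δU) (hV : IsCoaction δV) :
    (∀ t, assocLinv δ δU δV (braid (diag δU δV) act (assocLinv δU δV δ t)) =
      (braid δU act).rTensor V (assocLinv δU δ δV ((braid δV act).lTensor U t))) ↔
    opE (tens δU δV) (cmp (cmp (opσRight δ) (act ∘ₗ mulL k H)) (opσLeft δ)) =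
      opE (tens δU δV) (cmp (cmp (actSnd act) (opσMid δ)) (actFst act)) := by
  constructor
  · intro h
    ext1
    refine LinearMap.ext fun x => LinearMap.ext fun m => ?_
    have := h (TensorProduct.assoc k U V M (x ⊗ₜ[k] m))
    rw [hexagon_left δ act hU hV, hexagon_right δ act hU hV] at this
    exact (TensorProduct.comm k _ _).injective ((TensorProduct.assoc k M U V).symm.injective this)
  · intro h t
    obtain ⟨t, rfl⟩ := (TensorProduct.assoc k U V M).surjective t
    rw [hexagon_left δ act hU hV, hexagon_right δ act hU hV, h]

end Quasi
end Coaction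

namespace Coaction
variable {k : Type*} [Field k] {D U V : Type*} [AddCommGroup D] [Module k D] [AddCommGroup U]
  [Module k U] [AddCommGroup V] [Module k V]

/-! ### Matrix coefficients of finite-dimensional comodules -/

theorem op_restrict (δ : U →ₗ[k] D ⊗[k] U) (f : V →ₗ[k] U) (π : U →ₗ[k] V) (φ : D →ₗ[k] k) :
    op (π.lTensor D ∘ₗ δ ∘ₗ f) φ = π ∘ₗ op δ φ ∘ₗ f := by
  refine LinearMap.ext fun v => ?_
  simp only [op_apply, LinearMap.comp_apply]
  induction δ (f v) using TensorProduct.induction_on with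
  | zero => simp
  | add x y hx hy => simp only [map_add, hx, hy]
  | tmul d u => simp

/-- A subspace stable under all the operators `op δ φ` is a subcomodule; here the subspace is the
image of `f`, with retraction `π`. -/
theorem IsCoaction.restrict [Coalgebra k D] {δ : U →ₗ[k] D ⊗[k] U} (hδ : IsCoaction δ)
    (f : V →ₗ[k] U) (π : U →ₗ[k] V) (hπ : π ∘ₗ f = LinearMap.id)
    (hf : ∀ φ v, f (π (op δ φ (f v))) = op δ φ (f v)) :
    IsCoaction (π.lTensor D ∘ₗ δ ∘ₗ f) := by
  apply isCoaction_of_op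
  · rw [op_restrict, op_counit hδ]
    exact hπ
  · intro φ ψ
    rw [op_restrict, op_restrict, op_restrict, ← op_op hδ]
    refine LinearMap.ext fun v => ?_
    simp only [LinearMap.comp_apply, hf]

theorem restrict_colinear {δ : U →ₗ[k] D ⊗[k] U} (f : V →ₗ[k] U) (π : U →ₗ[k] V)
    (hf : ∀ φ v, f (π (op δ φ (f v))) = op δ φ (f v)) (v : V) :
    δ (f v) = f.lTensor D ((π.lTensor D ∘ₗ δ ∘ₗ f) v) := by
  revert v
  rw [colinear_iff]
  intro φ
  refine LinearMap.ext fun v => ?_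
  rw [op_restrict]
  exact hf φ v

/-- The subcomodule generated by `u`. -/
noncomputable def cyclic (δ : U →ₗ[k] D ⊗[k] U) (u : U) : Submodule k U :=
  LinearMap.range (LinearMap.flip (op δ) u)

theorem cyclic_fg (δ : U →ₗ[k] D ⊗[k] U) (u : U) : (cyclic δ u).FG := by
  classical
  obtain ⟨S, hS⟩ := TensorProduct.exists_finset (δ u)
  refine Submodule.FG.of_le (T := Submodule.span k (S.image Prod.snd)) ⟨_, rfl⟩ ?_
  rintro _ ⟨φ, rfl⟩
  change op δ φ u ∈ _
  rw [op_apply, hS]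
  simp only [map_sum, LinearMap.rTensor_tmul, TensorProduct.lid_tmul]
  exact Submodule.sum_mem _ fun p hp => Submodule.smul_mem _ _
    (Submodule.subset_span (by simpa using ⟨p.1, hp⟩))

theorem op_mem_cyclic [Coalgebra k D] {δ : U →ₗ[k] D ⊗[k] U} (hδ : IsCoaction δ) (u : U)
    (φ : D →ₗ[k] k) {x : U} (hx : x ∈ cyclic δ u) : op δ φ x ∈ cyclic δ u := by
  obtain ⟨ψ, rfl⟩ := hx
  exact ⟨dconv ψ φ, (LinearMap.congr_fun (op_op hδ ψ φ) u).symm⟩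

theorem mem_cyclic [Coalgebra k D] {δ : U →ₗ[k] D ⊗[k] U} (hδ : IsCoaction δ) (u : U) :
    u ∈ cyclic δ u := ⟨counit, LinearMap.congr_fun (op_counit hδ) u⟩

end Coaction

namespace FdComod

variable {k : Type u} {H : Type v} [Field k] [NonAssocRing H] [Module k H]
  [IsScalarTower k H H] [SMulCommClass k H H] [Coalgebra k H] [DualQuasiHopfAlgebra k H]

/-- Every element of `H` is a matrix coefficient of a finite-dimensional comodule, namely of the
subcomodule of `H` that it generates. -/
theorem exists_coefficient (h : H) : ∃ (U : FdComod k H) (x : U) (ξ : U →ₗ[k] k),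
    TensorProduct.rid k H (ξ.lTensor H (U.coact x)) = h := by
  have hc : IsCoaction (comul (R := k) (A := H)) :=
    ⟨fun u => by simp, fun u => Coalgebra.coassoc_apply u⟩
  let W := cyclic (comul (R := k) (A := H)) h
  have : FiniteDimensional k W := Module.Finite.iff_fg.mpr (cyclic_fg _ h)
  -- Coordinates on `W`, because the carrier of an object lives in the universe of `k`, not of `H`.
  let e : W ≃ₗ[k] (Fin (Module.finrank k W) → k) := (Module.finBasis k W).equivFun
  obtain ⟨f, hf⟩ : ∃ f : (Fin (Module.finrank k W) → k) →ₗ[k] H,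
      f = W.subtype ∘ₗ e.symm.toLinearMap := ⟨_, rfl⟩
  have hfW : ∀ v, f v ∈ W := fun v => by rw [hf]; exact (e.symm v).2
  have hWf : ∀ y ∈ W, ∃ v, f v = y := fun y hy => ⟨e ⟨y, hy⟩, by simp [hf]⟩
  have hinj : Function.Injective f := by
    rw [hf]
    exact (Submodule.subtype_injective W).comp e.symm.injective
  obtain ⟨π, hπ⟩ := f.exists_leftInverse_of_injective (LinearMap.ker_eq_bot.mpr hinj)
  have hmem : ∀ y ∈ W, f (π y) = y := by
    intro y hy
    obtain ⟨v, rfl⟩ := hWf y hy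
    exact congrArg f (LinearMap.congr_fun hπ v)
  have hst : ∀ φ v, f (π (op comul φ (f v))) = op (comul (R := k) (A := H)) φ (f v) :=
    fun φ v => hmem _ (op_mem_cyclic hc h φ (hfW v))
  refine ⟨⟨Fin (Module.finrank k W) → k, π.lTensor H ∘ₗ comul ∘ₗ f, hc.restrict f π hπ hst⟩,
    π h, counit ∘ₗ f, ?_⟩
  have hcol := restrict_colinear f π hst (π h)
  rw [hmem h (mem_cyclic hc h)] at hcol
  rw [LinearMap.lTensor_comp_apply, ← hcol]
  simp

variable {M N : Type*} [AddCommGroup M] [Module k M] [AddCommGroup N] [Module k N]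

/-- A family `Φ` of operators is determined by the maps `opE U.coact Φ`. -/
theorem eq_of_opE {Φ Ψ : H →ₗ[k] M →ₗ[k] N}
    (h : ∀ U : FdComod k H, opE U.coact Φ = opE U.coact Ψ) : Φ = Ψ := by
  ext a m
  obtain ⟨U, x, ξ, rfl⟩ := exists_coefficient (k := k) a
  rw [← rTensor_opE, h, rTensor_opE]

theorem eq_of_braid {Φ Ψ : H →ₗ[k] M →ₗ[k] N}
    (h : ∀ U : FdComod k H, braid U.coact Φ = braid U.coact Ψ) : Φ = Ψ :=
  eq_of_opE fun U => LinearMap.ext fun t => (TensorProduct.comm k U N).injective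
    (LinearMap.congr_fun (h U) t)

theorem eq_of_opE_tens {Φ Ψ : H ⊗[k] H →ₗ[k] M →ₗ[k] N}
    (h : ∀ U V : FdComod k H, opE (tens U.coact V.coact) Φ = opE (tens U.coact V.coact) Ψ) :
    Φ = Ψ := by
  ext a b m
  obtain ⟨U, x, ξ, rfl⟩ := exists_coefficient (k := k) a
  obtain ⟨V, y, ζ, rfl⟩ := exists_coefficient (k := k) b
  have e : TensorProduct.rid k H (ξ.lTensor H (U.coact x)) ⊗ₜ[k]
      TensorProduct.rid k H (ζ.lTensor H (V.coact y)) =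
      TensorProduct.rid k (H ⊗[k] H) ((tmulFun ξ ζ).lTensor (H ⊗[k] H)
        (tens U.coact V.coact (x ⊗ₜ[k] y))) := by
    rw [tens_tmul]
    induction U.coact x using TensorProduct.induction_on with
    | zero => simp
    | add x y hx hy => simp only [TensorProduct.add_tmul, map_add, hx, hy]
    | tmul d u =>
      induction V.coact y using TensorProduct.induction_on with
      | zero => simp
      | add x y hx hy => simp only [TensorProduct.tmul_add, map_add, hx, hy]
      | tmul e v =>
        simp [tmulFun, TensorProduct.tmul_smul, TensorProduct.smul_tmul', smul_smul, mul_comm]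
  simp only [TensorProduct.AlgebraTensorModule.curry_apply, LinearMap.restrictScalars_self,
    TensorProduct.curry_apply]
  rw [e, ← rTensor_opE, h, rTensor_opE]

/-! ### Duals on the other side -/

section Codual
variable (hs : Function.Bijective (antipode (k := k) (H := H)))

theorem antipode_comp_sInv : antipode ∘ₗ sInv k hs = LinearMap.id :=
  LinearMap.ext fun h => (LinearEquiv.ofBijective (s k : H →ₗ[k] H) hs).apply_symm_apply h

theorem sInv_comp_antipode : sInv k hs ∘ₗ antipode = LinearMap.id :=
  LinearMap.ext fun h => (LinearEquiv.ofBijective (s k : H →ₗ[k] H) hs).symm_apply_apply h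

/-- Evaluation identifies `U` with the dual of its codual. -/
noncomputable def evalIso (U : FdComod k H) : U ≅ dual (codual hs U) :=
  isoMk (M := U) (N := dual (codual hs U)) (Module.evalEquiv k U).toLinearMap
    (Module.evalEquiv k U).symm.toLinearMap
    (LinearEquiv.symm_apply_apply (Module.evalEquiv k U))
    (LinearEquiv.apply_symm_apply (Module.evalEquiv k U)) (by
    refine (colinear_iff (δ := U.coact) (δ' := dualCoact antipode (dualCoact (sInv k hs) U.coact))
      (Module.evalEquiv k U).toLinearMap).2 fun φ => ?_
    refine LinearMap.ext fun x => LinearMap.ext fun ψ => ?_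
    have h1 := dualCoact_isAdjoint (antipode (k := k) (H := H)) (codual hs U).coact φ
      (Module.evalEquiv k U x) ψ
    have h2 := dualCoact_isAdjoint (sInv k hs) U.coact (φ ∘ₗ antipode) ψ x
    rw [LinearMap.comp_assoc, antipode_comp_sInv, LinearMap.comp_id] at h2
    exact h2.symm.trans h1.symm)

/-- The codual as a dual on the other side. -/
@[reducible]
noncomputable def codualPairing (U : FdComod k H) : ExactPairing U (codual hs U) :=
  letI := dualPairing (codual hs U)
  exactPairingCongrLeft (evalIso hs U)

/-- All right duals in the sense of Mathlib. -/
@[reducible]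
noncomputable def hasRightDual (U : FdComod k H) : HasRightDual U where
  rightDual := codual hs U
  exact := codualPairing hs U

end Codual

end FdComod

namespace FdYD

variable {k : Type u} {H : Type v} [Field k] [NonAssocRing H] [Module k H]
  [IsScalarTower k H H] [SMulCommClass k H H] [Coalgebra k H] [DualQuasiHopfAlgebra k H]

/-! ### Yetter-Drinfeld modules as objects of the Drinfeld centre -/

/-- The underlying comodule. -/
def toComod (M : FdYD k H) : FdComod k H where
  carrier := M
  coact := M.coact
  isCoaction := ⟨M.yd.counit_coact, M.yd.coassoc_coact⟩

open FdComod in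
/-- The map `u ⊗ m ↦ u₍₋₁₎ · m ⊗ u₍₀₎` as a morphism of comodules. -/
noncomputable def braidHom (M : FdYD k H) (U : FdComod k H) : U ⊗ M.toComod ⟶ M.toComod ⊗ U :=
  let f : U ⊗[k] M →ₗ[k] M ⊗[k] U := braid U.coact M.act
  have hf := (braid_colinear_iff U.coact M.coact M.act U.isCoaction).2
    fun φ => congrArg (opE U.coact) ((compat_iff M.coact M.act).1 M.yd.compat φ)
  FdComod.Hom.mk (M := U ⊗ M.toComod) (N := M.toComod ⊗ U) f hf

/-- The maps `braidHom` form a lax half-braiding. -/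
noncomputable def laxHalfBraiding (M : FdYD k H) : LaxHalfBraiding M.toComod where
  t := M.braidHom
  naturality f := FdComod.hom_ext (braid_natural (FdComod.Hom.map_coact f) M.act)
  unit := FdComod.hom_ext <| TensorProduct.ext' (M := k) (N := M) fun c m => by
    have h : TensorProduct.comm k k M (c ⊗ₜ[k] M.act 1 m) = (c • m) ⊗ₜ[k] (1 : k) := by
      rw [M.yd.one_act, TensorProduct.comm_tmul, TensorProduct.smul_tmul, smul_eq_mul, mul_one]
    exact h
  tensor U V := by
    have h : (α_ U V M.toComod).inv ≫ M.braidHom (U ⊗ V) ≫ (α_ M.toComod U V).inv =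
        U ◁ M.braidHom V ≫ (α_ U M.toComod V).inv ≫ M.braidHom U ▷ V :=
      FdComod.hom_ext <| LinearMap.ext <|
        (hexagon_iff M.coact M.act U.isCoaction V.isCoaction).2
          (congrArg _ ((act_act_iff M.coact M.act).1 M.yd.act_act))
    rw [Iso.inv_comp_eq, ← Category.assoc, Iso.comp_inv_eq] at h
    simpa only [Category.assoc] using h

end FdYD

namespace FdComod

variable {k : Type u} {H : Type v} [Field k] [NonAssocRing H] [Module k H]
  [IsScalarTower k H H] [SMulCommClass k H H] [Coalgebra k H] [DualQuasiHopfAlgebra k H]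

/-- An action that induces a lax half-braiding satisfies the axioms of a Yetter-Drinfeld module. -/
noncomputable def yetterDrinfeld {X : FdComod k H} (T : LaxHalfBraiding X) (act : H →ₗ[k] X →ₗ[k] X)
    (h : ∀ U : FdComod k H, Hom.lin (T.t U) = braid U.coact act) : YetterDrinfeld k H X where
  coact := X.coact
  act := act
  counit_coact := X.isCoaction.counit
  coassoc_coact := X.isCoaction.coassoc
  act_act := (act_act_iff X.coact act).2 <| eq_of_opE_tens fun U V =>
    (hexagon_iff X.coact act U.isCoaction V.isCoaction).1 <| by
      have h1 : (α_ U V X).inv ≫ T.t (U ⊗ V) ≫ (α_ X U V).inv =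
          U ◁ T.t V ≫ (α_ U X V).inv ≫ T.t U ▷ V := by
        rw [T.tensor]; simp
      have h2 := congrArg Hom.lin h1
      intro t
      have h3 := LinearMap.congr_fun h2 t
      have e1 : Hom.lin (T.t (U ⊗ V)) = braid (diag U.coact V.coact) act := h (U ⊗ V)
      have e2 := h U
      have e3 := h V
      rw [comp_lin, comp_lin, comp_lin, comp_lin, e1, whiskerLeft_lin, whiskerRight_lin, e2,
        e3] at h3
      exact h3
  one_act m := by
    have h1 := LinearMap.congr_fun (congrArg Hom.lin T.unit) ((1 : k) ⊗ₜ[k] m)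
    have h2 := LinearMap.congr_fun (h (𝟙_ _)) ((1 : k) ⊗ₜ[k] m)
    have h3 : act 1 m ⊗ₜ[k] (1 : k) = ((1 : k) • m) ⊗ₜ[k] (1 : k) := h2.symm.trans h1
    have := congrArg (TensorProduct.rid k X) h3
    simpa using this
  compat := (compat_iff X.coact act).2 fun φ => eq_of_opE fun U =>
    (braid_colinear_iff U.coact X.coact act U.isCoaction).1 (by
      have := Hom.map_coact (T.t U)
      rw [h U] at this
      exact this) φ

end FdComod

/-! ### The action on a tensor product -/

namespace Coaction
section General
variable {k : Type*} [Field k]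
variable {D E U V W M N P : Type*}
  [AddCommGroup D] [Module k D] [AddCommGroup E] [Module k E]
  [AddCommGroup U] [Module k U] [AddCommGroup V] [Module k V] [AddCommGroup W] [Module k W]
  [AddCommGroup M] [Module k M] [AddCommGroup N] [Module k N] [AddCommGroup P] [Module k P]

theorem rTensor_braid_eq (δ : U →ₗ[k] D ⊗[k] U) (Φ : D →ₗ[k] M →ₗ[k] N) (f : N →ₗ[k] P) :
    f.rTensor U ∘ₗ braid δ Φ = braid δ (Φ.compr₂ f) := by
  ext u m
  simp only [TensorProduct.AlgebraTensorModule.curry_apply, LinearMap.restrictScalars_self,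
    TensorProduct.curry_apply, LinearMap.comp_apply, braid, opE_tmul, LinearEquiv.coe_coe]
  induction δ u using TensorProduct.induction_on with
  | zero => simp
  | add x y hx hy => simp only [map_add, hx, hy, LinearMap.add_apply]
  | tmul d u => simp

theorem braid_comp_lTensor (δ : U →ₗ[k] D ⊗[k] U) (Φ : D →ₗ[k] N →ₗ[k] P) (f : M →ₗ[k] N) :
    braid δ Φ ∘ₗ f.lTensor U = braid δ (Φ.compl₂ f) := by
  ext u m
  simp only [TensorProduct.AlgebraTensorModule.curry_apply, LinearMap.restrictScalars_self,
    TensorProduct.curry_apply, LinearMap.comp_apply, braid, opE_tmul, LinearEquiv.coe_coe,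
    LinearMap.lTensor_tmul]
  induction δ u using TensorProduct.induction_on with
  | zero => simp
  | add x y hx hy => simp only [map_add, hx, hy, LinearMap.add_apply]
  | tmul d u => simp

theorem isSemicolinear_leftComm {F : Type*} [AddCommGroup F] [Module k F]
    (δ₁ : U →ₗ[k] D ⊗[k] U) (δ₂ : V →ₗ[k] E ⊗[k] V)
    (δ₃ : W →ₗ[k] F ⊗[k] W) : IsSemicolinear (tens δ₁ (tens δ₂ δ₃)) (tens δ₂ (tens δ₁ δ₃))
      (TensorProduct.leftComm k D E F).toLinearMap
      (TensorProduct.leftComm k U V W).toLinearMap := by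
  suffices h : tens δ₂ (tens δ₁ δ₃) ∘ₗ (TensorProduct.leftComm k U V W).toLinearMap =
      TensorProduct.map (TensorProduct.leftComm k D E F).toLinearMap
      (TensorProduct.leftComm k U V W).toLinearMap ∘ₗ (tens δ₁ (tens δ₂ δ₃)) from
    LinearMap.congr_fun h
  ext u v w
  simp only [TensorProduct.AlgebraTensorModule.curry_apply, LinearMap.restrictScalars_self,
    TensorProduct.curry_apply, LinearMap.comp_apply, LinearEquiv.coe_coe,
    TensorProduct.leftComm_tmul, tens_tmul]
  induction δ₁ u using TensorProduct.induction_on with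
  | zero => simp
  | add x y hx hy => simp only [TensorProduct.add_tmul, TensorProduct.tmul_add, map_add, hx, hy]
  | tmul d u =>
    induction δ₂ v using TensorProduct.induction_on with
    | zero => simp
    | add x y hx hy => simp only [TensorProduct.add_tmul, TensorProduct.tmul_add, map_add, hx, hy]
    | tmul e v =>
      induction δ₃ w using TensorProduct.induction_on with
      | zero => simp
      | add x y hx hy => simp only [TensorProduct.tmul_add, map_add, hx, hy]
      | tmul e v => simp

theorem op_tens_tmul (δ₁ : U →ₗ[k] D ⊗[k] U) (δ₂ : V →ₗ[k] E ⊗[k] V) (ψ : D ⊗[k] E →ₗ[k] k)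
    (x : U) (y : V) : op (tens δ₁ δ₂) ψ (x ⊗ₜ[k] y) =
      sweedler (δ₁ x) fun a x₀ => x₀ ⊗ₜ[k] op δ₂ (TensorProduct.curry ψ a) y := by
  rw [op_tens, opE_tmul]
  exact (sweedler_eq (δ₁ x) ((LinearMap.flip (evalE (op δ₂ ∘ₗ TensorProduct.curry ψ))) y) _
    fun a b => rfl).symm

theorem op_tens_tmul' (δ₁ : U →ₗ[k] D ⊗[k] U) (δ₂ : V →ₗ[k] E ⊗[k] V) (ψ : D ⊗[k] E →ₗ[k] k)
    (x : U) (y : V) : op (tens δ₁ δ₂) ψ (x ⊗ₜ[k] y) =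
      sweedler (δ₁ x) fun a x₀ => sweedler (δ₂ y) fun b y₀ => ψ (a ⊗ₜ[k] b) • (x₀ ⊗ₜ[k] y₀) := by
  rw [op_tens_tmul]
  refine congrArg (sweedler (δ₁ x)) (funext fun a => funext fun x₀ => ?_)
  rw [op_eq_sweedler]
  simp [sweedler, TensorProduct.tmul_sum]

theorem sweedler_cop2 [Coalgebra k D] {δ : M →ₗ[k] D ⊗[k] M} (hδ : IsCoaction δ)
    (K : D ⊗[k] (D ⊗[k] M) →ₗ[k] P) (F : D → D → M → P)
    (hF : ∀ a b x, F a b x = K (a ⊗ₜ[k] (b ⊗ₜ[k] x))) (m : M) :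
    (sweedler (δ m) fun a x => cop2 k a fun a₁ a₂ => F a₁ a₂ x) =
      sweedler (δ m) fun a x => sweedler (δ x) fun b y => F a b y := by
  rw [sweedler_eq (δ m) (K ∘ₗ δ.lTensor D) (fun a x => sweedler (δ x) fun b y => F a b y) ?_,
    LinearMap.comp_apply, ← hδ.coassoc]
  · refine sweedler_eq (δ m)
      (K ∘ₗ (TensorProduct.assoc k D D M).toLinearMap ∘ₗ comul.rTensor M) _ ?_
    intro a x
    refine cop2_eq a (K ∘ₗ (TensorProduct.assoc k D D M).toLinearMap ∘ₗ
      (TensorProduct.mk k _ _).flip x) _ fun b c => ?_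
    exact hF b c x
  · intro a x
    exact sweedler_eq (δ x) (K ∘ₗ TensorProduct.mk k _ _ a) _ fun b y => hF a b y

end General

section Quasi
variable {k : Type*} {H : Type*} [Field k] [NonAssocRing H] [Module k H]
  [IsScalarTower k H H] [SMulCommClass k H H] [Coalgebra k H] [DualQuasiHopfAlgebra k H]
variable {U M N : Type*}
  [AddCommGroup U] [Module k U] [AddCommGroup M] [Module k M] [AddCommGroup N] [Module k N]
variable {δU : U →ₗ[k] H ⊗[k] U} {δM : M →ₗ[k] H ⊗[k] M} {δN : N →ₗ[k] H ⊗[k] N}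
variable (δM δN) (actM : H →ₗ[k] M →ₗ[k] M) (actN : H →ₗ[k] N →ₗ[k] N)

/-- `h ↦ (m ⊗ n ↦ σ(h, m₍₋₁₎, n₍₋₁₎) m₍₀₎ ⊗ n₍₀₎)` -/
noncomputable def opσ₁ : H →ₗ[k] M ⊗[k] N →ₗ[k] M ⊗[k] N :=
  op (tens δM δN) ∘ₗ TensorProduct.curry (tri σ)

/-- `h ↦ (m ⊗ n ↦ σ⁻¹(m₍₋₁₎, h, n₍₋₁₎) m₍₀₎ ⊗ n₍₀₎)` -/
noncomputable def opσinv₂ : H →ₗ[k] M ⊗[k] N →ₗ[k] M ⊗[k] N :=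
  op (tens δM δN) ∘ₗ TensorProduct.curry (tri σinv ∘ₗ (TensorProduct.leftComm k H H H).toLinearMap)

/-- `h ↦ (m ⊗ n ↦ σ(m₍₋₁₎, n₍₋₁₎, h) m₍₀₎ ⊗ n₍₀₎)` -/
noncomputable def opσ₃ : H →ₗ[k] M ⊗[k] N →ₗ[k] M ⊗[k] N :=
  op (tens δM δN) ∘ₗ TensorProduct.curry (tri σ ∘ₗ (TensorProduct.assoc k H H H).toLinearMap ∘ₗ
    (TensorProduct.comm k H (H ⊗[k] H)).toLinearMap)

/-- The action on a tensor product. -/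
noncomputable def tensorAct : H →ₗ[k] M ⊗[k] N →ₗ[k] M ⊗[k] N :=
  cmp (cmp (opσ₁ δM δN) (LinearMap.rTensorHom N ∘ₗ actM))
    (cmp (cmp (opσinv₂ δM δN) (LinearMap.lTensorHom M ∘ₗ actN)) (opσ₃ δM δN))

theorem cmp_five {D : Type*} [AddCommGroup D] [Module k D] [Coalgebra k D]
    (Φ₁ Φ₂ Φ₃ Φ₄ Φ₅ : D →ₗ[k] M →ₗ[k] M) (d : D) (m : M) :
    cmp (cmp Φ₁ Φ₂) (cmp (cmp Φ₃ Φ₄) Φ₅) d m = cop5 k d fun d₁ d₂ d₃ d₄ d₅ =>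
      Φ₅ d₅ (Φ₄ d₄ (Φ₃ d₃ (Φ₂ d₂ (Φ₁ d₁ m)))) := by
  rw [cmp_cmp_apply_sweedler]
  refine congrArg (cop3 k d) (funext fun d₁ => funext fun d₂ => funext fun d' => ?_)
  rw [cmp_cmp_apply_sweedler]

theorem rTensor_braid_assoc (t : U ⊗[k] (M ⊗[k] N)) :
    (braid δU actM).rTensor N ((TensorProduct.assoc k U M N).symm t) =
      (TensorProduct.assoc k M U N).symm (TensorProduct.leftComm k U M N
        (opE δU (LinearMap.rTensorHom N ∘ₗ actM) t)) := by
  suffices h : (braid δU actM).rTensor N ∘ₗ (TensorProduct.assoc k U M N).symm.toLinearMap =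
      (TensorProduct.assoc k M U N).symm.toLinearMap ∘ₗ
        (TensorProduct.leftComm k U M N).toLinearMap ∘ₗ
          opE δU (LinearMap.rTensorHom N ∘ₗ actM) from LinearMap.congr_fun h t
  ext u m n
  simp only [TensorProduct.AlgebraTensorModule.curry_apply, LinearMap.restrictScalars_self,
    TensorProduct.curry_apply, LinearMap.comp_apply, braid, opE_tmul, LinearEquiv.coe_coe,
    LinearMap.rTensor_tmul, TensorProduct.assoc_symm_tmul]
  induction δU u using TensorProduct.induction_on with
  | zero => simp
  | add x y hx hy => simp only [map_add, LinearMap.add_apply, TensorProduct.add_tmul, hx, hy]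
  | tmul d u => simp

theorem lTensor_braid_leftComm (t : U ⊗[k] (M ⊗[k] N)) :
    (braid δU actN).lTensor M (TensorProduct.leftComm k U M N t) =
      TensorProduct.assoc k M N U (TensorProduct.comm k U _
        (opE δU (LinearMap.lTensorHom M ∘ₗ actN) t)) := by
  suffices h : (braid δU actN).lTensor M ∘ₗ (TensorProduct.leftComm k U M N).toLinearMap =
      (TensorProduct.assoc k M N U).toLinearMap ∘ₗ
        (TensorProduct.comm k U _).toLinearMap ∘ₗ
          opE δU (LinearMap.lTensorHom M ∘ₗ actN) from LinearMap.congr_fun h t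
  ext u m n
  simp only [TensorProduct.AlgebraTensorModule.curry_apply, LinearMap.restrictScalars_self,
    TensorProduct.curry_apply, LinearMap.comp_apply, braid, opE_tmul, LinearEquiv.coe_coe,
    LinearMap.lTensor_tmul, TensorProduct.leftComm_tmul]
  induction δU u using TensorProduct.induction_on with
  | zero => simp
  | add x y hx hy => simp only [map_add, LinearMap.add_apply, TensorProduct.tmul_add, hx, hy]
  | tmul d u => simp

/-- The half-braiding of a tensor product is given by `tensorAct`. -/
theorem braid_tensorAct (hU : IsCoaction δU) (t : U ⊗[k] (M ⊗[k] N)) :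
    assocLinv δM δN δU ((braid δU actN).lTensor M (assocL δM δU δN
      ((braid δU actM).rTensor N (assocLinv δU δM δN t)))) =
      braid δU (tensorAct δM δN actM actN) t := by
  have h1 : ∀ t, assocLinv δU δM δN t = (TensorProduct.assoc k U M N).symm
      (opE δU (opσ₁ δM δN) t) := fun t => by
    rw [assocLinv, LinearMap.comp_apply, op_tens]
    rfl
  have h3 : ∀ t, assocL δM δU δN ((TensorProduct.assoc k M U N).symm
      (TensorProduct.leftComm k U M N t)) =
      TensorProduct.leftComm k U M N (opE δU (opσinv₂ δM δN) t) := fun t => by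
    have := (isSemicolinear_leftComm δU δM δN).op (tri σinv) t
    rw [op_tens δU] at this
    rw [assocL, LinearMap.comp_apply, LinearEquiv.coe_coe, LinearEquiv.apply_symm_apply]
    exact this
  have h5 : ∀ t, assocLinv δM δN δU (TensorProduct.assoc k M N U (TensorProduct.comm k U _ t)) =
      TensorProduct.comm k U _ (opE δU (opσ₃ δM δN) t) := fun t => by
    have hsc : IsSemicolinear (tens (tens δM δN) δU) (tens δM (tens δN δU)) _ _ :=
      (isSemicolinear_assoc_symm δM δN δU).symm
    have := (hsc.comp (isSemicolinear_comm δU (tens δM δN))).op (tri σ) t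
    rw [op_tens δU] at this
    rw [assocLinv, LinearMap.comp_apply, LinearEquiv.coe_coe, LinearEquiv.symm_apply_eq]
    exact this
  rw [h1, rTensor_braid_assoc, h3, lTensor_braid_leftComm, h5, braid, tensorAct, ← opE_opE hU,
    ← opE_opE hU, ← opE_opE hU, ← opE_opE hU]
  rfl

variable {δM δN}

theorem tensorAct_tmul (hM : IsCoaction δM) (hN : IsCoaction δN) (h : H) (m : M) (n : N) :
    tensorAct δM δN actM actN h (m ⊗ₜ[k] n) = cop5 k h fun h₁ h₂ h₃ h₄ h₅ =>
      sweedler (δM m) fun m₁ m₀ =>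
      sweedler (δN n) fun n' n₀ => cop2 k n' fun n₁ n₂ =>
      sweedler (δM (actM h₂ m₀)) fun p' p₀ => cop2 k p' fun p₁ p₂ =>
      sweedler (δN (actN h₄ n₀)) fun q₁ q₀ =>
        (σ h₁ m₁ n₁ * σinv p₁ h₃ n₂ * σ p₂ q₁ h₅ : k) • (p₀ ⊗ₜ[k] q₀) := by
  rw [tensorAct, cmp_five]
  refine congrArg (cop5 k h) (funext fun h₁ => funext fun h₂ => funext fun h₃ => funext fun h₄ =>
    funext fun h₅ => ?_)
  let τ : H →ₗ[k] H →ₗ[k] k := TensorProduct.curry (TensorProduct.curry (tri σ ∘ₗ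
    (TensorProduct.assoc k H H H).toLinearMap ∘ₗ
      (TensorProduct.comm k H (H ⊗[k] H)).toLinearMap) h₅)
  have hτ : ∀ p q, σ (k := k) p q h₅ = τ p q := fun _ _ => rfl
  simp only [hτ]
  -- the innermost two Sweedler sums assemble to the last operator
  have e1 : ∀ (m₁ : H) (m₀ : M) (n₁ n₂ : H) (n₀ : N), (sweedler (δM (actM h₂ m₀)) fun p' p₀ =>
      cop2 k p' fun p₁ p₂ => sweedler (δN (actN h₄ n₀)) fun q₁ q₀ =>
        (σ h₁ m₁ n₁ * σinv p₁ h₃ n₂ * τ p₂ q₁ : k) • (p₀ ⊗ₜ[k] q₀)) =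
      σ (k := k) h₁ m₁ n₁ • sweedler (δM (actM h₂ m₀)) fun p₁ x => σinv (k := k) p₁ h₃ n₂ •
        opσ₃ δM δN h₅ (x ⊗ₜ[k] actN h₄ n₀) := by
    intro m₁ m₀ n₁ n₂ n₀
    have e : ∀ (p₁ p₂ : H) (p₀ : M), (sweedler (δN (actN h₄ n₀)) fun q₁ q₀ =>
        (σ h₁ m₁ n₁ * σinv p₁ h₃ n₂ * τ p₂ q₁ : k) • (p₀ ⊗ₜ[k] q₀)) =
        (σ (k := k) h₁ m₁ n₁ * σinv p₁ h₃ n₂) • (p₀ ⊗ₜ[k] op δN (τ p₂) (actN h₄ n₀)) := by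
      intro p₁ p₂ p₀
      rw [op_eq_sweedler]
      simp [sweedler, TensorProduct.tmul_sum, Finset.smul_sum, mul_smul]
    simp only [e]
    let K : H ⊗[k] (H ⊗[k] M) →ₗ[k] M ⊗[k] N := TensorProduct.lift
      (LinearMap.smulRight ((LinearMap.flip (LinearMap.flip (σinv (k := k)) h₃)) n₂)
        ((σ (k := k) h₁ m₁ n₁) • TensorProduct.lift (LinearMap.mk₂ k (fun p₂ p₀ =>
          p₀ ⊗ₜ[k] op δN (τ p₂) (actN h₄ n₀))
          (by intros; simp [TensorProduct.tmul_add]) (by intros; simp)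
          (by intros; simp [TensorProduct.add_tmul]) (by intros; simp [TensorProduct.smul_tmul']))))
    rw [sweedler_cop2 hM K _ (fun a b x => by rw [mul_comm, mul_smul]; rfl)]
    have e5 : ∀ x, (sweedler (δM x) fun p₂ p₀ => p₀ ⊗ₜ[k] op δN (τ p₂) (actN h₄ n₀)) =
        opσ₃ δM δN h₅ (x ⊗ₜ[k] actN h₄ n₀) := fun x =>
      (op_tens_tmul δM δN _ x _).symm
    simp only [← e5]
    simp only [sweedler, Finset.smul_sum, mul_smul]
  simp only [e1]
  have e2 : ∀ (m₁ : H) (m₀ : M), (sweedler (δN n) fun n' n₀ => cop2 k n' fun n₁ n₂ =>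
      σ (k := k) h₁ m₁ n₁ • sweedler (δM (actM h₂ m₀)) fun p₁ x => σinv (k := k) p₁ h₃ n₂ •
        opσ₃ δM δN h₅ (x ⊗ₜ[k] actN h₄ n₀)) =
      sweedler (δN n) fun n₁ x => σ (k := k) h₁ m₁ n₁ •
        opσ₃ δM δN h₅ ((actN h₄).lTensor M (opσinv₂ δM δN h₃ (actM h₂ m₀ ⊗ₜ[k] x))) := by
    intro m₁ m₀
    let K : H ⊗[k] (H ⊗[k] N) →ₗ[k] M ⊗[k] N := TensorProduct.lift
      (LinearMap.smulRight (σ (k := k) h₁ m₁)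
        (TensorProduct.lift (LinearMap.mk₂ k (fun n₂ n₀ =>
          sweedler (δM (actM h₂ m₀)) fun p₁ x => σinv (k := k) p₁ h₃ n₂ •
        opσ₃ δM δN h₅ (x ⊗ₜ[k] actN h₄ n₀))
          (by intros; simp [sweedler, add_smul, Finset.sum_add_distrib])
          (by intros; simp [sweedler, mul_smul, Finset.smul_sum])
          (by intros; simp [sweedler, TensorProduct.tmul_add, Finset.sum_add_distrib])
          (by intros; simp [sweedler, Finset.smul_sum, smul_smul, mul_comm]))))
    refine (sweedler_cop2 hN K _ (by intro a b x; rfl) n).trans ?_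
    refine congrArg (sweedler (δN n)) (funext fun n₁ => funext fun x => ?_)
    have e6 : opσinv₂ δM δN h₃ (actM h₂ m₀ ⊗ₜ[k] x) = sweedler (δM (actM h₂ m₀)) fun p₁ y =>
        sweedler (δN x) fun n₂ n₀ => σinv (k := k) p₁ h₃ n₂ • (y ⊗ₜ[k] n₀) :=
      op_tens_tmul' δM δN _ _ _
    rw [e6]
    simp only [sweedler, map_sum, map_smul, Finset.smul_sum, LinearMap.lTensor_tmul]
    exact Finset.sum_comm
  simp only [e2]
  have e7 : opσ₁ δM δN h₁ (m ⊗ₜ[k] n) = sweedler (δM m) fun m₁ m₀ =>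
      sweedler (δN n) fun n₁ x => σ (k := k) h₁ m₁ n₁ • (m₀ ⊗ₜ[k] x) :=
    op_tens_tmul' δM δN _ _ _
  rw [e7]
  simp [sweedler]

end Quasi
end Coaction

/-! ### The braided monoidal category of Yetter-Drinfeld modules -/

namespace CategoryTheory
variable {C : Type*} [Category C] [MonoidalCategory C]

theorem whisker_comm_iff_inv {X Y U : C} (e : X ⊗ U ≅ U ⊗ X) (e' : Y ⊗ U ≅ U ⊗ Y) (f : X ⟶ Y) :
    f ▷ U ≫ e'.hom = e.hom ≫ U ◁ f ↔ e.inv ≫ f ▷ U = U ◁ f ≫ e'.inv := by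
  rw [Iso.inv_comp_eq, ← Category.assoc, Iso.eq_comp_inv]

theorem whisker_comm_id {X U : C} (e e' : X ⊗ U ≅ U ⊗ X) (h : e.inv = e'.inv) :
    𝟙 X ▷ U ≫ e'.hom = e.hom ≫ U ◁ 𝟙 X := by
  rw [whisker_comm_iff_inv, h]
  simp

end CategoryTheory

namespace FdYD

variable {k : Type u} {H : Type v} [Field k] [NonAssocRing H] [Module k H]
  [IsScalarTower k H H] [SMulCommClass k H H] [Coalgebra k H] [DualQuasiHopfAlgebra k H]

/-- The Yetter-Drinfeld module given by an object of the centre whose half-braiding comes from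
an action. -/
noncomputable def ofCenter (X : Center (FdComod k H)) (act : H →ₗ[k] X.1 →ₗ[k] X.1)
    (h : ∀ U : FdComod k H, FdComod.Hom.lin (X.2.β U).inv = braid U.coact act) : FdYD k H where
  carrier := X.1
  yd := FdComod.yetterDrinfeld X.2.toLax act h

variable [∀ U : FdComod k H, HasRightDual U]

/-- A Yetter-Drinfeld module as an object of the Drinfeld centre. -/
noncomputable def centerObj (M : FdYD k H) : Center (FdComod k H) :=
  ⟨M.toComod, M.laxHalfBraiding.halfBraiding⟩

/-- For comodule maps, linearity over `H` is compatibility with the half-braidings. -/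
theorem comm_iff_map_act {M N : FdYD k H} (f : M.toComod ⟶ N.toComod) :
    (∀ U, f ▷ U ≫ (N.centerObj.2.β U).hom = (M.centerObj.2.β U).hom ≫ U ◁ f) ↔
      ∀ h m, FdComod.Hom.lin f (M.act h m) = N.act h (FdComod.Hom.lin f m) := by
  let f' : M →ₗ[k] N := FdComod.Hom.lin f
  have key : ∀ U, f ▷ U ≫ (N.centerObj.2.β U).hom = (M.centerObj.2.β U).hom ≫ U ◁ f ↔
      braid U.coact (M.act.compr₂ f') = braid U.coact (N.act.compl₂ f') := by
    intro U
    have e1 : FdComod.Hom.lin (M.braidHom U ≫ f ▷ U) = braid U.coact (M.act.compr₂ f') :=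
      rTensor_braid_eq U.coact M.act f'
    have e2 : FdComod.Hom.lin (U ◁ f ≫ N.braidHom U) = braid U.coact (N.act.compl₂ f') :=
      braid_comp_lTensor U.coact N.act f'
    refine (whisker_comm_iff_inv (M.laxHalfBraiding.iso U) (N.laxHalfBraiding.iso U) f).trans
      ⟨fun h => ?_, fun h => FdComod.hom_ext ?_⟩
    · exact e1.symm.trans ((congrArg FdComod.Hom.lin h).trans e2)
    · exact e1.trans (h.trans e2.symm)
  refine (forall_congr' key).trans ⟨fun h a m => ?_, fun h U => ?_⟩
  · exact LinearMap.congr_fun (LinearMap.congr_fun (FdComod.eq_of_braid h) a) m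
  · exact congrArg (braid U.coact) (LinearMap.ext fun a => LinearMap.ext fun m => h a m)

variable (k H) in
/-- Yetter-Drinfeld modules form a full subcategory of the Drinfeld centre of comodules. -/
noncomputable def toCenter : FdYD k H ⥤ Center (FdComod k H) where
  obj := centerObj
  map {M N} f :=
    { f := FdComod.Hom.mk (M := M.toComod) (N := N.toComod) (Hom.lin f) (Hom.map_coact f)
      comm := (comm_iff_map_act (M := M) (N := N) (FdComod.Hom.mk (M := M.toComod)
        (N := N.toComod) (Hom.lin f) (Hom.map_coact f))).2 (Hom.map_act f) }

theorem toCenter_map_lin {M N : FdYD k H} (f : M ⟶ N) :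
    FdComod.Hom.lin ((toCenter k H).map f).f = Hom.lin f := rfl

instance : (toCenter k H).Faithful where
  map_injective h := Hom.ext (congrArg (fun g => FdComod.Hom.lin (Center.Hom.f g)) h)

instance : (toCenter k H).Full where
  map_surjective {M N} g := ⟨Hom.mk (M := M) (N := N) (FdComod.Hom.lin g.f)
    (FdComod.Hom.map_coact g.f) ((comm_iff_map_act (M := M) (N := N) g.f).1 g.comm), rfl⟩

theorem preimage_lin {M N : FdYD k H} (g : (toCenter k H).obj M ⟶ (toCenter k H).obj N) :
    Hom.lin ((toCenter k H).preimage g) = FdComod.Hom.lin g.f := by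
  rw [← toCenter_map_lin, Functor.map_preimage]

/-- The identity map as an isomorphism in the centre. -/
noncomputable def ofCenterIso (X : Center (FdComod k H)) (act : H →ₗ[k] X.1 →ₗ[k] X.1)
    (h : ∀ U : FdComod k H, FdComod.Hom.lin (X.2.β U).inv = braid U.coact act) :
    X ≅ (toCenter k H).obj (ofCenter X act h) where
  hom := ⟨𝟙 X.1, fun U => whisker_comm_id (X.2.β U) ((ofCenter X act h).laxHalfBraiding.iso U)
    (FdComod.hom_ext (h U))⟩
  inv := ⟨𝟙 X.1, fun U => whisker_comm_id ((ofCenter X act h).laxHalfBraiding.iso U) (X.2.β U)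
    (FdComod.hom_ext (h U).symm)⟩
  hom_inv_id := Center.ext _ _ (Category.comp_id _)
  inv_hom_id := Center.ext _ _ (Category.comp_id _)

theorem center_tensor_inv (M N : FdYD k H) (U : FdComod k H) :
    FdComod.Hom.lin (((toCenter k H).obj M ⊗ (toCenter k H).obj N).2.β U).inv =
      braid U.coact (tensorAct M.coact N.coact M.act N.act) :=
  LinearMap.ext fun t => braid_tensorAct (δM := M.coact) (δN := N.coact) M.act N.act
    U.isCoaction t

theorem center_unit_inv (U : FdComod k H) :
    FdComod.Hom.lin ((𝟙_ (Center (FdComod k H))).2.β U).inv =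
      braid U.coact ((counit (R := k) (A := H)).smulRight (LinearMap.id (R := k) (M := k))) := by
  rw [braid, opE_counit U.isCoaction, LinearMap.lTensor_id, LinearMap.comp_id]
  refine TensorProduct.ext' (M := U) (N := k) fun x c => ?_
  have h : (TensorProduct.lid k U).symm (c • x) = c ⊗ₜ[k] x := by
    rw [LinearEquiv.symm_apply_eq, TensorProduct.lid_tmul]
  exact h

/-- The tensor product of Yetter-Drinfeld modules. -/
noncomputable def tensor (M N : FdYD k H) : FdYD k H :=
  ofCenter ((toCenter k H).obj M ⊗ (toCenter k H).obj N) (tensorAct M.coact N.coact M.act N.act)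
    (center_tensor_inv M N)

variable (k H) in
/-- The trivial Yetter-Drinfeld module. -/
noncomputable def unit : FdYD k H :=
  ofCenter (𝟙_ _) ((counit (R := k) (A := H)).smulRight (LinearMap.id (R := k) (M := k)))
    center_unit_inv

/-- The monoidal constraint of `toCenter`. -/
noncomputable def tensorIso (M N : FdYD k H) :
    (toCenter k H).obj M ⊗ (toCenter k H).obj N ≅ (toCenter k H).obj (tensor M N) :=
  ofCenterIso _ _ (center_tensor_inv M N)

variable (k H) in
/-- The unit constraint of `toCenter`. -/
noncomputable def unitIso : 𝟙_ (Center (FdComod k H)) ≅ (toCenter k H).obj (unit k H) :=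
  ofCenterIso _ _ center_unit_inv

noncomputable instance : MonoidalCategoryStruct (FdYD k H) where
  tensorObj := tensor
  tensorUnit := unit k H
  whiskerLeft M _ _ f := (toCenter k H).preimage
    ((tensorIso _ _).inv ≫ ((toCenter k H).obj M ◁ (toCenter k H).map f) ≫ (tensorIso _ _).hom)
  whiskerRight f N := (toCenter k H).preimage
    ((tensorIso _ _).inv ≫ ((toCenter k H).map f ▷ (toCenter k H).obj N) ≫ (tensorIso _ _).hom)
  tensorHom f g := (toCenter k H).preimage
    ((tensorIso _ _).inv ≫ ((toCenter k H).map f ⊗ₘ (toCenter k H).map g) ≫ (tensorIso _ _).hom)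
  associator X Y Z := (toCenter k H).preimageIso
    (((tensorIso _ _).symm ≪≫ ((tensorIso _ _).symm ⊗ᵢ .refl _))
        ≪≫ α_ ((toCenter k H).obj X) ((toCenter k H).obj Y) ((toCenter k H).obj Z)
        ≪≫ ((.refl _ ⊗ᵢ tensorIso _ _) ≪≫ tensorIso _ _))
  leftUnitor X := (toCenter k H).preimageIso
    (((tensorIso _ _).symm ≪≫ ((unitIso k H).symm ⊗ᵢ .refl _)) ≪≫ λ_ ((toCenter k H).obj X))
  rightUnitor X := (toCenter k H).preimageIso
    (((tensorIso _ _).symm ≪≫ (.refl _ ⊗ᵢ (unitIso k H).symm)) ≪≫ ρ_ ((toCenter k H).obj X))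

variable (k H) in
/-- The monoidal structure is induced along `toCenter`. -/
noncomputable def inducingData : Monoidal.InducingFunctorData (toCenter k H) where
  μIso := tensorIso
  εIso := unitIso k H
  whiskerLeft_eq _ _ _ _ := Functor.map_preimage _ _
  whiskerRight_eq _ _ := Functor.map_preimage _ _
  tensorHom_eq _ _ := Functor.map_preimage _ _
  associator_eq _ _ _ := Functor.map_preimage _ _
  leftUnitor_eq _ := Functor.map_preimage _ _
  rightUnitor_eq _ := Functor.map_preimage _ _

noncomputable instance : MonoidalCategory (FdYD k H) :=
  Monoidal.induced (toCenter k H) (inducingData k H)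

noncomputable instance : (toCenter k H).Monoidal :=
  Monoidal.fromInducedMonoidal (toCenter k H) (inducingData k H)

/-- The braiding is the inverse of the one of the centre. -/
noncomputable instance : BraidedCategory (FdYD k H) :=
  @reverseBraiding (FdYD k H) _ _ (BraidedCategory.ofFullyFaithful (toCenter k H))

theorem tensor_coact (M N : FdYD k H) (m : M) (n : N) :
    diag M.coact N.coact (m ⊗ₜ[k] n) =
      sweedler (M.coact m) fun m₁ m₀ => sweedler (N.coact n) fun n₁ n₀ =>
        (m₁ * n₁) ⊗ₜ[k] (m₀ ⊗ₜ[k] n₀) := by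
  rw [diag, push, LinearMap.comp_apply, tens_tmul]
  conv_lhs => rw [(TensorProduct.exists_finset (M.coact m)).choose_spec,
    (TensorProduct.exists_finset (N.coact n)).choose_spec]
  simp only [sweedler, TensorProduct.sum_tmul, TensorProduct.tmul_sum, map_sum,
    TensorProduct.tensorTensorTensorComm_tmul, LinearMap.rTensor_tmul, LinearMap.mul'_apply]
  exact Finset.sum_comm

theorem assocL_tmul (M N P : FdYD k H) (m : M) (n : N) (p : P) :
    assocL M.coact N.coact P.coact ((m ⊗ₜ[k] n) ⊗ₜ[k] p) =
      sweedler (M.coact m) fun m₁ m₀ => sweedler (N.coact n) fun n₁ n₀ =>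
      sweedler (P.coact p) fun p₁ p₀ =>
        (σinv m₁ n₁ p₁ : k) • (m₀ ⊗ₜ[k] (n₀ ⊗ₜ[k] p₀)) := by
  rw [assocL, LinearMap.comp_apply, LinearEquiv.coe_coe, TensorProduct.assoc_tmul, op_tens_tmul]
  refine congrArg (sweedler (M.coact m)) (funext fun m₁ => funext fun m₀ => ?_)
  rw [op_tens_tmul']
  simp [sweedler, TensorProduct.tmul_sum]

theorem associator_lin (M N P : FdYD k H) :
    Hom.lin (α_ M N P).hom = assocL M.coact N.coact P.coact := by
  refine (preimage_lin _).trans (LinearMap.ext fun t => ?_)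
  change TensorProduct.map LinearMap.id LinearMap.id (assocL M.coact N.coact P.coact
    (TensorProduct.map LinearMap.id LinearMap.id t)) = _
  rw [TensorProduct.map_id, TensorProduct.map_id]
  rfl

theorem tensorHom_lin {M M' N N' : FdYD k H} (f : M ⟶ M') (g : N ⟶ N') :
    Hom.lin (f ⊗ₘ g) = TensorProduct.map (Hom.lin f) (Hom.lin g) :=
  preimage_lin _

theorem leftUnitor_lin (M : FdYD k H) :
    Hom.lin (λ_ M).hom = (TensorProduct.lid k M).toLinearMap := by
  refine (preimage_lin _).trans (LinearMap.ext fun t => ?_)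
  change TensorProduct.lid k M (TensorProduct.map LinearMap.id LinearMap.id t) = _
  rw [TensorProduct.map_id]
  rfl

theorem rightUnitor_lin (M : FdYD k H) :
    Hom.lin (ρ_ M).hom = (TensorProduct.rid k M).toLinearMap := by
  refine (preimage_lin _).trans (LinearMap.ext fun t => ?_)
  change TensorProduct.rid k M (TensorProduct.map LinearMap.id LinearMap.id t) = _
  rw [TensorProduct.map_id]
  rfl

variable (k H) in
/-- The monoidal structure is the standard one. -/
noncomputable def standardTensor : StandardTensor (k := k) (H := H) where
  μ M N := LinearEquiv.refl k (M ⊗[k] N)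
  η := LinearEquiv.refl k k
  coact_tensor := tensor_coact
  act_tensor M N h m n := tensorAct_tmul M.act N.act M.toComod.isCoaction N.toComod.isCoaction h m n
  coact_unit _ := rfl
  act_unit _ _ := rfl
  tensorHom_lin f g m n := LinearMap.congr_fun (tensorHom_lin f g) (m ⊗ₜ[k] n)
  associator_lin M N P m n p := (LinearMap.congr_fun (associator_lin M N P) _).trans
    (assocL_tmul M N P m n p)
  leftUnitor_lin M c m := LinearMap.congr_fun (leftUnitor_lin M) (c ⊗ₜ[k] m)
  rightUnitor_lin M m c := LinearMap.congr_fun (rightUnitor_lin M) (m ⊗ₜ[k] c)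

theorem toCenter_μIso (M N : FdYD k H) :
    Functor.Monoidal.μIso (toCenter k H) M N = tensorIso M N :=
  Iso.ext rfl

theorem braiding_lin (N M : FdYD k H) : Hom.lin (β_ N M).hom = braid N.coact M.act := by
  have h := preimage_lin (M := N ⊗ M) (N := M ⊗ N)
    ((Functor.Monoidal.μIso (toCenter k H) M N).symm ≪≫ β_ ((toCenter k H).obj M)
      ((toCenter k H).obj N) ≪≫ Functor.Monoidal.μIso (toCenter k H) N M).inv
  rw [toCenter_μIso, toCenter_μIso] at h
  refine h.trans ?_
  exact congrArg FdComod.Hom.lin (congrArg (fun g => ((tensorIso N M).inv.f ≫ g) ≫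
    (tensorIso M N).hom.f) (Center.braiding_inv_f ((toCenter k H).obj M) ((toCenter k H).obj N)))

theorem braiding_tmul (N M : FdYD k H) (n : N) (m : M) :
    braid N.coact M.act (n ⊗ₜ[k] m) =
      sweedler (N.coact n) fun n₁ n₀ => M.act n₁ m ⊗ₜ[k] n₀ := by
  refine (sweedler_eq (N.coact n) ((TensorProduct.comm k N M).toLinearMap ∘ₗ
    (LinearMap.flip (evalE M.act)) m) _ fun a b => rfl).symm

end FdYD

/-! ### Duals in the Drinfeld centre -/

namespace CategoryTheory
universe v₁ u₁
variable {C : Type u₁} [Category.{v₁} C] [MonoidalCategory C]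

/-- Transport of a half-braiding along an isomorphism. -/
def HalfBraiding.transport {X Y : C} (b : HalfBraiding X) (i : X ≅ Y) : HalfBraiding Y where
  β U := whiskerRightIso i.symm U ≪≫ b.β U ≪≫ whiskerLeftIso U i
  monoidal U U' := by
    have h : ∀ {P Q : C} (f : P ⟶ U ⊗ X ⊗ U') (g : U ⊗ X ⊗ U' ⟶ Q),
        f ≫ U ◁ (i.hom ▷ U') ≫ U ◁ (i.inv ▷ U') ≫ g = f ≫ g := by
      intro P Q f g
      rw [← whiskerLeft_comp_assoc, ← comp_whiskerRight, i.hom_inv_id]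
      simp
    simp only [Iso.trans_hom, whiskerRightIso_hom, Iso.symm_hom, whiskerLeftIso_hom, b.monoidal]
    calc
      _ = 𝟙 _ ⊗≫ i.inv ▷ U ▷ U' ⊗≫ (((b.β U).hom ▷ U' ≫ (α_ U X U').hom) ≫ U ◁ (b.β U').hom) ⊗≫
          U ◁ U' ◁ i.hom ⊗≫ 𝟙 _ := by monoidal
      _ = 𝟙 _ ⊗≫ i.inv ▷ U ▷ U' ⊗≫ (((b.β U).hom ▷ U' ≫ (α_ U X U').hom) ≫
          U ◁ (i.hom ▷ U') ≫ U ◁ (i.inv ▷ U') ≫ U ◁ (b.β U').hom) ⊗≫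
          U ◁ U' ◁ i.hom ⊗≫ 𝟙 _ := by rw [h]
      _ = _ := by monoidal
  naturality {U U'} f := by
    simp only [Iso.trans_hom, whiskerRightIso_hom, Iso.symm_hom, whiskerLeftIso_hom, Category.assoc]
    rw [whisker_exchange_assoc, b.naturality_assoc, whisker_exchange]

/-- The transported object is isomorphic to the given one. -/
noncomputable def Center.transportIso (X : Center C) {Y : C} (i : X.1 ≅ Y) :
    X ≅ (⟨Y, X.2.transport i⟩ : Center C) :=
  have : IsIso i.hom := inferInstance
  Center.isoMk ⟨i.hom, fun U => by
    change i.hom ▷ U ≫ (i.inv ▷ U ≫ (X.2.β U).hom ≫ U ◁ i.hom) = (X.2.β U).hom ≫ U ◁ i.hom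
    rw [← comp_whiskerRight_assoc, i.hom_inv_id]
    simp⟩

/-- The forgetful functor from the centre preserves dualities. -/
@[reducible]
noncomputable def Center.pairingFst (X Y : Center C) [ExactPairing X Y] : ExactPairing X.1 Y.1 where
  coevaluation' := (η_ X Y).f
  evaluation' := (ε_ X Y).f
  coevaluation_evaluation' := by
    have h := congrArg Center.Hom.f (coevaluation_evaluation X Y)
    refine Eq.trans ?_ (h.trans (congrArg ((ρ_ Y.1).hom ≫ ·) (Center.leftUnitor_inv_f Y)))
    exact congrArg (Y.1 ◁ (η_ X Y).f ≫ · ≫ (ε_ X Y).f ▷ Y.1) (Center.associator_inv_f Y X Y).symm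
  evaluation_coevaluation' := by
    have h := congrArg Center.Hom.f (evaluation_coevaluation X Y)
    exact h.trans (congrArg ((λ_ X.1).hom ≫ ·) (Center.rightUnitor_inv_f X))

theorem rightDualIso_comp_evaluation {X Y₁ Y₂ : C} (p₁ : ExactPairing X Y₁)
    (p₂ : ExactPairing X Y₂) :
    (rightDualIso p₁ p₂).inv ▷ X ≫ ε_ X Y₁ = ε_ X Y₂ := by
  have h := @rightAdjointMate_comp_evaluation C _ _ X X ⟨Y₁⟩ ⟨Y₂⟩ (𝟙 X)
  rw [MonoidalCategory.whiskerLeft_id, Category.id_comp] at h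
  exact h

/-- If the object `M` of the centre has a left dual in the centre, every right dual of the
underlying object underlies a right dual in the centre, with the same evaluation. -/
theorem Center.exists_rightDual (R M : Center C) [ExactPairing R M] (L : C)
    [pL : ExactPairing M.1 L] : ∃ (b : HalfBraiding L) (p : ExactPairing M (⟨L, b⟩ : Center C)),
      p.evaluation'.f = ε_ M.1 L := by
  -- The braiding makes `R` a dual on the other side; uniqueness of duals moves it to `L`.
  let p := BraidedCategory.exactPairing_swap R M
  let i : R.1 ≅ L := rightDualIso (Center.pairingFst M R) pL
  let j := Center.transportIso R i
  refine ⟨R.2.transport i, exactPairingCongrRight j.symm, ?_⟩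
  have h := rightDualIso_comp_evaluation (Center.pairingFst M R) pL
  have hj : j.inv.f = i.inv := by
    have h2 : j.inv.f ≫ i.hom = 𝟙 _ := congrArg Center.Hom.f j.inv_hom_id
    exact (Iso.eq_comp_inv i).2 h2 |>.trans (Category.id_comp _)
  refine Eq.trans ?_ h
  exact congrArg (fun f => f ▷ M.1 ≫ (ε_ M R).f) hj

/-- A morphism to the unit that is a map of the centre intertwines the half-braidings. -/
theorem Center.evaluation_comm {X Y : Center C} (e : X ⊗ Y ⟶ 𝟙_ (Center C)) (U : C) :
    e.f ▷ U ≫ (λ_ U).hom ≫ (ρ_ U).inv = (α_ X.1 Y.1 U).hom ≫ X.1 ◁ (Y.2.β U).hom ≫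
      (α_ X.1 U Y.1).inv ≫ (X.2.β U).hom ▷ Y.1 ≫ (α_ U X.1 Y.1).hom ≫ U ◁ e.f := by
  have h := e.comm U
  simp only [Center.tensorUnit_β, Center.tensor_β, Iso.trans_hom, Iso.symm_hom, whiskerLeftIso_hom,
    whiskerRightIso_hom] at h
  have assoc : ∀ {P₀ P₁ P₂ P₃ P₄ P₅ P₆ : C} (f₁ : P₀ ⟶ P₁) (f₂ : P₁ ⟶ P₂) (f₃ : P₂ ⟶ P₃)
      (f₄ : P₃ ⟶ P₄) (f₅ : P₄ ⟶ P₅) (g : P₅ ⟶ P₆),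
      (f₁ ≫ f₂ ≫ f₃ ≫ f₄ ≫ f₅) ≫ g = f₁ ≫ f₂ ≫ f₃ ≫ f₄ ≫ f₅ ≫ g := by
    intros; simp only [Category.assoc]
  exact h.trans (assoc _ _ _ _ _ _)

/-- The half-braiding of `Y` with a dual `U'` of `U`, from that of `X` with `U`, where `Y` is a dual
of `X`. Here `d` stands for the transpose of `bX⁻¹`, with respect to the duals `V` of `X ⊗ U` and
`W` of `U ⊗ X`. -/
theorem halfBraiding_dual_formula {X Y U X' U' V W : C} [ExactPairing Y X] [ExactPairing X' X]
    [ExactPairing U' U] [ExactPairing V (X ⊗ U)] [ExactPairing W (U ⊗ X)]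
    {bX : HalfBraiding X} {bY : HalfBraiding Y}
    (h : ∀ U, ε_ Y X ▷ U ≫ (λ_ U).hom ≫ (ρ_ U).inv = (α_ X Y U).hom ≫ X ◁ (bY.β U).hom ≫
      (α_ X U Y).inv ≫ (bX.β U).hom ▷ Y ≫ (α_ U X Y).hom ≫ U ◁ ε_ Y X)
    (j : Y ⟶ X') (hj : X ◁ j ≫ ε_ X' X = ε_ Y X)
    (d : V ⟶ W) (hd : (U ⊗ X) ◁ d ≫ ε_ W (U ⊗ X) = (bX.β U).inv ▷ V ≫ ε_ V (X ⊗ U)) :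
    U' ◁ j ≫ mate V (U' ⊗ X') (X ⊗ U) ≫ d ≫ mate (X' ⊗ U') W (U ⊗ X) =
      (bY.β U').inv ≫ j ▷ U' := by
  have e1 : (X ⊗ U) ◁ (U' ◁ j) ≫ ε_ (U' ⊗ X') (X ⊗ U) = ε_ (U' ⊗ Y) (X ⊗ U) := by
    calc
      _ = 𝟙 _ ⊗≫ X ◁ ((U ⊗ U') ◁ j ≫ ε_ U' U ▷ X') ⊗≫ ε_ X' X := by
        rw [tensor_evaluation]; monoidal
      _ = 𝟙 _ ⊗≫ X ◁ ε_ U' U ▷ Y ⊗≫ (X ◁ j ≫ ε_ X' X) := by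
        rw [whisker_exchange]; monoidal
      _ = _ := by rw [hj, tensor_evaluation]
  have e2 : (U ⊗ X) ◁ (j ▷ U') ≫ ε_ (X' ⊗ U') (U ⊗ X) = ε_ (Y ⊗ U') (U ⊗ X) := by
    calc
      _ = 𝟙 _ ⊗≫ U ◁ (X ◁ j ≫ ε_ X' X) ▷ U' ⊗≫ ε_ U' U := by
        rw [tensor_evaluation]; monoidal
      _ = _ := by rw [hj, tensor_evaluation]
  refine hom_ext_evaluation (W := U ⊗ X) ?_
  simp only [MonoidalCategory.whiskerLeft_comp, Category.assoc]
  rw [whiskerLeft_mate_evaluation, hd, whisker_exchange_assoc, whiskerLeft_mate_evaluation,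
    whisker_exchange_assoc, e1, e2]
  exact halfBraiding_dual_transpose bX bY h U' U

end CategoryTheory

/-! ### Dual actions -/

namespace Coaction
variable {k : Type*} [Field k]
variable {D E U M N P Q V : Type*}
  [AddCommGroup D] [Module k D] [AddCommGroup E] [Module k E]
  [AddCommGroup U] [Module k U] [AddCommGroup M] [Module k M] [AddCommGroup N] [Module k N]
  [AddCommGroup P] [Module k P] [AddCommGroup Q] [Module k Q] [AddCommGroup V] [Module k V]

/-- The transposed action `h ↦ (φ ↦ φ ∘ Φ(t h))`, where `t` is usually an antipode. -/
noncomputable def transposeAct (t : E →ₗ[k] D) (Φ : D →ₗ[k] M →ₗ[k] N) :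
    E →ₗ[k] Module.Dual k N →ₗ[k] Module.Dual k M :=
  Module.Dual.transpose ∘ₗ Φ ∘ₗ t

@[simp] theorem transposeAct_apply (t : E →ₗ[k] D) (Φ : D →ₗ[k] M →ₗ[k] N) (h : E)
    (φ : Module.Dual k N) (m : M) : transposeAct t Φ h φ m = φ (Φ (t h) m) := rfl

/-- Applying `Θ` through the dual coaction of `U` is transposed to applying `Ξ` through the coaction
of `U`. -/
theorem tensorDual_braid [FiniteDimensional k U] [FiniteDimensional k N] (δ : U →ₗ[k] D ⊗[k] U)
    (s : D →ₗ[k] E) (Θ : E →ₗ[k] P →ₗ[k] Module.Dual k N) (Ξ : D →ₗ[k] N →ₗ[k] N)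
    (κ : P →ₗ[k] Module.Dual k N) (h : ∀ d p n, Θ (s d) p n = κ p (Ξ d n))
    (a : Module.Dual k U ⊗[k] P) (t : U ⊗[k] N) :
    tensorDual k U N (braid (dualCoact s δ) Θ a) t =
      tensorDual k N U (κ.lTensor _ a) (braid δ Ξ t) := by
  suffices hh : (tensorDual k U N).toLinearMap ∘ₗ braid (dualCoact s δ) Θ =
      LinearMap.lcomp k k (braid δ Ξ) ∘ₗ (tensorDual k N U).toLinearMap ∘ₗ κ.lTensor _ from
    LinearMap.congr_fun (LinearMap.congr_fun hh a) t
  refine TensorProduct.ext' fun ξ p => TensorProduct.ext' fun u n => ?_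
  let g : E →ₗ[k] k := LinearMap.applyₗ n ∘ₗ Θ.flip p
  have h1 : ∀ a : E ⊗[k] Module.Dual k U, tensorDual k U N (TensorProduct.comm k _ _
      (evalE Θ a p)) (u ⊗ₜ[k] n) = (TensorProduct.lid k (Module.Dual k U) (g.rTensor _ a)) u := by
    intro a
    induction a using TensorProduct.induction_on with
    | zero => simp
    | add x y hx hy => simp only [map_add, hx, hy, LinearMap.add_apply]
    | tmul d u => simp [g, mul_comm]
  have h2 : ∀ t : D ⊗[k] U, tensorDual k N U (ξ ⊗ₜ[k] κ p) (TensorProduct.comm k _ _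
      (evalE Ξ t n)) = ξ (TensorProduct.lid k U ((g ∘ₗ s).rTensor _ t)) := by
    intro t
    induction t using TensorProduct.induction_on with
    | zero => simp
    | add x y hx hy => simp only [map_add, hx, hy, LinearMap.add_apply]
    | tmul d u => simp [g, h]
  refine (h1 _).trans (Eq.trans ?_ (h2 _).symm)
  exact LinearMap.congr_fun (op_dualCoact s δ g ξ) u

/-- Functionals applied before and after `braid` can be absorbed into the family of operators. -/
theorem op_braid_op [Coalgebra k D] {δ : U →ₗ[k] D ⊗[k] U} (hδ : IsCoaction δ)
    (δM : M →ₗ[k] D ⊗[k] M) (δN : N →ₗ[k] D ⊗[k] N)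
    (ψ₁ ψ₂ : D ⊗[k] D →ₗ[k] k) (Θ : D →ₗ[k] M →ₗ[k] N) :
    op (tens δN δ) ψ₂ ∘ₗ braid δ Θ ∘ₗ op (tens δ δM) ψ₁ =
      braid δ (cmp (cmp (op δM ∘ₗ TensorProduct.curry ψ₁) Θ)
        (op δN ∘ₗ TensorProduct.curry (ψ₂ ∘ₗ (TensorProduct.comm k D D).toLinearMap))) := by
  rw [op_tens δ δM, braid, braid, ← LinearMap.comp_assoc, ← LinearMap.comp_assoc, op_tens_comm,
    ← opE_opE hδ, ← opE_opE hδ]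
  rfl

theorem apply_op_op (δM : M →ₗ[k] D ⊗[k] M) (δN : N →ₗ[k] E ⊗[k] N)
    (ψ₁ : D →ₗ[k] k) (ψ₂ : E →ₗ[k] k) (A : M →ₗ[k] N) (φ : N →ₗ[k] k) (m : M) :
    φ (op δN ψ₂ (A (op δM ψ₁ m))) = sweedler (δM m) fun m₁ m₀ => sweedler (δN (A m₀)) fun p₁ p₀ =>
      ψ₁ m₁ * ψ₂ p₁ * φ p₀ := by
  rw [op_eq_sweedler δM, sweedler, sweedler, map_sum, map_sum, map_sum]
  refine Finset.sum_congr rfl fun p _ => ?_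
  rw [map_smul, map_smul, map_smul, op_eq_sweedler, sweedler, sweedler, map_sum, smul_eq_mul,
    Finset.mul_sum]
  refine Finset.sum_congr rfl fun q _ => ?_
  rw [map_smul, smul_eq_mul, mul_assoc]

theorem IsAntiCoalg.comul_apply [Coalgebra k D] [Coalgebra k E] {s : D →ₗ[k] E}
    (hs : IsAntiCoalg s) (d : D) : comul (R := k) (s d) =
      TensorProduct.comm k E E (TensorProduct.map s s (comul (R := k) d)) := by
  refine eq_of_forall_functional fun φ => ?_
  rw [← sub_eq_zero, ← Module.forall_dual_apply_eq_zero_iff k]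
  intro ψ
  have h1 := LinearMap.congr_fun (hs.dconv_comp φ ψ) d
  rw [map_sub, sub_eq_zero]
  have e1 : ∀ t : E ⊗[k] E, ψ (TensorProduct.lid k E (φ.rTensor E t)) =
      TensorProduct.lift ((LinearMap.mul k k).compl₁₂ φ ψ) t := by
    intro t
    induction t using TensorProduct.induction_on with
    | zero => simp
    | add x y hx hy => simp only [map_add, hx, hy]
    | tmul d u => simp
  have e2 : ∀ t : D ⊗[k] D, TensorProduct.lift ((LinearMap.mul k k).compl₁₂ φ ψ)
      (TensorProduct.comm k E E (TensorProduct.map s s t)) =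
      TensorProduct.lift ((LinearMap.mul k k).compl₁₂ (ψ ∘ₗ s) (φ ∘ₗ s)) t := by
    intro t
    induction t using TensorProduct.induction_on with
    | zero => simp
    | add x y hx hy => simp only [map_add, hx, hy]
    | tmul d u => simp [mul_comm]
  rw [e1, e1, e2]
  exact h1

theorem cmp_antiCoalg [Coalgebra k D] [Coalgebra k E] {s : D →ₗ[k] E}
    (hs : IsAntiCoalg s) (Φ : E →ₗ[k] M →ₗ[k] N) (Ψ : E →ₗ[k] N →ₗ[k] P) (d : D) (m : M) :
    cmp Φ Ψ (s d) m = cop2 k d fun a b => Ψ (s a) (Φ (s b) m) := by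
  let G : E ⊗[k] E →ₗ[k] P := TensorProduct.lift (LinearMap.flip (Ψ.compl₂ (Φ.flip m)))
  rw [cmp_apply_sweedler, cop2_eq (s d) G (fun a b => Ψ b (Φ a m)) fun a b => rfl, hs.comul_apply]
  exact (cop2_eq d (G ∘ₗ (TensorProduct.comm k E E).toLinearMap ∘ₗ TensorProduct.map s s) _
    fun a b => rfl).symm

theorem cmp_cmp_antiCoalg [Coalgebra k D] [Coalgebra k E] {s : D →ₗ[k] E}
    (hs : IsAntiCoalg s) (Φ : E →ₗ[k] M →ₗ[k] N) (Ψ : E →ₗ[k] N →ₗ[k] P) (Θ : E →ₗ[k] P →ₗ[k] Q)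
    (d : D) (m : M) :
    cmp (cmp Φ Ψ) Θ (s d) m = cop3 k d fun a b c => Θ (s a) (Ψ (s b) (Φ (s c) m)) := by
  rw [cmp_antiCoalg hs]
  refine congrArg (cop2 k d) (funext fun a => funext fun b => ?_)
  rw [cmp_antiCoalg hs]
  simp [cop2, sweedler]

theorem map_cop3 [Coalgebra k D] (f : V →ₗ[k] P) (d : D) (F : D → D → D → V) :
    f (cop3 k d F) = cop3 k d fun a b c => f (F a b c) := by
  simp [cop3, cop2, sweedler]

end Coaction

namespace FdComod

variable {k : Type u} {H : Type v} [Field k] [NonAssocRing H] [Module k H]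
  [IsScalarTower k H H] [SMulCommClass k H H] [Coalgebra k H] [DualQuasiHopfAlgebra k H]

/-- The transpose of a colinear map is colinear. -/
noncomputable def dualMap {W W' : FdComod k H} (f : W ⟶ W') : dual W' ⟶ dual W :=
  let g : Module.Dual k W' →ₗ[k] Module.Dual k W := Module.Dual.transpose (Hom.lin f)
  have hg : ∀ φ, (dual W).coact (g φ) = g.lTensor H ((dual W').coact φ) := by
    refine (colinear_iff g).2 fun ψ => LinearMap.ext fun φ => ?_
    have h := (colinear_iff (Hom.lin f)).1 (Hom.map_coact f) (ψ ∘ₗ antipode)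
    refine (congrArg g (op_dualCoact antipode W'.coact ψ φ)).trans
      (Eq.trans ?_ (op_dualCoact antipode W.coact ψ (g φ)).symm)
    exact congrArg (φ ∘ₗ ·) h.symm
  Hom.mk (M := dual W') (N := dual W) g hg

theorem dualMap_evaluation {W W' : FdComod k H} (f : W ⟶ W') :
    W ◁ dualMap f ≫ ε_ (dual W) W = f ▷ dual W' ≫ ε_ (dual W') W' := by
  have h := (colinear_iff (Hom.lin f)).1 (Hom.map_coact f) β
  exact hom_ext <| TensorProduct.ext' fun w (φ : Module.Dual k W') =>
    congrArg φ (LinearMap.congr_fun h w)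

variable (X Y U : FdComod k H)

theorem op_twistF_op_twistG (t : X ⊗[k] Y) :
    op (tens X.coact Y.coact) (twistFFun k H)
      (op (tens X.coact Y.coact) (twistGFun k H) t) = t := by
  have h : dualTwistF X Y ≫ dualTwistG X Y = 𝟙 _ := mate_comp_mate _ _ _
  rw [← sub_eq_zero, ← Module.forall_dual_apply_eq_zero_iff k]
  intro φ
  rw [map_sub, sub_eq_zero, ← dualTwistF_lin]
  refine (dualTwistG_lin X Y (Hom.lin (dualTwistF X Y) φ) t).symm.trans ?_
  exact congrArg (fun z : Module.Dual k (X ⊗[k] Y) => z t)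
    (LinearMap.congr_fun (congrArg Hom.lin h) φ)

theorem dualTwist_dualMap (T : U ⊗ X ⟶ X ⊗ U) (a : Module.Dual k U ⊗[k] Module.Dual k X)
    (t : U ⊗[k] X) :
    tensorDual k U X (Hom.lin (dualTwistG X U ≫ dualMap T ≫ dualTwistF U X) a) t =
      tensorDual k X U a (op (tens X.coact U.coact) (twistGFun k H)
        (Hom.lin T (op (tens U.coact X.coact) (twistFFun k H) t))) := by
  refine (dualTwistF_lin U X (Hom.lin (dualMap T) (Hom.lin (dualTwistG X U) a)) t).trans ?_
  exact dualTwistG_lin X U a _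

end FdComod

namespace Coaction
variable {k : Type*} [Field k] {D V M : Type*} [AddCommGroup D] [Module k D] [AddCommGroup V]
  [Module k V] [AddCommGroup M] [Module k M] [Coalgebra k D]

theorem cop3_smul (d : D) (F : D → D → D → k) (v : V) :
    cop3 k d F • v = cop3 k d fun a b c => F a b c • v := by
  simp [cop3, cop2, sweedler, Finset.sum_smul]

theorem cmp_cmp_transposeAct [FiniteDimensional k M] (δ : M →ₗ[k] D ⊗[k] M) (t s : D →ₗ[k] D)
    (ψ₁ ψ₂ : D ⊗[k] D →ₗ[k] k) (Φ : D →ₗ[k] M →ₗ[k] M) (d : D) (φ : Module.Dual k M) (m : M) :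
    cmp (cmp (op (dualCoact t δ) ∘ₗ TensorProduct.curry ψ₁) (transposeAct s Φ))
      (op (dualCoact t δ) ∘ₗ TensorProduct.curry ψ₂) d φ m =
    cop3 k d fun a b c => φ (op δ (TensorProduct.curry ψ₁ a ∘ₗ t) (Φ (s b)
      (op δ (TensorProduct.curry ψ₂ c ∘ₗ t) m))) := by
  rw [cmp_cmp_apply_sweedler]
  refine (map_cop3 (LinearMap.applyₗ (R := k) m) d _).trans ?_
  refine congrArg (cop3 k d) (funext fun a => funext fun b => funext fun c => ?_)
  rw [LinearMap.comp_apply, LinearMap.comp_apply, op_dualCoact, op_dualCoact]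
  rfl

end Coaction

namespace FdYD

variable {k : Type u} {H : Type v} [Field k] [NonAssocRing H] [Module k H]
  [IsScalarTower k H H] [SMulCommClass k H H] [Coalgebra k H] [DualQuasiHopfAlgebra k H]
variable (hs : Function.Bijective (antipode (k := k) (H := H)))
variable (M : FdYD k H)

/-! ### Duals of Yetter-Drinfeld modules -/

/-- The action of `H` on the dual `*M`, with the functionals `f` and `g` acting through the coaction
of `M` before the result is transposed along `s⁻¹`. -/
noncomputable def dualAct : H →ₗ[k] Module.Dual k M →ₗ[k] Module.Dual k M :=
  transposeAct (sInv k hs) (cmp (cmp (op M.coact ∘ₗ TensorProduct.curry (twistFFun k H)) M.act)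
    (op M.coact ∘ₗ TensorProduct.curry (twistGFun k H ∘ₗ (TensorProduct.comm k H H).toLinearMap)))

/-- The action of `H` on the dual `M*`: the transpose of the action of `M` along `s`, conjugated by
the functionals `g` and `f` acting through the coaction of `M*`. -/
noncomputable def codualAct : H →ₗ[k] Module.Dual k M →ₗ[k] Module.Dual k M :=
  cmp (cmp (op (dualCoact (sInv k hs) M.coact) ∘ₗ TensorProduct.curry (twistGFun k H))
      (transposeAct (antipode (k := k)) M.act))
    (op (dualCoact (sInv k hs) M.coact) ∘ₗ
      TensorProduct.curry (twistFFun k H ∘ₗ (TensorProduct.comm k H H).toLinearMap))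

theorem dualAct_apply {ι : Type*} [Fintype ι] (b : Module.Basis ι k M) (h : H)
    (φ : Module.Dual k M) :
    dualAct hs M h φ = ∑ i, cop3 k h fun h₁ h₂ h₃ => sweedler (M.coact (b i)) fun m₁ m₀ =>
      sweedler (M.coact (M.act (sInv k hs h₂) m₀)) fun p₁ p₀ =>
        (twistF k (sInv k hs h₃) m₁ * twistG k p₁ (sInv k hs h₁) * φ p₀) • b.coord i := by
  rw [← b.sum_dual_apply_smul_coord (dualAct hs M h φ)]
  refine Finset.sum_congr rfl fun i _ => ?_
  rw [dualAct, transposeAct_apply, cmp_cmp_antiCoalg (isAntiCoalg_sInv hs), map_cop3]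
  refine (cop3_smul h _ (b.coord i)).trans ?_
  refine congrArg (cop3 k h) (funext fun h₁ => funext fun h₂ => funext fun h₃ => ?_)
  rw [LinearMap.comp_apply, LinearMap.comp_apply, apply_op_op]
  simp only [sweedler, Finset.sum_smul, TensorProduct.curry_apply, LinearMap.comp_apply,
    LinearEquiv.coe_coe, TensorProduct.comm_tmul, twistFFun_tmul, twistGFun_tmul]

theorem codualAct_apply {ι : Type*} [Fintype ι] (b : Module.Basis ι k M) (h : H)
    (φ : Module.Dual k M) :
    codualAct hs M h φ = ∑ i, cop3 k h fun h₁ h₂ h₃ => sweedler (M.coact (b i)) fun m₁ m₀ =>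
      sweedler (M.coact (M.act (s k h₂) m₀)) fun p₁ p₀ =>
        (twistF k (sInv k hs m₁) h₃ * twistG k h₁ (sInv k hs p₁) * φ p₀) • b.coord i := by
  rw [← b.sum_dual_apply_smul_coord (codualAct hs M h φ)]
  refine Finset.sum_congr rfl fun i _ => ?_
  rw [codualAct, cmp_cmp_transposeAct]
  refine (cop3_smul h _ (b.coord i)).trans ?_
  refine congrArg (cop3 k h) (funext fun h₁ => funext fun h₂ => funext fun h₃ => ?_)
  rw [apply_op_op]
  simp only [sweedler, Finset.sum_smul, TensorProduct.curry_apply, LinearMap.comp_apply,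
    LinearEquiv.coe_coe, TensorProduct.comm_tmul, twistFFun_tmul, twistGFun_tmul]

theorem dualCoact_eq_sweedler {ι : Type*} [Fintype ι] (b : Module.Basis ι k M) (t : H →ₗ[k] H)
    (φ : Module.Dual k M) :
    dualCoact t M.coact φ = ∑ i, sweedler (M.coact (b i)) fun m₁ m₀ =>
      φ m₀ • (t m₁ ⊗ₜ[k] b.coord i) := by
  rw [dualCoact_apply b]
  refine Finset.sum_congr rfl fun i _ => ?_
  refine (sweedler_eq (M.coact (b i)) ((TensorProduct.mk k H _).flip (b.coord i) ∘ₗ t ∘ₗ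
    (TensorProduct.rid k H).toLinearMap ∘ₗ φ.lTensor H) _ fun h m => ?_).symm
  simp [TensorProduct.smul_tmul']

variable [∀ U : FdComod k H, HasRightDual U]

/-- The dual `*M` as an object of the centre of the category of comodules. -/
noncomputable abbrev centerDual : Center (FdComod k H) :=
  Center.leftDual (M := M.toComod) (FdComod.dual M.toComod) M.centerObj.2

/-- The duality between `M` and `centerDual M`. -/
@[reducible]
noncomputable def centerDualPairing : ExactPairing (centerDual M) ((toCenter k H).obj M) :=
  Center.leftDualPairing (M := M.toComod) (FdComod.dual M.toComod) M.centerObj.2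

/-- The half-braiding of `*M` with `dual U` is the transpose of the one of `M` with `U`, up to the
comparison maps for the duals of `M ⊗ U` and `U ⊗ M`. -/
theorem centerDual_formula (U : FdComod k H) :
    FdComod.dualTwistG M.toComod U ≫ FdComod.dualMap (M.braidHom U) ≫
      FdComod.dualTwistF U M.toComod = ((centerDual M).2.β (FdComod.dual U)).inv := by
  have key := halfBraiding_dual_formula (X := M.toComod) (Y := FdComod.dual M.toComod) (U := U)
    (X' := FdComod.dual M.toComod) (U' := FdComod.dual U) (V := FdComod.dual (M.toComod ⊗ U))
    (W := FdComod.dual (U ⊗ M.toComod)) (bX := M.centerObj.2) (bY := (centerDual M).2)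
    (Center.evaluation_comm (X := M.centerObj) (Y := centerDual M)
      (centerDualPairing M).evaluation') (𝟙 _) (by simp) (FdComod.dualMap (M.braidHom U))
    (FdComod.dualMap_evaluation _)
  rw [MonoidalCategory.whiskerLeft_id, Category.id_comp, id_whiskerRight] at key
  exact key.trans (Category.comp_id _)

/-- The definition of `dualAct` is forced: this is the transposed half-braiding, conjugated by the
twists. -/
theorem transpose_braid (U : FdComod k H) (a : Module.Dual k U ⊗[k] Module.Dual k M)
    (t : U ⊗[k] M) :
    tensorDual k M U a (op (tens M.coact U.coact) (twistGFun k H)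
      (braid U.coact M.act (op (tens U.coact M.coact) (twistFFun k H) t))) =
    tensorDual k U M (braid (FdComod.dual U).coact (dualAct hs M) a) t := by
  refine Eq.trans ?_ (tensorDual_braid U.coact antipode (dualAct hs M)
    (cmp (cmp (op M.coact ∘ₗ TensorProduct.curry (twistFFun k H)) M.act)
      (op M.coact ∘ₗ TensorProduct.curry (twistGFun k H ∘ₗ
        (TensorProduct.comm k H H).toLinearMap))) LinearMap.id (fun h φ m => ?_) a t).symm
  rotate_left
  · rw [dualAct, transposeAct_apply]
    exact congrArg (fun d => φ (cmp (cmp (op M.coact ∘ₗ TensorProduct.curry (twistFFun k H)) M.act)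
      (op M.coact ∘ₗ TensorProduct.curry (twistGFun k H ∘ₗ
        (TensorProduct.comm k H H).toLinearMap)) d m))
      (LinearMap.congr_fun (FdComod.sInv_comp_antipode hs) h)
  rw [LinearMap.lTensor_id]
  exact congrArg (tensorDual k M U a) (LinearMap.congr_fun (op_braid_op U.isCoaction M.coact M.coact
    (twistFFun k H) (twistGFun k H) M.act) t)

theorem centerDual_inv_dual (U : FdComod k H) :
    FdComod.Hom.lin ((centerDual M).2.β (FdComod.dual U)).inv =
      braid (FdComod.dual U).coact (dualAct hs M) := by
  have h1 : ∀ a t, tensorDual k U M (FdComod.Hom.lin (FdComod.dualTwistG M.toComod U ≫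
      FdComod.dualMap (M.braidHom U) ≫ FdComod.dualTwistF U M.toComod) a) t =
      tensorDual k U M (braid (FdComod.dual U).coact (dualAct hs M) a) t := fun a t =>
    (FdComod.dualTwist_dualMap M.toComod U (M.braidHom U) a t).trans (transpose_braid hs M U a t)
  have h2 : FdComod.Hom.lin (FdComod.dualTwistG M.toComod U ≫
      FdComod.dualMap (M.braidHom U) ≫ FdComod.dualTwistF U M.toComod) =
      braid (FdComod.dual U).coact (dualAct hs M) :=
    LinearMap.ext fun a => (tensorDual k U M).injective (LinearMap.ext fun t => h1 a t)
  exact (congrArg FdComod.Hom.lin (centerDual_formula M U)).symm.trans h2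

/-- The half-braiding of `*M` comes from `dualAct`. Every comodule is isomorphic to a dual, so this
follows from `centerDual_inv_dual`. -/
theorem centerDual_inv (U : FdComod k H) :
    FdComod.Hom.lin ((centerDual M).2.β U).inv = braid U.coact (dualAct hs M) := by
  let e := FdComod.evalIso hs U
  let T := FdComod.Hom.lin ((centerDual M).2.β U).inv
  have h1 : braid (FdComod.dual (FdComod.codual hs U)).coact (dualAct hs M) ∘ₗ
      (Module.evalEquiv k U).toLinearMap.rTensor (Module.Dual k M) =
      (Module.evalEquiv k U).toLinearMap.lTensor (Module.Dual k M) ∘ₗ T :=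
    (congrArg (· ∘ₗ (Module.evalEquiv k U).toLinearMap.rTensor (Module.Dual k M))
      (centerDual_inv_dual hs M (FdComod.codual hs U)).symm).trans
      (congrArg FdComod.Hom.lin ((centerDual M).2.toLax.naturality e.hom))
  have h2 := braid_natural (FdComod.Hom.map_coact e.hom) (dualAct hs M)
  have h3 : Function.Injective
      ((Module.evalEquiv k U).toLinearMap.lTensor (Module.Dual k M)) :=
    ((Module.evalEquiv k U).lTensor (Module.Dual k M)).injective
  exact LinearMap.ext fun t => h3 (LinearMap.congr_fun (h1.symm.trans h2) t)

/-- The dual `M*` carries a half-braiding that makes it a dual of `M` in the centre, with the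
evaluation of comodules. -/
theorem exists_centerCodual : ∃ (b : HalfBraiding (FdComod.codual hs M.toComod))
    (p : ExactPairing ((toCenter k H).obj M)
      (⟨FdComod.codual hs M.toComod, b⟩ : Center (FdComod k H))),
    p.evaluation'.f = (FdComod.codualPairing hs M.toComod).evaluation' :=
  @Center.exists_rightDual _ _ _ (centerDual M) M.centerObj (centerDualPairing M) _
    (pL := FdComod.codualPairing hs M.toComod)

variable (b : HalfBraiding (FdComod.codual hs M.toComod))
    (p : ExactPairing ((toCenter k H).obj M)
      (⟨FdComod.codual hs M.toComod, b⟩ : Center (FdComod k H)))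

/-- Since `M` is a dual of `M*` on the same side as before, the half-braiding of `M` is the
transpose of the one of `M*` up to comparison maps. -/
theorem centerCodual_formula
    (hp : p.evaluation'.f = (FdComod.codualPairing hs M.toComod).evaluation')
    (U : FdComod k H) :
    FdComod.dual U ◁ (FdComod.evalIso hs M.toComod).hom ≫
    FdComod.dualTwistG (FdComod.codual hs M.toComod) U ≫ FdComod.dualMap (b.β U).inv ≫
      FdComod.dualTwistF U (FdComod.codual hs M.toComod) =
    M.braidHom (FdComod.dual U) ≫ (FdComod.evalIso hs M.toComod).hom ▷ FdComod.dual U := by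
  let _ := FdComod.codualPairing hs M.toComod
  refine halfBraiding_dual_formula (X := FdComod.codual hs M.toComod) (Y := M.toComod) (U := U)
    (X' := FdComod.dual (FdComod.codual hs M.toComod)) (U' := FdComod.dual U)
    (V := FdComod.dual (FdComod.codual hs M.toComod ⊗ U))
    (W := FdComod.dual (U ⊗ FdComod.codual hs M.toComod)) (bX := b) (bY := M.centerObj.2)
    (fun V => ?_) (FdComod.evalIso hs M.toComod).hom rfl (FdComod.dualMap (b.β U).inv)
    (FdComod.dualMap_evaluation _)
  have h := Center.evaluation_comm (X := ⟨FdComod.codual hs M.toComod, b⟩) (Y := M.centerObj)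
      p.evaluation' V
  rw [hp] at h
  exact h

/-- The half-braiding of `M*`, conjugated by the twists, comes from the transposed action. -/
theorem twist_centerCodual
    (hp : p.evaluation'.f = (FdComod.codualPairing hs M.toComod).evaluation')
    (U : FdComod k H) (t : U ⊗[k] Module.Dual k M) :
    op (tens (dualCoact (sInv k hs) M.coact) U.coact) (twistGFun k H)
      (FdComod.Hom.lin (b.β U).inv
        (op (tens U.coact (dualCoact (sInv k hs) M.coact)) (twistFFun k H) t)) =
    braid U.coact (transposeAct (antipode (k := k)) M.act) t := by
  let ev : M →ₗ[k] Module.Dual k (Module.Dual k M) := (Module.evalEquiv k M).toLinearMap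
  let S : Module.Dual k U ⊗[k] Module.Dual k (Module.Dual k M) →ₗ[k]
      Module.Dual k (Module.Dual k M) ⊗[k] Module.Dual k U :=
    FdComod.Hom.lin (FdComod.dualTwistG (FdComod.codual hs M.toComod) U ≫
      FdComod.dualMap (b.β U).inv ≫ FdComod.dualTwistF U (FdComod.codual hs M.toComod))
  have hf : ∀ a : Module.Dual k U ⊗[k] M, S (ev.lTensor (Module.Dual k U) a) =
      ev.rTensor (Module.Dual k U) (braid (FdComod.dual U).coact M.act a) :=
    LinearMap.congr_fun (congrArg FdComod.Hom.lin (centerCodual_formula hs M b p hp U))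
  have h1 : ∀ a : Module.Dual k U ⊗[k] M,
      tensorDual k (Module.Dual k M) U (ev.lTensor (Module.Dual k U) a)
        (op (tens (dualCoact (sInv k hs) M.coact) U.coact) (twistGFun k H)
          (FdComod.Hom.lin (b.β U).inv
            (op (tens U.coact (dualCoact (sInv k hs) M.coact)) (twistFFun k H) t))) =
      tensorDual k U (Module.Dual k M) (ev.rTensor (Module.Dual k U)
        (braid (FdComod.dual U).coact M.act a)) t := fun a =>
    (FdComod.dualTwist_dualMap (FdComod.codual hs M.toComod) U (b.β U).inv
      (ev.lTensor (Module.Dual k U) a) t).symm.trans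
      (congrArg (fun z => tensorDual k U (Module.Dual k M) z t) (hf a))
  have h2 : ∀ a : Module.Dual k U ⊗[k] M,
      tensorDual k U (Module.Dual k M) (ev.rTensor (Module.Dual k U)
        (braid (FdComod.dual U).coact M.act a)) t =
      tensorDual k (Module.Dual k M) U (ev.lTensor (Module.Dual k U) a)
        (braid U.coact (transposeAct (antipode (k := k)) M.act) t) := fun a =>
    (congrArg (fun z => tensorDual k U (Module.Dual k M) z t)
      (LinearMap.congr_fun (rTensor_braid_eq (FdComod.dual U).coact M.act ev) a)).trans
      (tensorDual_braid U.coact antipode (M.act.compr₂ ev) (transposeAct (antipode (k := k)) M.act)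
        ev (fun _ _ _ => rfl) a t)
  rw [← sub_eq_zero, ← Module.forall_dual_apply_eq_zero_iff k]
  intro φ
  -- Every functional on `M* ⊗ U` comes from `U* ⊗ M`, as `M` is finite-dimensional.
  obtain ⟨a, rfl⟩ := (tensorDual k (Module.Dual k M) U).surjective φ
  obtain ⟨a, rfl⟩ := ((Module.evalEquiv k M).lTensor (Module.Dual k U)).surjective a
  rw [map_sub, sub_eq_zero]
  exact (h1 a).trans (h2 a)

end FdYD

namespace Coaction
variable {k : Type*} [Field k] {D U M N : Type*} [AddCommGroup D] [Module k D] [AddCommGroup U]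
  [Module k U] [AddCommGroup M] [Module k M] [AddCommGroup N] [Module k N] [Coalgebra k D]

/-- A map whose conjugate under invertible twists comes from an action comes from the twisted
action. -/
theorem eq_braid_of_conj {δ : U →ₗ[k] D ⊗[k] U} (hδ : IsCoaction δ)
    {δM : M →ₗ[k] D ⊗[k] M} {δN : N →ₗ[k] D ⊗[k] N} {ψ₁ ψ₂ ψ₁' ψ₂' : D ⊗[k] D →ₗ[k] k}
    {Θ : D →ₗ[k] M →ₗ[k] N} {T : U ⊗[k] M →ₗ[k] N ⊗[k] U}
    (h₁ : ∀ t, op (tens δ δM) ψ₁' (op (tens δ δM) ψ₁ t) = t)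
    (h₂ : ∀ t, op (tens δN δ) ψ₂ (op (tens δN δ) ψ₂' t) = t)
    (hT : ∀ t, op (tens δN δ) ψ₂' (T (op (tens δ δM) ψ₁' t)) = braid δ Θ t) :
    T = braid δ (cmp (cmp (op δM ∘ₗ TensorProduct.curry ψ₁) Θ)
        (op δN ∘ₗ TensorProduct.curry (ψ₂ ∘ₗ (TensorProduct.comm k D D).toLinearMap))) := by
  rw [← op_braid_op hδ]
  refine LinearMap.ext fun t => ?_
  rw [LinearMap.comp_apply, LinearMap.comp_apply, ← hT, h₁, h₂]

end Coaction

namespace FdYD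

variable {k : Type u} {H : Type v} [Field k] [NonAssocRing H] [Module k H]
  [IsScalarTower k H H] [SMulCommClass k H H] [Coalgebra k H] [DualQuasiHopfAlgebra k H]
variable (hs : Function.Bijective (antipode (k := k) (H := H)))
variable (M : FdYD k H)

/-- The twists cancel: `codualAct` is characterised by its conjugate under them. -/
theorem eq_braid_codualAct (U : FdComod k H)
    (T : U ⊗[k] Module.Dual k M →ₗ[k] Module.Dual k M ⊗[k] U)
    (hT : ∀ t : U ⊗[k] Module.Dual k M,
      op (tens (dualCoact (sInv k hs) M.coact) U.coact) (twistGFun k H)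
        (T (op (tens U.coact (dualCoact (sInv k hs) M.coact)) (twistFFun k H) t)) =
      braid U.coact (transposeAct (antipode (k := k)) M.act) t) :
    T = braid U.coact (codualAct hs M) := by
  have hUL : ∀ t : U ⊗[k] Module.Dual k M, op (tens U.coact (dualCoact (sInv k hs) M.coact))
      (twistFFun k H) (op (tens U.coact (dualCoact (sInv k hs) M.coact)) (twistGFun k H) t) = t :=
    FdComod.op_twistF_op_twistG U (FdComod.codual hs M.toComod)
  have hLU : ∀ t : Module.Dual k M ⊗[k] U, op (tens (dualCoact (sInv k hs) M.coact) U.coact)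
      (twistFFun k H) (op (tens (dualCoact (sInv k hs) M.coact) U.coact) (twistGFun k H) t) = t :=
    FdComod.op_twistF_op_twistG (FdComod.codual hs M.toComod) U
  exact eq_braid_of_conj U.isCoaction hUL hLU hT

variable [∀ U : FdComod k H, HasRightDual U]

/-- The half-braiding of `M*` comes from `codualAct`. -/
theorem centerCodual_inv (b : HalfBraiding (FdComod.codual hs M.toComod))
    (p : ExactPairing ((toCenter k H).obj M)
      (⟨FdComod.codual hs M.toComod, b⟩ : Center (FdComod k H)))
    (hp : p.evaluation'.f = (FdComod.codualPairing hs M.toComod).evaluation') (U : FdComod k H) :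
    FdComod.Hom.lin (b.β U).inv = braid U.coact (codualAct hs M) :=
  eq_braid_codualAct hs M U _ (twist_centerCodual hs M b p hp U)

theorem exists_rightDual : ∃ R : YetterDrinfeld k H (Module.Dual k M),
    R.coact = dualCoact antipode M.coact ∧ R.act = dualAct hs M ∧
      IsRightDual (FdYD.mk (Module.Dual k M) R) M := by
  refine ⟨(ofCenter (centerDual M) (dualAct hs M) (centerDual_inv hs M)).yd, rfl, rfl, ⟨?_⟩⟩
  let _ := centerDualPairing M
  let _ : ExactPairing ((toCenter k H).obj (ofCenter (centerDual M) (dualAct hs M)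
      (centerDual_inv hs M))) ((toCenter k H).obj M) :=
    exactPairingCongrLeft (ofCenterIso (centerDual M) (dualAct hs M) (centerDual_inv hs M)).symm
  exact ExactPairing.ofFullyFaithful (toCenter k H)
    (ofCenter (centerDual M) (dualAct hs M) (centerDual_inv hs M)) M

theorem exists_leftDual : ∃ L : YetterDrinfeld k H (Module.Dual k M),
    L.coact = dualCoact (sInv k hs) M.coact ∧ L.act = codualAct hs M ∧
      IsLeftDual (FdYD.mk (Module.Dual k M) L) M := by
  obtain ⟨b, p, hp⟩ := exists_centerCodual hs M
  have h := centerCodual_inv hs M b p hp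
  refine ⟨(ofCenter ⟨FdComod.codual hs M.toComod, b⟩ (codualAct hs M) h).yd, rfl, rfl, ⟨?_⟩⟩
  let _ : ExactPairing ((toCenter k H).obj M) ((toCenter k H).obj
      (ofCenter ⟨FdComod.codual hs M.toComod, b⟩ (codualAct hs M) h)) :=
    exactPairingCongrRight
      (ofCenterIso ⟨FdComod.codual hs M.toComod, b⟩ (codualAct hs M) h).symm
  exact ExactPairing.ofFullyFaithful (toCenter k H) M
    (ofCenter ⟨FdComod.codual hs M.toComod, b⟩ (codualAct hs M) h)

end FdYD

theorem theorem3p3 (k : Type u) (H : Type v) [Field k] [NonAssocRing H] [Module k H]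
    [IsScalarTower k H H] [SMulCommClass k H H] [Coalgebra k H] [DualQuasiHopfAlgebra k H]
    (hs : Function.Bijective (s k : H →ₗ[k] H)) :
    ∃ (_ : MonoidalCategory (FdYD k H)) (_ : BraidedCategory (FdYD k H))
      (T : FdYD.StandardTensor (k := k) (H := H)),
      -- the braiding is `n ⊗ m ↦ n₍₋₁₎ · m ⊗ n₍₀₎`
      (∀ (N M : FdYD k H) (n : N) (m : M),
        FdYD.Hom.lin (β_ N M).hom (T.μ N M (n ⊗ₜ[k] m)) =
          sweedler (N.coact n) fun n₁ n₀ => T.μ M N (M.act n₁ m ⊗ₜ[k] n₀)) ∧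
      Nonempty (RigidCategory (FdYD k H)) ∧
      ∀ (M : FdYD k H) (ι : Type*) [Fintype ι] (b : Module.Basis ι k M),
        -- the right dual
        (∃ R : YetterDrinfeld k H (Module.Dual k M),
          (∀ φ : Module.Dual k M,
            R.coact φ = ∑ i, sweedler (M.coact (b i)) fun m₁ m₀ =>
              φ m₀ • (s k m₁ ⊗ₜ[k] b.coord i)) ∧
          (∀ (h : H) (φ : Module.Dual k M),
            R.act h φ = ∑ i, cop3 k h fun h₁ h₂ h₃ => sweedler (M.coact (b i)) fun m₁ m₀ =>
              sweedler (M.coact (M.act (sInv k hs h₂) m₀)) fun p₁ p₀ =>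
                (twistF k (sInv k hs h₃) m₁ * twistG k p₁ (sInv k hs h₁) * φ p₀) •
                  b.coord i) ∧
          FdYD.IsRightDual (FdYD.mk (Module.Dual k M) R) M) ∧
        -- the left dual
        (∃ L : YetterDrinfeld k H (Module.Dual k M),
          (∀ φ : Module.Dual k M,
            L.coact φ = ∑ i, sweedler (M.coact (b i)) fun m₁ m₀ =>
              φ m₀ • (sInv k hs m₁ ⊗ₜ[k] b.coord i)) ∧
          (∀ (h : H) (φ : Module.Dual k M),
            L.act h φ = ∑ i, cop3 k h fun h₁ h₂ h₃ => sweedler (M.coact (b i)) fun m₁ m₀ =>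
              sweedler (M.coact (M.act (s k h₂) m₀)) fun p₁ p₀ =>
                (twistF k (sInv k hs m₁) h₃ * twistG k h₁ (sInv k hs p₁) * φ p₀) •
                  b.coord i) ∧
          FdYD.IsLeftDual (FdYD.mk (Module.Dual k M) L) M) := by
  let _ : ∀ U : FdComod k H, HasRightDual U := FdComod.hasRightDual hs
  refine ⟨inferInstance, inferInstance, FdYD.standardTensor k H, fun N M n m => ?_, ⟨?_⟩,
    fun M ι _ b => ⟨?_, ?_⟩⟩
  · exact (LinearMap.congr_fun (FdYD.braiding_lin N M) (n ⊗ₜ[k] m)).trans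
      (FdYD.braiding_tmul N M n m)
  · choose R hR using FdYD.exists_rightDual (k := k) (H := H) hs
    let _ : LeftRigidCategory (FdYD k H) :=
      { leftDual := fun M =>
          { leftDual := FdYD.mk (Module.Dual k M) (R M), exact := (hR M).2.2.some } }
    -- In a braided category duals on one side suffice.
    exact BraidedCategory.rigidCategoryOfLeftRigidCategory
  · obtain ⟨R, hc, ha, hR⟩ := FdYD.exists_rightDual hs M
    exact ⟨R, fun φ => by rw [hc]; exact FdYD.dualCoact_eq_sweedler M b _ φ,
      fun h φ => by rw [ha]; exact FdYD.dualAct_apply hs M b h φ, hR⟩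
  · obtain ⟨L, hc, ha, hL⟩ := FdYD.exists_leftDual hs M
    exact ⟨L, fun φ => by rw [hc]; exact FdYD.dualCoact_eq_sweedler M b _ φ,
      fun h φ => by rw [ha]; exact FdYD.codualAct_apply hs M b h φ, hL⟩
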